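/- Let $d$ be a positive integer and $r,s>0$. For a probability distribution $\mu$ on $\mathbb{R}^d$ and $z\in\mathbb{R}^d$, define the sigmoid sphere depth $$SD_s(z\mid \mu)=\inf_{c\in\mathbb{R}^d:\ \|c-z\|=r}\ \mathbb{E}_{X\sim\mu}\left[\frac{1}{1+e^{-(r^2-\|X-c\|^2)/s}}\right],$$ and, for probability distributions $\mu,\nu$ on $\mathbb{R}^d$, define the Liu–Singh quality index based on $SD_s$ by $$Q(\mu,\nu)=\mathbb{P}\big(SD_s(X\mid\mu)\le SD_s(Y\mid\mu)\big),\qquad X\sim\mu,\ Y\sim\nu\ \text{independent}.$$ Let $F$ be a probability distribution on $\mathbb{R}^d$ that is absolutely continuous with respect to Lebesgue measure, has bounded support, and satisfies (A1) there is a constant $C$ such that $\mathbb{P}(d_1\le SD_s(Z\mid F)\le d_2)\le C|d_2-d_1|$ for all $d_1,d_2\in[0,1]$, where $Z\sim F$. Let $X_1,X_2,\dots,Y_1,Y_2,\dots$ be independent random vectors, all with distribution $F$, and let $F_n=\frac1n\sum_{i=1}^n\delta_{X_i}$ and $F'_m=\frac1m\sum_{j=1}^m\delta_{Y_j}$ be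 the empirical distributions of $X_1,\dots,X_n$ and of $Y_1,\dots,Y_m$. Then $$\left(\frac1{12}\left(\frac1n+\frac1m\right)\right)^{-1/2}\big(Q(F_n,F'_m)-Q(F,F)\big)\ \longrightarrow\ \mathcal{N}(0,1)\quad\text{in distribution as } n\to\infty \text{ and } m\to\infty .$$ -/

import Mathlib

open MeasureTheory ProbabilityTheory Filter
open scoped Topology ENNReal

/-- The smoothed (sigmoid) sphere depth `SD_s(z | μ)` with radius `r` and scale `s`: the infimum
over the centres `c` of the sphere `S(z, r)` of `E[sig_s (r² - ‖X - c‖²)]` with `X ∼ μ`, where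
`sig_s x = 1 / (1 + exp (-x / s))`, that is, `Real.sigmoid (x / s)`. -/
noncomputable def sphereDepth {d : ℕ} (r s : ℝ) (z : EuclideanSpace ℝ (Fin d))
    (μ : Measure (EuclideanSpace ℝ (Fin d))) : ℝ :=
  ⨅ c : Metric.sphere z r,
    ∫ x, Real.sigmoid ((r ^ 2 - ‖x - (c : EuclideanSpace ℝ (Fin d))‖ ^ 2) / s) ∂μ

/-- The Liu–Singh quality index `Q(F, G) = P(D(X | F) ≤ D(Y | F))` for independent `X ∼ F` and
`Y ∼ G`, where `D z F` stands for the depth of the point `z` with respect to `F`. -/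
noncomputable def qualityIndex {E : Type*} [MeasurableSpace E] (D : E → Measure E → ℝ)
    (F G : Measure E) : ℝ :=
  (F.prod G).real {p | D p.1 F ≤ D p.2 F}

/-- The empirical distribution `(1/n) ∑ δ_{x i}` of a sample `x` of size `n`. -/
noncomputable def empiricalDistribution {E : Type*} [MeasurableSpace E] {n : ℕ} (x : Fin n → E) :
    Measure E :=
  (n : ℝ≥0∞)⁻¹ • ∑ i, Measure.dirac (x i)

/-- Assumption (A1) for a depth `D` and a distribution `F`: for some constant `C`,
`P(d₁ ≤ D(Z | F) ≤ d₂) ≤ C |d₂ - d₁|` for all `d₁, d₂ ∈ [0, 1]`, where `Z ∼ F`. -/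
def DepthA1 {E : Type*} [MeasurableSpace E] (D : E → Measure E → ℝ) (F : Measure E) : Prop :=
  ∃ C : ℝ, ∀ d₁ ∈ Set.Icc (0 : ℝ) 1, ∀ d₂ ∈ Set.Icc (0 : ℝ) 1,
    F.real {z | d₁ ≤ D z F ∧ D z F ≤ d₂} ≤ C * |d₂ - d₁|

/-- The infimum of `g` over the sphere of radius `r` centred at `z`. -/
noncomputable def sphereInf {E : Type*} [SeminormedAddCommGroup E] (r : ℝ) (g : E → ℝ) (z : E) :
    ℝ :=
  ⨅ c : Metric.sphere z r, g c

theorem abs_ciInf_sub_ciInf_le {ι : Type*} {f g : ι → ℝ} (hf : BddBelow (Set.range f))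
    (hg : BddBelow (Set.range g)) {a : ℝ} (ha : 0 ≤ a) (h : ∀ i, |f i - g i| ≤ a) :
    |(⨅ i, f i) - ⨅ i, g i| ≤ a := by
  rcases isEmpty_or_nonempty ι with hι | hι
  · simpa using ha
  rw [abs_sub_le_iff]
  constructor
  · rw [sub_le_iff_le_add, ← sub_le_iff_le_add']
    refine le_ciInf fun i => ?_
    linarith [ciInf_le hf i, (abs_sub_le_iff.1 (h i)).1]
  · rw [sub_le_iff_le_add, ← sub_le_iff_le_add']
    refine le_ciInf fun i => ?_
    linarith [ciInf_le hg i, (abs_sub_le_iff.1 (h i)).2]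

theorem exists_tendsto_ciInf_add_mul_sub_div {ι : Type*} {g w : ι → ℝ}
    (hg : BddBelow (Set.range g)) {K : ℝ} (hw : ∀ i, |w i| ≤ K) :
    ∃ v : ℝ, Tendsto (fun ε : ℝ => ((⨅ i, (g i + ε * w i)) - ⨅ i, g i) / ε) (𝓝[>] 0) (𝓝 v) := by
  rcases isEmpty_or_nonempty ι with hι | hι
  · exact ⟨0, by simp⟩
  have hK : 0 ≤ K := (abs_nonneg _).trans (hw (Classical.arbitrary ι))
  have hbdd : ∀ ε : ℝ, BddBelow (Set.range fun i => g i + ε * w i) := by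
    rintro ε
    obtain ⟨b, hb⟩ := hg
    refine ⟨b - |ε| * K, ?_⟩
    rintro _ ⟨i, rfl⟩
    have h1 : b ≤ g i := hb ⟨i, rfl⟩
    have h2 : |ε * w i| ≤ |ε| * K := by
      rw [abs_mul]; exact mul_le_mul_of_nonneg_left (hw i) (abs_nonneg _)
    have := (abs_le.1 h2).1
    simp only
    linarith
  set φ : ℝ → ℝ := fun ε => ((⨅ i, (g i + ε * w i)) - ⨅ i, g i) / ε with hφ
  have hanti : ∀ a b : ℝ, 0 < a → a ≤ b → φ b ≤ φ a := by
    intro a b ha hab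
    have hb : 0 < b := ha.trans_le hab
    rw [hφ]
    simp only
    rw [div_le_div_iff₀ hb ha]
    have key : (1 - a / b) * (⨅ i, g i) + a / b * (⨅ i, (g i + b * w i)) ≤
        ⨅ i, (g i + a * w i) := by
      refine le_ciInf fun i => ?_
      have h1 : (1 - a / b) * (⨅ i, g i) ≤ (1 - a / b) * g i :=
        mul_le_mul_of_nonneg_left (ciInf_le hg i) (by
          rw [sub_nonneg, div_le_one hb]; exact hab)
      have h2 : a / b * (⨅ i, (g i + b * w i)) ≤ a / b * (g i + b * w i) :=
        mul_le_mul_of_nonneg_left (ciInf_le (hbdd b) i) (by positivity)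
      have h3 : (1 - a / b) * g i + a / b * (g i + b * w i) = g i + a * w i := by
        field_simp; ring
      linarith
    have h4 := mul_le_mul_of_nonneg_right key hb.le
    have h5 : ((1 - a / b) * (⨅ i, g i) + a / b * (⨅ i, (g i + b * w i))) * b =
        (b - a) * (⨅ i, g i) + a * (⨅ i, (g i + b * w i)) := by
      field_simp
    rw [h5] at h4
    linarith
  have hbd : ∀ a : ℝ, 0 < a → φ a ≤ K := by
    intro a ha
    rw [hφ]
    simp only
    rw [div_le_iff₀ ha]
    refine (le_abs_self _).trans (abs_ciInf_sub_ciInf_le (hbdd a) hg (by positivity) fun i => ?_)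
    rw [add_sub_cancel_left, abs_mul, abs_of_pos ha, mul_comm]
    exact mul_le_mul_of_nonneg_right (hw i) ha.le
  have hlim := tendsto_atTop_ciSup (f := fun x : ℝ => φ (Real.exp (-x))) (by
    intro x y hxy
    exact hanti _ _ (Real.exp_pos _) (Real.exp_le_exp.2 (by linarith)))
    ⟨K, by rintro _ ⟨x, rfl⟩; exact hbd _ (Real.exp_pos _)⟩
  refine ⟨_, (hlim.comp (tendsto_neg_atBot_atTop.comp
    Real.tendsto_log_nhdsGT_zero)).congr' ?_⟩
  filter_upwards [self_mem_nhdsWithin] with ε hε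
  simp [Real.exp_log (Set.mem_Ioi.1 hε), hφ]

section sphereInf

variable {E : Type*} [NormedAddCommGroup E] [ProperSpace E] {r : ℝ}

theorem bddBelow_range_sphere {g : E → ℝ} (hg : Continuous g) (z : E) :
    BddBelow (Set.range fun c : Metric.sphere z r => g c) := by
  have := ((isCompact_sphere z r).image hg).bddBelow
  rwa [Set.image_eq_range] at this

theorem abs_sphereInf_sub_le {g h : E → ℝ} (hg : Continuous g) (hh : Continuous h) {z : E} {a : ℝ}
    (ha : 0 ≤ a) (hgh : ∀ c ∈ Metric.sphere z r, |g c - h c| ≤ a) :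
    |sphereInf r g z - sphereInf r h z| ≤ a :=
  abs_ciInf_sub_ciInf_le (bddBelow_range_sphere hg z) (bddBelow_range_sphere hh z) ha
    fun c => hgh c c.2

theorem exists_tendsto_sphereInf_add_mul_sub_div {g w : E → ℝ} (hg : Continuous g)
    {K : ℝ} {z : E} (hw : ∀ c ∈ Metric.sphere z r, |w c| ≤ K) :
    ∃ v : ℝ, Tendsto (fun ε : ℝ => (sphereInf r (fun c => g c + ε * w c) z - sphereInf r g z) / ε)
      (𝓝[>] 0) (𝓝 v) :=
  exists_tendsto_ciInf_add_mul_sub_div (bddBelow_range_sphere hg z) fun c => hw c c.2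

theorem continuous_sphereInf {X : Type*} [TopologicalSpace X] {G : X → E → ℝ}
    (hG : Continuous fun p : X × E => G p.1 p.2) :
    Continuous fun p : X × E => sphereInf r (G p.1) p.2 := by
  have h := (isCompact_sphere (0 : E) r).continuous_sInf
    (f := fun (p : X × E) (u : E) => G p.1 (p.2 + u)) (by
      simp only [Function.HasUncurry.uncurry]
      exact hG.comp (by fun_prop : Continuous fun q : (X × E) × E => (q.1.1, q.1.2 + q.2)))
  convert h using 2 with p
  rw [sphereInf, iInf, sInf_image', iInf]
  congr 1
  ext y
  constructor
  · rintro ⟨⟨c, hc⟩, rfl⟩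
    refine ⟨⟨c - p.2, ?_⟩, ?_⟩
    · simpa [dist_eq_norm] using hc
    · simp
  · rintro ⟨⟨u, hu⟩, rfl⟩
    exact ⟨⟨p.2 + u, by simpa [dist_eq_norm] using hu⟩, rfl⟩

theorem continuous_sphereInf_right {g : E → ℝ} (hg : Continuous g) :
    Continuous (sphereInf r g) :=
  (continuous_sphereInf (X := Unit) (G := fun _ => g) (by fun_prop)).comp
    (by fun_prop : Continuous fun z : E => ((), z))

end sphereInf

/-- The distribution function of `D` restricted to the event `B`. -/
noncomputable def eventCDF {α : Type*} [MeasurableSpace α] (F : Measure α) (D : α → ℝ) (B : Set α)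
    (t : ℝ) : ℝ :=
  F.real (B ∩ {z | D z ≤ t})

section Concentration

variable {α : Type*} [MeasurableSpace α] {F : Measure α} {D : α → ℝ} {C : ℝ}

theorem measureReal_eq_singleton_zero
    (hA : ∀ a b, a ≤ b → F.real {z | D z ∈ Set.Icc a b} ≤ C * (b - a))
    (t : ℝ) : F.real {z | D z = t} = 0 := by
  have := hA t t le_rfl
  simp only [Set.Icc_self, Set.mem_singleton_iff, sub_self, mul_zero] at this
  exact le_antisymm this measureReal_nonneg

variable [IsProbabilityMeasure F]

theorem eventCDF_sub (hD : Measurable D)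
    (hA : ∀ a b, a ≤ b → F.real {z | D z ∈ Set.Icc a b} ≤ C * (b - a))
    {B : Set α} (hB : MeasurableSet B) {a b : ℝ} (hab : a ≤ b) :
    eventCDF F D B b - eventCDF F D B a = F.real (B ∩ {z | D z ∈ Set.Icc a b}) := by
  have hm : MeasurableSet {z | D z ≤ a} := measurableSet_le hD measurable_const
  have h1 : eventCDF F D B b =
      F.real (B ∩ {z | D z ≤ a}) + F.real (B ∩ {z | D z ∈ Set.Ioc a b}) := by
    rw [eventCDF, ← measureReal_union]
    · congr 1
      ext z
      simp only [Set.mem_inter_iff, Set.mem_ofPred_eq, Set.mem_union, Set.mem_Ioc]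
      constructor
      · rintro ⟨h1, h2⟩
        rcases le_or_gt (D z) a with h | h
        · exact Or.inl ⟨h1, h⟩
        · exact Or.inr ⟨h1, h, h2⟩
      · rintro (⟨h1, h⟩ | ⟨h1, _, h⟩)
        · exact ⟨h1, h.trans hab⟩
        · exact ⟨h1, h⟩
    · rw [Set.disjoint_left]
      rintro z ⟨_, h⟩ ⟨_, h', _⟩
      exact absurd h (not_le.2 h')
    · exact hB.inter (hD measurableSet_Ioc)
  have h2 : F.real (B ∩ {z | D z ∈ Set.Icc a b}) = F.real (B ∩ {z | D z ∈ Set.Ioc a b}) := by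
    apply le_antisymm
    · have : B ∩ {z | D z ∈ Set.Icc a b} ⊆ (B ∩ {z | D z ∈ Set.Ioc a b}) ∪ {z | D z = a} := by
        rintro z ⟨h1, h2, h3⟩
        rcases h2.eq_or_lt with h | h
        · exact Or.inr h.symm
        · exact Or.inl ⟨h1, h, h3⟩
      refine (measureReal_mono this).trans ((measureReal_union_le _ _).trans ?_)
      rw [measureReal_eq_singleton_zero hA, add_zero]
    · exact measureReal_mono fun z hz => ⟨hz.1, hz.2.1.le, hz.2.2⟩
  rw [h1, h2, eventCDF]
  ring

theorem eventCDF_sub_le (hD : Measurable D)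
    (hA : ∀ a b, a ≤ b → F.real {z | D z ∈ Set.Icc a b} ≤ C * (b - a))
    {B : Set α} (hB : MeasurableSet B) {a b : ℝ} (hab : a ≤ b) :
    eventCDF F D B b - eventCDF F D B a ≤ C * (b - a) := by
  rw [eventCDF_sub hD hA hB hab]
  exact (measureReal_mono Set.inter_subset_right).trans (hA a b hab)

theorem monotone_eventCDF (B : Set α) : Monotone (eventCDF F D B) := fun _ _ hab =>
  measureReal_mono fun _ hz => ⟨hz.1, le_trans hz.2 hab⟩

theorem ae_notMem_of_volume_zero (hD : Measurable D)
    (hA : ∀ a b, a ≤ b → F.real {z | D z ∈ Set.Icc a b} ≤ C * (b - a)) (hC : 0 ≤ C)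
    {N : Set ℝ} (hN : volume N = 0) : ∀ᵐ z ∂F, D z ∉ N := by
  have hlip : ∀ x y, x ≤ y → eventCDF F D Set.univ y - eventCDF F D Set.univ x ≤ C * (y - x) :=
    fun x y h => eventCDF_sub_le hD hA MeasurableSet.univ h
  have hcont : Continuous (eventCDF F D Set.univ) := by
    refine (LipschitzWith.of_le_add_mul C.toNNReal fun x y => ?_).continuous
    rw [Real.coe_toNNReal C hC]
    rcases le_total x y with h | h
    · have := monotone_eventCDF (F := F) (D := D) Set.univ h
      have : 0 ≤ C * dist x y := by positivity
      linarith
    · have := hlip y x h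
      rw [Real.dist_eq, abs_of_nonneg (by linarith)]
      linarith
  let f : StieltjesFunction ℝ :=
    { toFun := fun t => C * t - eventCDF F D Set.univ t
      mono' := fun x y h => by
        have := hlip x y h
        simp only
        linarith
      right_continuous' := fun x => (by fun_prop : Continuous fun t =>
        C * t - eventCDF F D Set.univ t).continuousWithinAt }
  have : IsProbabilityMeasure (F.map D) := Measure.isProbabilityMeasure_map hD.aemeasurable
  have heq : f.measure + F.map D = ENNReal.ofReal C • volume := by
    symm
    refine Measure.ext_of_Ioc' _ _ (fun a b _ => ?_) fun a b hab => ?_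
    · simp [ENNReal.mul_eq_top]
    symm
    have h2 : F.real (D ⁻¹' Set.Ioc a b) =
        eventCDF F D Set.univ b - eventCDF F D Set.univ a := by
      rw [eventCDF_sub hD hA MeasurableSet.univ hab.le, Set.univ_inter]
      apply le_antisymm
      · exact measureReal_mono fun z hz => ⟨hz.1.le, hz.2⟩
      · have : {z | D z ∈ Set.Icc a b} ⊆ (D ⁻¹' Set.Ioc a b) ∪ {z | D z = a} := by
          rintro z ⟨h2, h3⟩
          rcases h2.eq_or_lt with h | h
          · exact Or.inr h.symm
          · exact Or.inl ⟨h, h3⟩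
        refine (measureReal_mono this).trans ((measureReal_union_le _ _).trans ?_)
        rw [measureReal_eq_singleton_zero hA, add_zero]
    have h3 : F (D ⁻¹' Set.Ioc a b) =
        ENNReal.ofReal (eventCDF F D Set.univ b - eventCDF F D Set.univ a) := by
      rw [← h2, ofReal_measureReal]
    rw [Measure.add_apply, StieltjesFunction.measure_Ioc, Measure.map_apply hD measurableSet_Ioc,
      h3, ← ENNReal.ofReal_add]
    · simp only [f, Measure.smul_apply, Real.volume_Ioc, smul_eq_mul]
      rw [← ENNReal.ofReal_mul hC]
      congr 1
      ring
    · exact sub_nonneg.2 (f.mono hab.le)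
    · exact sub_nonneg.2 (monotone_eventCDF _ hab.le)
  have h0 : (F.map D) N = 0 := by
    have h1 : (f.measure + F.map D) N = 0 := by
      rw [heq, Measure.smul_apply, hN, smul_zero]
    rw [Measure.add_apply] at h1
    exact (add_eq_zero.1 h1).2
  exact (ae_of_ae_map hD.aemeasurable (measure_eq_zero_iff_ae_notMem.1 h0))

theorem ae_differentiableAt_eventCDF (hD : Measurable D)
    (hA : ∀ a b, a ≤ b → F.real {z | D z ∈ Set.Icc a b} ≤ C * (b - a)) (hC : 0 ≤ C) (B : Set α) :
    ∀ᵐ z ∂F, DifferentiableAt ℝ (eventCDF F D B) (D z) := by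
  have h := (monotone_eventCDF (F := F) (D := D) B).ae_differentiableAt
  have := ae_notMem_of_volume_zero hD hA hC (ae_iff.1 h)
  filter_upwards [this] with z hz
  simpa using hz

end Concentration

theorem tendsto_inv_mul_sub_of_hasDerivAt {M : ℝ → ℝ} {M' t : ℝ} (h : HasDerivAt M M' t)
    (a b : ℝ) :
    Tendsto (fun ε : ℝ => ε⁻¹ * (M (t + ε * b) - M (t + ε * a))) (𝓝[>] 0) (𝓝 ((b - a) * M')) := by
  have key : ∀ c : ℝ, Tendsto (fun ε : ℝ => ε⁻¹ * (M (t + ε * c) - M t)) (𝓝[>] 0) (𝓝 (c * M')) := by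
    intro c
    have h1 : HasDerivAt (fun ε : ℝ => M (t + ε * c)) (M' * c) 0 := by
      have h2 : HasDerivAt (fun ε : ℝ => t + ε * c) c 0 := by
        simpa using ((hasDerivAt_id (0 : ℝ)).mul_const c).const_add t
      have h3 : HasDerivAt M M' (t + 0 * c) := by simpa using h
      exact h3.comp (0 : ℝ) h2
    have := h1.tendsto_slope_zero_right
    simpa [mul_comm] using this
  convert (key b).sub (key a) using 2 <;> ring

theorem measureReal_prod_eq_integral {α β : Type*} [MeasurableSpace α] [MeasurableSpace β]
    (μ : Measure α) (ν : Measure β) [IsFiniteMeasure μ] [IsFiniteMeasure ν] {S : Set (α × β)}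
    (hS : MeasurableSet S) :
    (μ.prod ν).real S = ∫ x, ν.real (Prod.mk x ⁻¹' S) ∂μ := by
  simp only [Measure.real]
  rw [Measure.prod_apply hS, integral_toReal]
  · exact (measurable_measure_prodMk_left hS).aemeasurable
  · exact ae_of_all _ fun x => measure_lt_top _ _

theorem measureReal_eq_sum_fibers {α : Type*} [MeasurableSpace α] (F : Measure α)
    [IsFiniteMeasure F] {L : α → ℤ} (hL : Measurable L) {s : Finset ℤ} (hs : ∀ z, L z ∈ s)
    {A : Set α} (hA : MeasurableSet A) :
    F.real A = ∑ l ∈ s, F.real ({z | L z = l} ∩ A) := by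
  rw [← measureReal_biUnion_finset]
  · congr 1
    ext z
    simp [hs z]
  · intro i _ j _ hij
    rw [Function.onFun, Set.disjoint_left]
    rintro z ⟨h1, _⟩ ⟨h2, _⟩
    exact hij (h1.symm.trans h2)
  · exact fun l _ => (hL (measurableSet_singleton l)).inter hA

section Concentration

variable {α : Type*} [MeasurableSpace α] {F : Measure α} [IsProbabilityMeasure F]
  {D : α → ℝ} {C : ℝ}

theorem exists_tendsto_inv_mul_sum_eventCDF (hD : Measurable D)
    (hA : ∀ a b, a ≤ b → F.real {z | D z ∈ Set.Icc a b} ≤ C * (b - a)) {L : α → ℤ}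
    (hL : Measurable L) {s : Finset ℤ} (hs : ∀ z, L z ∈ s) {t : ℝ}
    (ht : ∀ l ∈ s, DifferentiableAt ℝ (eventCDF F D {z | L z = l}) t) (a : ℤ → ℝ) {c : ℝ}
    (hc : 0 ≤ c) :
    ∃ v ≤ c * C, Tendsto (fun ε : ℝ => ε⁻¹ * ∑ l ∈ s,
      (eventCDF F D {z | L z = l} (t + ε * (a l + c)) - eventCDF F D {z | L z = l} (t + ε * a l)))
      (𝓝[>] 0) (𝓝 v) := by
  have hlim : ∀ (a : ℤ → ℝ) (c : ℝ), Tendsto (fun ε : ℝ => ε⁻¹ * ∑ l ∈ s,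
      (eventCDF F D {z | L z = l} (t + ε * (a l + c)) - eventCDF F D {z | L z = l} (t + ε * a l)))
      (𝓝[>] 0) (𝓝 (c * ∑ l ∈ s, deriv (eventCDF F D {z | L z = l}) t)) := by
    intro a c
    simp_rw [Finset.mul_sum]
    refine tendsto_finsetSum _ fun l hl => ?_
    have := tendsto_inv_mul_sub_of_hasDerivAt (ht l hl).hasDerivAt (a l) (a l + c)
    simpa using this
  refine ⟨_, ?_, hlim a c⟩
  refine mul_le_mul_of_nonneg_left ?_ hc
  have h1 := hlim 0 1
  rw [one_mul] at h1
  refine le_of_tendsto h1 ?_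
  filter_upwards [self_mem_nhdsWithin] with ε hε
  have hε : 0 < ε := hε
  have h2 : ∑ l ∈ s, (eventCDF F D {z | L z = l} (t + ε * ((0 : ℤ → ℝ) l + 1)) -
      eventCDF F D {z | L z = l} (t + ε * (0 : ℤ → ℝ) l)) =
      F.real {z | D z ∈ Set.Icc t (t + ε)} := by
    rw [measureReal_eq_sum_fibers F hL hs (A := {z | D z ∈ Set.Icc t (t + ε)})
      (hD measurableSet_Icc)]
    refine Finset.sum_congr rfl fun l _ => ?_
    simp only [Pi.zero_apply, zero_add, mul_one, mul_zero, add_zero]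
    exact eventCDF_sub hD hA (B := {z | L z = l}) (hL (measurableSet_singleton l)) (by linarith)
  rw [h2, inv_mul_le_iff₀ hε]
  refine (hA _ _ (by linarith)).trans (by ring_nf; rfl)

theorem eventually_prod_real_abs_sub_le_of_integer (hD : Measurable D)
    (hA : ∀ a b, a ≤ b → F.real {z | D z ∈ Set.Icc a b} ≤ C * (b - a)) (hC : 0 < C) {L : α → ℤ}
    (hL : Measurable L) {s : Finset ℤ} (hs : ∀ z, L z ∈ s) {δ : ℝ} (hδ : 0 < δ) :
    ∀ᶠ ε in 𝓝[>] (0 : ℝ), (F.prod F).real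
      {p | |(D p.1 + ε * (δ * L p.1)) - (D p.2 + ε * (δ * L p.2))| ≤ 5 * δ * ε} ≤
        11 * C * δ * ε := by
  set W : ℝ → α → ℝ := fun ε z => F.real
    {z' | |(D z + ε * (δ * L z)) - (D z' + ε * (δ * L z'))| ≤ 5 * δ * ε} with hW
  have hSm : ∀ ε : ℝ, MeasurableSet {p : α × α |
      |(D p.1 + ε * (δ * L p.1)) - (D p.2 + ε * (δ * L p.2))| ≤ 5 * δ * ε} := by
    intro ε
    have hL' : Measurable fun z => (L z : ℝ) := (measurable_of_countable _).comp hL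
    exact measurableSet_le (by fun_prop) measurable_const
  have hprod : ∀ ε : ℝ, (F.prod F).real
      {p | |(D p.1 + ε * (δ * L p.1)) - (D p.2 + ε * (δ * L p.2))| ≤ 5 * δ * ε} =
      ∫ z, W ε z ∂F := fun ε => measureReal_prod_eq_integral F F (hSm ε)
  have hWsum : ∀ ε : ℝ, 0 < ε → ∀ z, W ε z = ∑ l ∈ s, (eventCDF F D {z | L z = l}
      (D z + ε * (δ * (L z - l) - 5 * δ + 10 * δ)) -
      eventCDF F D {z | L z = l} (D z + ε * (δ * (L z - l) - 5 * δ))) := by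
    intro ε hε z
    rw [hW]
    simp only
    rw [measureReal_eq_sum_fibers F hL hs
      (A := {z' | |(D z + ε * (δ * L z)) - (D z' + ε * (δ * L z'))| ≤ 5 * δ * ε})
      (measurable_prodMk_left (x := z) (hSm ε))]
    refine Finset.sum_congr rfl fun l _ => ?_
    rw [eventCDF_sub hD hA (B := {z | L z = l}) (hL (measurableSet_singleton l))
      (by have : 0 < ε * δ := by positivity
          nlinarith)]
    congr 1
    ext z'
    simp only [Set.mem_inter_iff, Set.mem_ofPred_eq, Set.mem_Icc, abs_le]
    refine and_congr_right fun h => ?_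
    rw [h]
    constructor
    · rintro ⟨h1, h2⟩
      constructor <;> linarith
    · rintro ⟨h1, h2⟩
      constructor <;> linarith
  have hae : ∀ᵐ z ∂F, ∀ l ∈ s, DifferentiableAt ℝ (eventCDF F D {z | L z = l}) (D z) := by
    refine (ae_ball_iff (S := (s : Set ℤ)) s.countable_toSet).2 ?_
    exact fun l _ => ae_differentiableAt_eventCDF hD hA hC.le _
  have hlim : ∀ᵐ z ∂F, ∃ v ≤ 10 * δ * C, Tendsto (fun ε => ε⁻¹ * W ε z) (𝓝[>] 0) (𝓝 v) := by
    filter_upwards [hae] with z hz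
    obtain ⟨v, hv, h⟩ := exists_tendsto_inv_mul_sum_eventCDF hD hA hL hs hz
      (fun l => δ * (L z - l) - 5 * δ) (c := 10 * δ) (by positivity)
    refine ⟨v, hv, h.congr' ?_⟩
    filter_upwards [self_mem_nhdsWithin] with ε hε
    rw [hWsum ε hε]
  set V : α → ℝ := fun z => limUnder (𝓝[>] (0 : ℝ)) fun ε => ε⁻¹ * W ε z with hV
  have hVlim : ∀ᵐ z ∂F, V z ≤ 10 * δ * C ∧ Tendsto (fun ε => ε⁻¹ * W ε z) (𝓝[>] 0) (𝓝 (V z)) := by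
    filter_upwards [hlim] with z ⟨v, hv, h⟩
    rw [hV]
    simp only
    rw [h.limUnder_eq]
    exact ⟨hv, h⟩
  have hWm : ∀ ε, Measurable (W ε) := fun ε =>
    (measurable_measure_prodMk_left (hSm ε)).ennreal_toReal
  have hDCT : Tendsto (fun ε => ∫ z, ε⁻¹ * W ε z ∂F) (𝓝[>] 0) (𝓝 (∫ z, V z ∂F)) := by
    refine tendsto_integral_filter_of_dominated_convergence (fun _ => s.card * (C * (10 * δ)))
      (Eventually.of_forall fun ε => ((hWm ε).const_mul _).aestronglyMeasurable) ?_
      (integrable_const _) (hVlim.mono fun z hz => hz.2)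
    filter_upwards [self_mem_nhdsWithin] with ε hε
    have hε : 0 < ε := hε
    refine ae_of_all _ fun z => ?_
    rw [Real.norm_eq_abs, abs_of_nonneg (mul_nonneg (by positivity) measureReal_nonneg),
      inv_mul_le_iff₀ hε]
    refine (hWsum ε hε z).le.trans ((Finset.sum_le_card_nsmul _ _ (C * (ε * (10 * δ)))
      fun l _ => ?_).trans ?_)
    · refine (eventCDF_sub_le hD hA (hL (measurableSet_singleton l)) ?_).trans ?_
      · have : 0 < ε * δ := by positivity
        nlinarith
      · refine mul_le_mul_of_nonneg_left ?_ hC.le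
        linarith
    · rw [nsmul_eq_mul]
      apply le_of_eq
      ring
  have hVle : ∫ z, V z ∂F ≤ 10 * δ * C := by
    by_cases hi : Integrable V F
    · refine (integral_mono_ae hi (integrable_const _) (hVlim.mono fun z hz => hz.1)).trans ?_
      simp
    · rw [integral_undef hi]
      positivity
  have hlt : ∫ z, V z ∂F < 11 * C * δ := by
    have : 0 < C * δ := by positivity
    nlinarith
  filter_upwards [hDCT.eventually_lt_const hlt, self_mem_nhdsWithin] with ε h1 hε
  have hε : 0 < ε := hε
  rw [hprod]
  rw [integral_const_mul, inv_mul_lt_iff₀ hε] at h1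
  linarith

theorem eventually_prod_real_abs_sub_le (hD : Measurable D)
    (hA : ∀ a b, a ≤ b → F.real {z | D z ∈ Set.Icc a b} ≤ C * (b - a)) (hC : 0 < C)
    {V : ℝ → α → ℝ} {V₀ : α → ℝ} (hV : ∀ ε, Measurable (V ε)) (hV₀ : Measurable V₀) {K : ℝ}
    (hVK : ∀ᶠ ε in 𝓝[>] (0 : ℝ), ∀ᵐ z ∂F, |V ε z| ≤ K) (hV₀K : ∀ z, |V₀ z| ≤ K)
    (hlim : ∀ᵐ z ∂F, Tendsto (fun ε => V ε z) (𝓝[>] 0) (𝓝 (V₀ z))) {δ : ℝ} (hδ : 0 < δ) :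
    ∀ᶠ ε in 𝓝[>] (0 : ℝ), (F.prod F).real
      {p | |(D p.1 + ε * V ε p.1) - (D p.2 + ε * V ε p.2)| ≤ δ * ε} ≤ 12 * C * δ * ε := by
  set L : α → ℤ := fun z => ⌊V₀ z / δ⌋ with hLdef
  have hL : Measurable L := Int.measurable_floor.comp (hV₀.div_const δ)
  have hs : ∀ z, L z ∈ Finset.Icc ⌊-K / δ⌋ ⌊K / δ⌋ := by
    intro z
    rw [Finset.mem_Icc]
    have := abs_le.1 (hV₀K z)
    exact ⟨Int.floor_le_floor (div_le_div_of_nonneg_right this.1 hδ.le),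
      Int.floor_le_floor (div_le_div_of_nonneg_right this.2 hδ.le)⟩
  have hVL : ∀ z, |V₀ z - δ * L z| ≤ δ := by
    intro z
    have h1 := Int.floor_le (V₀ z / δ)
    have h2 := (Int.lt_floor_add_one (V₀ z / δ)).le
    rw [le_div_iff₀ hδ] at h1
    rw [div_le_iff₀ hδ] at h2
    rw [abs_le, hLdef]
    constructor <;> simp only <;> nlinarith
  set bad : ℝ → Set α := fun ε => {z | δ < |V ε z - V₀ z|} with hbad
  have hbadm : ∀ ε, MeasurableSet (bad ε) := fun ε =>
    measurableSet_lt measurable_const ((hV ε).sub hV₀).abs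
  have hbad0 : Tendsto (fun ε => F.real (bad ε)) (𝓝[>] 0) (𝓝 0) := by
    have h1 : Tendsto (fun ε => ∫ z, (bad ε).indicator (fun _ => (1 : ℝ)) z ∂F) (𝓝[>] 0)
        (𝓝 (∫ z, (0 : ℝ) ∂F)) := by
      refine tendsto_integral_filter_of_dominated_convergence (fun _ => 1)
        (Eventually.of_forall fun ε => (measurable_const.indicator (hbadm ε)).aestronglyMeasurable)
        (Eventually.of_forall fun ε => ae_of_all _ fun z => ?_) (integrable_const _) ?_
      · by_cases h : z ∈ bad ε <;> simp [h]
      · filter_upwards [hlim] with z hz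
        refine tendsto_const_nhds.congr' ?_
        filter_upwards [Metric.tendsto_nhds.1 hz δ hδ] with ε hε
        rw [Set.indicator_of_notMem]
        simpa [bad, ← Real.dist_eq] using hε.le
    simpa [integral_indicator_const, hbadm] using h1
  have hKnn : 0 ≤ K := by
    have : Nonempty α := nonempty_of_isProbabilityMeasure F
    exact (abs_nonneg _).trans (hV₀K (Classical.arbitrary α))
  set K' : ℝ := 2 * K + δ with hK'
  have hK'pos : 0 < K' := by positivity
  have hcl : ∀ (t ε : ℝ), 0 ≤ ε → F.real {z | |t - D z| ≤ K' * ε} ≤ C * (2 * K' * ε) := by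
    intro t ε hε
    have : {z | |t - D z| ≤ K' * ε} = {z | D z ∈ Set.Icc (t - K' * ε) (t + K' * ε)} := by
      ext z
      simp only [Set.mem_ofPred_eq, Set.mem_Icc, abs_le]
      constructor <;> rintro ⟨h1, h2⟩ <;> constructor <;> linarith
    rw [this]
    refine (hA _ _ (by have := mul_nonneg hK'pos.le hε; linarith)).trans (le_of_eq (by ring))
  have hSm : ∀ ε : ℝ, MeasurableSet {p : α × α | p.1 ∈ bad ε ∧ |D p.1 - D p.2| ≤ K' * ε} :=
    fun ε => (measurable_fst (hbadm ε)).inter (measurableSet_le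
      (f := fun p : α × α => |D p.1 - D p.2|) (by fun_prop) measurable_const)
  have hS1 : ∀ ε : ℝ, 0 ≤ ε → (F.prod F).real {p | p.1 ∈ bad ε ∧ |D p.1 - D p.2| ≤ K' * ε} ≤
      F.real (bad ε) * (C * (2 * K' * ε)) := by
    intro ε hε
    rw [measureReal_prod_eq_integral F F (hSm ε)]
    have h1 : ∀ z, F.real (Prod.mk z ⁻¹' {p : α × α | p.1 ∈ bad ε ∧ |D p.1 - D p.2| ≤ K' * ε}) ≤
        (bad ε).indicator (fun _ => C * (2 * K' * ε)) z := by
      intro z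
      by_cases h : z ∈ bad ε
      · simpa [h] using hcl (D z) ε hε
      · simp [h]
    refine (integral_mono_of_nonneg (ae_of_all _ fun z => measureReal_nonneg)
      ((integrable_const _).indicator (hbadm ε)) (ae_of_all _ h1)).trans ?_
    rw [integral_indicator_const _ (hbadm ε), smul_eq_mul]
  have hS2 : ∀ ε : ℝ, 0 ≤ ε → (F.prod F).real {p | p.2 ∈ bad ε ∧ |D p.2 - D p.1| ≤ K' * ε} ≤
      F.real (bad ε) * (C * (2 * K' * ε)) := by
    intro ε hε
    refine le_trans (le_of_eq ?_) (hS1 ε hε)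
    have := (Measure.measurePreserving_swap (μ := F) (ν := F)).measureReal_preimage
      (hSm ε).nullMeasurableSet
    rw [← this]
    rfl
  have hsmall : ∀ᶠ ε in 𝓝[>] (0 : ℝ), F.real (bad ε) * (4 * K') < δ := by
    have := hbad0.mul_const (4 * K')
    rw [zero_mul] at this
    exact this.eventually_lt_const hδ
  filter_upwards [eventually_prod_real_abs_sub_le_of_integer hD hA hC hL hs hδ, hsmall, hVK,
    self_mem_nhdsWithin] with ε h1 h2 h3 hε
  have hε : 0 < ε := hε
  have h3' : ∀ᵐ p ∂F.prod F, |V ε p.1| ≤ K ∧ |V ε p.2| ≤ K :=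
    (Measure.quasiMeasurePreserving_fst.ae h3).and (Measure.quasiMeasurePreserving_snd.ae h3)
  have hsub : ({p : α × α | |(D p.1 + ε * V ε p.1) - (D p.2 + ε * V ε p.2)| ≤ δ * ε} : Set _)
      ≤ᵐ[F.prod F] (({p | |(D p.1 + ε * (δ * L p.1)) - (D p.2 + ε * (δ * L p.2))| ≤ 5 * δ * ε} ∪
        {p | p.1 ∈ bad ε ∧ |D p.1 - D p.2| ≤ K' * ε}) ∪
        {p | p.2 ∈ bad ε ∧ |D p.2 - D p.1| ≤ K' * ε} : Set _) := by
    filter_upwards [h3'] with p ⟨hp1, hp2⟩ hp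
    change |(D p.1 + ε * V ε p.1) - (D p.2 + ε * V ε p.2)| ≤ δ * ε at hp
    have hclose : |D p.1 - D p.2| ≤ K' * ε := by
      rw [abs_le] at hp hp1 hp2 ⊢
      constructor <;> nlinarith
    by_cases hb1 : p.1 ∈ bad ε
    · exact Or.inl (Or.inr ⟨hb1, hclose⟩)
    by_cases hb2 : p.2 ∈ bad ε
    · exact Or.inr ⟨hb2, by rwa [abs_sub_comm]⟩
    refine Or.inl (Or.inl ?_)
    have a1 : |V ε p.1 - V₀ p.1| ≤ δ := not_lt.1 hb1
    have a2 : |V ε p.2 - V₀ p.2| ≤ δ := not_lt.1 hb2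
    have b1 := hVL p.1
    have b2 := hVL p.2
    change |(D p.1 + ε * (δ * L p.1)) - (D p.2 + ε * (δ * L p.2))| ≤ 5 * δ * ε
    have c1 : |V ε p.1 - δ * L p.1| ≤ 2 * δ :=
      (abs_sub_le _ (V₀ p.1) _).trans (by linarith)
    have c2 : |V ε p.2 - δ * L p.2| ≤ 2 * δ :=
      (abs_sub_le _ (V₀ p.2) _).trans (by linarith)
    rw [abs_le] at hp c1 c2 ⊢
    constructor <;> nlinarith
  have hle := ENNReal.toReal_mono (measure_ne_top _ _) (measure_mono_ae hsub)
  refine hle.trans ((measureReal_union_le _ _).trans ?_)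
  have h4 := measureReal_union_le (μ := F.prod F)
    {p | |(D p.1 + ε * (δ * L p.1)) - (D p.2 + ε * (δ * L p.2))| ≤ 5 * δ * ε}
    {p | p.1 ∈ bad ε ∧ |D p.1 - D p.2| ≤ K' * ε}
  have h5 := hS1 ε hε.le
  have h6 := hS2 ε hε.le
  have h7 : F.real (bad ε) * (4 * K') * (C * ε) ≤ δ * (C * ε) :=
    mul_le_mul_of_nonneg_right h2.le (by positivity)
  linarith

end Concentration

theorem exists_finite_net_of_bounded_lipschitz {E : Type*} [SeminormedAddCommGroup E]
    {B : Set E} (hB : IsCompact B) {K : ℝ} (hK : 0 ≤ K) {A : Set (E → ℝ)}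
    (hcont : ∀ w ∈ A, Continuous w) (hbdd : ∀ w ∈ A, ∀ c ∈ B, |w c| ≤ K)
    (hlip : ∀ w ∈ A, ∀ c ∈ B, ∀ c' ∈ B, |w c - w c'| ≤ K * ‖c - c'‖) {δ : ℝ} (hδ : 0 < δ) :
    ∃ t : Set (E → ℝ), t ⊆ A ∧ t.Finite ∧ ∀ w ∈ A, ∃ v ∈ t, ∀ c ∈ B, |w c - v c| ≤ δ := by
  rcases isEmpty_or_nonempty A with hA | hA
  · exact ⟨∅, Set.empty_subset _, Set.finite_empty, fun w hw => (hA.false ⟨w, hw⟩).elim⟩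
  have : CompactSpace B := isCompact_iff_compactSpace.1 hB
  let res : A → BoundedContinuousFunction B ℝ := fun w =>
    BoundedContinuousFunction.mkOfCompact ⟨fun c : B => w.1 c, (hcont w w.2).comp
      continuous_subtype_val⟩
  have hcpt : IsCompact (closure (Set.range res)) := by
    refine BoundedContinuousFunction.arzela_ascoli (Set.Icc (-K) K) isCompact_Icc _ ?_ ?_
    · rintro _ x ⟨w, rfl⟩
      exact abs_le.1 (hbdd w w.2 x x.2)
    · refine (LipschitzWith.uniformEquicontinuous _ K.toNNReal ?_).equicontinuous
      rintro ⟨_, ⟨w, rfl⟩⟩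
      refine LipschitzWith.of_dist_le_mul fun c c' => ?_
      rw [Real.coe_toNNReal K hK, Real.dist_eq, Subtype.dist_eq, dist_eq_norm]
      exact hlip w w.2 c c.2 c' c'.2
  obtain ⟨t, ht, htf, hcov⟩ := Metric.finite_approx_of_totallyBounded
    (hcpt.totallyBounded.subset subset_closure) δ hδ
  choose! f hf using fun y (hy : y ∈ t) => ht hy
  refine ⟨(fun y => (f y : E → ℝ)) '' t, ?_, htf.image _, ?_⟩
  · rintro _ ⟨y, _, rfl⟩
    exact (f y).2
  · intro w hw
    obtain ⟨y, hy, hwy⟩ := Set.mem_iUnion₂.1 (hcov ⟨⟨w, hw⟩, rfl⟩)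
    refine ⟨f y, ⟨y, hy, rfl⟩, fun c hc => ?_⟩
    have h1 := (BoundedContinuousFunction.dist_coe_le_dist (f := res ⟨w, hw⟩) (g := y) ⟨c, hc⟩).trans
      (Metric.mem_ball.1 hwy).le
    rw [← hf y hy] at h1
    exact h1

section

variable {E : Type*} [NormedAddCommGroup E] {R r : ℝ}

theorem sphere_subset_closedBall_of_norm_le {z : E} (hz : ‖z‖ ≤ R) :
    Metric.sphere z r ⊆ Metric.closedBall 0 (R + r) := by
  intro c hc
  rw [mem_sphere_iff_norm] at hc
  rw [mem_closedBall_zero_iff]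
  calc ‖c‖ = ‖(c - z) + z‖ := by simp
    _ ≤ ‖c - z‖ + ‖z‖ := norm_add_le _ _
    _ ≤ R + r := by linarith

variable [ProperSpace E] [MeasurableSpace E] [BorelSpace E]
  {F : Measure E} [IsProbabilityMeasure F] {C : ℝ} {g : E → ℝ}

theorem eventually_prod_real_abs_sphereInf_sub_le (hg : Continuous g) (hR : ∀ᵐ z ∂F, ‖z‖ ≤ R)
    (hA : ∀ a b, a ≤ b → F.real {z | sphereInf r g z ∈ Set.Icc a b} ≤ C * (b - a)) (hC : 0 < C)
    {w : E → ℝ} (hw : Continuous w) {K : ℝ} (hK : 0 ≤ K)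
    (hwK : ∀ c ∈ Metric.closedBall (0 : E) (R + r), |w c| ≤ K) {δ : ℝ} (hδ : 0 < δ) :
    ∀ᶠ ε in 𝓝[>] (0 : ℝ), (F.prod F).real
      {p | |sphereInf r (fun c => g c + ε * w c) p.1 - sphereInf r (fun c => g c + ε * w c) p.2|
        ≤ δ * ε} ≤ 12 * C * δ * ε := by
  set V : ℝ → E → ℝ := fun ε z =>
    (sphereInf r (fun c => g c + ε * w c) z - sphereInf r g z) / ε with hVdef
  have hgw : ∀ ε : ℝ, Continuous fun c => g c + ε * w c := fun ε => by fun_prop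
  have hVc : ∀ ε, Continuous (V ε) := fun ε =>
    ((continuous_sphereInf_right (hgw ε)).sub (continuous_sphereInf_right hg)).div_const _
  have hlim : ∀ z, ∃ v, Tendsto (fun ε => V ε z) (𝓝[>] 0) (𝓝 v) := by
    intro z
    obtain ⟨b, hb⟩ := ((isCompact_sphere z r).image hw).isBounded.exists_norm_le
    exact exists_tendsto_sphereInf_add_mul_sub_div hg fun c hc => hb _ ⟨c, hc, rfl⟩
  choose V₀ hV₀ using hlim
  have hV₀m : Measurable V₀ := measurable_of_tendsto_metrizable' (𝓝[>] (0 : ℝ))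
    (fun ε => (hVc ε).measurable) (tendsto_pi_nhds.2 hV₀)
  have hVK : ∀ z : E, ‖z‖ ≤ R → ∀ ε : ℝ, 0 < ε → |V ε z| ≤ K := by
    intro z hz ε hε
    rw [hVdef]
    simp only
    rw [abs_div, abs_of_pos hε, div_le_iff₀ hε]
    refine abs_sphereInf_sub_le (hgw ε) hg (by positivity) fun c hc => ?_
    rw [add_sub_cancel_left, abs_mul, abs_of_pos hε, mul_comm]
    exact mul_le_mul_of_nonneg_right (hwK c (sphere_subset_closedBall_of_norm_le hz hc)) hε.le
  have hmain := eventually_prod_real_abs_sub_le (continuous_sphereInf_right hg).measurable hA hC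
    (fun ε => (hVc ε).measurable)
    (V₀ := fun z => max (-K) (min K (V₀ z))) (by fun_prop) (K := K) ?_ ?_ ?_ hδ
  · filter_upwards [hmain, self_mem_nhdsWithin] with ε h1 hε
    have hε : 0 < ε := hε
    have : ∀ z, sphereInf r g z + ε * V ε z = sphereInf r (fun c => g c + ε * w c) z := by
      intro z
      rw [hVdef]
      field_simp
      ring
    simpa only [this] using h1
  · filter_upwards [self_mem_nhdsWithin] with ε hε
    filter_upwards [hR] with z hz
    exact hVK z hz ε hε
  · intro z
    rw [abs_le]
    exact ⟨le_max_left _ _, max_le (by linarith) (min_le_left _ _)⟩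
  · filter_upwards [hR] with z hz
    have : |V₀ z| ≤ K := by
      refine le_of_tendsto (hV₀ z).abs ?_
      filter_upwards [self_mem_nhdsWithin] with ε hε
      exact hVK z hz ε hε
    rw [abs_le] at this
    rw [min_eq_right this.2, max_eq_right this.1]
    exact hV₀ z

theorem eventually_forall_prod_real_abs_sphereInf_sub_le (hg : Continuous g)
    (hR : ∀ᵐ z ∂F, ‖z‖ ≤ R)
    (hA : ∀ a b, a ≤ b → F.real {z | sphereInf r g z ∈ Set.Icc a b} ≤ C * (b - a)) (hC : 0 < C)
    {K : ℝ} (hK : 0 ≤ K) {δ : ℝ} (hδ : 0 < δ) :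
    ∀ᶠ ε in 𝓝[>] (0 : ℝ), ∀ w : E → ℝ, Continuous w →
      (∀ c ∈ Metric.closedBall (0 : E) (R + r), |w c| ≤ K) →
      (∀ c ∈ Metric.closedBall (0 : E) (R + r), ∀ c' ∈ Metric.closedBall (0 : E) (R + r),
        |w c - w c'| ≤ K * ‖c - c'‖) →
      (F.prod F).real
        {p | |sphereInf r (fun c => g c + ε * w c) p.1 - sphereInf r (fun c => g c + ε * w c) p.2|
          ≤ δ * ε} ≤ 36 * C * δ * ε := by
  obtain ⟨t, htA, htf, hnet⟩ := exists_finite_net_of_bounded_lipschitz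
    (isCompact_closedBall (0 : E) (R + r)) hK
    (A := {w | Continuous w ∧ (∀ c ∈ Metric.closedBall (0 : E) (R + r), |w c| ≤ K) ∧
      (∀ c ∈ Metric.closedBall (0 : E) (R + r), ∀ c' ∈ Metric.closedBall (0 : E) (R + r),
        |w c - w c'| ≤ K * ‖c - c'‖)})
    (fun w h => h.1) (fun w h => h.2.1) (fun w h => h.2.2) hδ
  have hall := (Set.Finite.eventually_all htf (l := 𝓝[>] (0 : ℝ)) (p := fun v ε =>
    (F.prod F).real {p | |sphereInf r (fun c => g c + ε * v c) p.1 -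
      sphereInf r (fun c => g c + ε * v c) p.2| ≤ (3 * δ) * ε} ≤ 12 * C * (3 * δ) * ε)).2
    fun v hv => eventually_prod_real_abs_sphereInf_sub_le hg hR hA hC (htA hv).1 hK (htA hv).2.1
      (by positivity)
  filter_upwards [hall, self_mem_nhdsWithin] with ε h1 hε w hw hwK hwl
  have hε : 0 < ε := hε
  obtain ⟨v, hv, hwv⟩ := hnet w ⟨hw, hwK, hwl⟩
  have hvc : Continuous v := (htA hv).1
  have hclose : ∀ z : E, ‖z‖ ≤ R → |sphereInf r (fun c => g c + ε * w c) z -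
      sphereInf r (fun c => g c + ε * v c) z| ≤ δ * ε := by
    intro z hz
    refine abs_sphereInf_sub_le (by fun_prop) (by fun_prop) (by positivity) fun c hc => ?_
    rw [add_sub_add_left_eq_sub, ← mul_sub, abs_mul, abs_of_pos hε, mul_comm]
    exact mul_le_mul_of_nonneg_right (hwv c (sphere_subset_closedBall_of_norm_le hz hc)) hε.le
  have hR2 : ∀ᵐ p ∂F.prod F, ‖p.1‖ ≤ R ∧ ‖p.2‖ ≤ R :=
    (Measure.quasiMeasurePreserving_fst.ae hR).and (Measure.quasiMeasurePreserving_snd.ae hR)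
  refine (ENNReal.toReal_mono (measure_ne_top _ _) (measure_mono_ae ?_)).trans
    ((h1 v hv).trans (le_of_eq (by ring)))
  filter_upwards [hR2] with p ⟨hp1, hp2⟩ hp
  change |_ - _| ≤ _ at hp
  change |_ - _| ≤ _
  have a1 := hclose p.1 hp1
  have a2 := hclose p.2 hp2
  rw [abs_le] at *
  constructor <;> linarith

end

section Fourier

open scoped FourierTransform SchwartzMap ContDiff RealInnerProductSpace

variable {E : Type*} [NormedAddCommGroup E] [InnerProductSpace ℝ E] [FiniteDimensional ℝ E]

theorem exists_schwartzMap_eq_on_ball {h : E → ℝ} (hh : ContDiff ℝ ∞ h) (ρ : ℝ) :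
    ∃ f : 𝓢(E, ℂ), ∀ v, ‖v‖ ≤ ρ → f v = (h v : ℂ) := by
  let χ : ContDiffBump (0 : E) := ⟨max ρ 1, max ρ 1 + 1, by positivity, by linarith⟩
  have hc : HasCompactSupport fun v => (Complex.ofRealCLM (χ v * h v) : ℂ) := by
    refine HasCompactSupport.comp_left (g := fun y : ℝ => (Complex.ofRealCLM y : ℂ)) ?_ (by simp)
    exact χ.hasCompactSupport.mul_right
  have hd : ContDiff ℝ ∞ fun v => (Complex.ofRealCLM (χ v * h v) : ℂ) :=
    Complex.ofRealCLM.contDiff.comp (χ.contDiff.mul hh)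
  refine ⟨hc.toSchwartzMap hd, fun v hv => ?_⟩
  have : χ v = 1 := χ.one_of_mem_closedBall (by
    rw [mem_closedBall_zero_iff]; exact hv.trans (le_max_left _ _))
  change (Complex.ofRealCLM (χ v * h v) : ℂ) = _
  simp [this]

variable [MeasurableSpace E] [BorelSpace E]

theorem SchwartzMap.integral_comp_sub_eq_integral_fourier_mul_charFun (f : 𝓢(E, ℂ)) (μ : Measure E)
    [IsFiniteMeasure μ] (c : E) :
    ∫ x, f (x - c) ∂μ = ∫ ξ, 𝓕 f ξ * Complex.exp (-(2 * Real.pi * ⟪ξ, c⟫ : ℝ) * Complex.I) *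
      charFun μ ((2 * Real.pi) • ξ) := by
  have h1 : ∀ x, f (x - c) = ∫ ξ, 𝓕 f ξ * Complex.exp (-(2 * Real.pi * ⟪ξ, c⟫ : ℝ) * Complex.I) *
      Complex.exp (⟪x, (2 * Real.pi) • ξ⟫ * Complex.I) := by
    intro x
    have h2 : f (x - c) = 𝓕⁻ (𝓕 f) (x - c) := by rw [FourierTransform.fourierInv_fourier_eq]
    rw [h2, SchwartzMap.fourierInv_coe, Real.fourierInv_eq']
    refine integral_congr_ae (ae_of_all _ fun ξ => ?_)
    simp only [smul_eq_mul]
    rw [mul_assoc (𝓕 f ξ), ← Complex.exp_add, mul_comm]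
    congr 2
    rw [inner_sub_right, inner_smul_right, real_inner_comm ξ x]
    push_cast
    ring
  simp_rw [h1, charFun_apply]
  rw [integral_integral_swap]
  · refine integral_congr_ae (ae_of_all _ fun ξ => ?_)
    simp only
    rw [integral_const_mul]
  · have hcont : Continuous fun p : E × E =>
        Complex.exp (-(2 * Real.pi * ⟪p.2, c⟫ : ℝ) * Complex.I) *
          Complex.exp (⟪p.1, (2 * Real.pi) • p.2⟫ * Complex.I) := by fun_prop
    have hint : Integrable (fun p : E × E => 𝓕 f p.2) (μ.prod volume) :=
      (𝓕 f).integrable.comp_snd μ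
    have := hint.mul_bdd (c := 1) hcont.aestronglyMeasurable (ae_of_all _ fun p => by
      rw [norm_mul, ← Complex.ofReal_neg, Complex.norm_exp_ofReal_mul_I,
        Complex.norm_exp_ofReal_mul_I, one_mul])
    refine this.congr (ae_of_all _ fun p => ?_)
    simp only [Function.uncurry]
    ring

/-- Integrals of translates of a smooth function against two measures on a bounded set differ, in
the uniform and in the Lipschitz sense, by at most a weighted `L¹` distance of the characteristic
functions. -/
theorem exists_integral_sub_le_integral_charFun {h : E → ℝ} (hh : ContDiff ℝ ∞ h) (R R' : ℝ) :
    ∃ b : E → ℝ, Continuous b ∧ (∀ ξ, 0 ≤ b ξ) ∧ Integrable b ∧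
      ∀ (μ ν : Measure E) [IsProbabilityMeasure μ] [IsProbabilityMeasure ν],
        (∀ᵐ x ∂μ, ‖x‖ ≤ R) → (∀ᵐ x ∂ν, ‖x‖ ≤ R) →
        (∀ c, ‖c‖ ≤ R' → |∫ x, h (x - c) ∂μ - ∫ x, h (x - c) ∂ν| ≤
          ∫ ξ, b ξ * ‖charFun μ ((2 * Real.pi) • ξ) - charFun ν ((2 * Real.pi) • ξ)‖) ∧
        (∀ c, ‖c‖ ≤ R' → ∀ c', ‖c'‖ ≤ R' →
          |(∫ x, h (x - c) ∂μ - ∫ x, h (x - c) ∂ν) -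
            (∫ x, h (x - c') ∂μ - ∫ x, h (x - c') ∂ν)| ≤
          (∫ ξ, b ξ * ‖charFun μ ((2 * Real.pi) • ξ) - charFun ν ((2 * Real.pi) • ξ)‖) *
            ‖c - c'‖) := by
  obtain ⟨f, hf⟩ := exists_schwartzMap_eq_on_ball hh (R + R')
  have hbint : Integrable fun ξ : E => ‖𝓕 f ξ‖ * (1 + 2 * Real.pi * ‖ξ‖) := by
    have h1 := (𝓕 f).integrable.norm (μ := (volume : Measure E))
    have h2 := ((𝓕 f).integrable_pow_mul (volume : Measure E) 1).const_mul (2 * Real.pi)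
    refine (h1.add h2).congr (ae_of_all _ fun ξ => ?_)
    simp only [Pi.add_apply, pow_one]
    ring
  refine ⟨fun ξ => ‖𝓕 f ξ‖ * (1 + 2 * Real.pi * ‖ξ‖), ?_, fun ξ => by positivity, hbint, ?_⟩
  · exact (𝓕 f).continuous.norm.mul (by fun_prop)
  intro μ ν _ _ hμ hν
  set ψ : E → ℂ := fun ξ => charFun μ ((2 * Real.pi) • ξ) - charFun ν ((2 * Real.pi) • ξ) with hψ
  have hψc : Continuous ψ := by
    have h1 : Continuous (charFun μ) := continuous_charFun
    have h2 : Continuous (charFun ν) := continuous_charFun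
    fun_prop
  have hψ2 : ∀ ξ, ‖ψ ξ‖ ≤ 2 := fun ξ => (norm_sub_le _ _).trans (by
    have h1 := norm_charFun_le_one (μ := μ) ((2 * Real.pi) • ξ)
    have h2 := norm_charFun_le_one (μ := ν) ((2 * Real.pi) • ξ)
    linarith)
  set e : E → E → ℂ := fun c ξ => Complex.exp (-(2 * Real.pi * ⟪ξ, c⟫ : ℝ) * Complex.I) with he
  have hec : ∀ c, Continuous (e c) := fun c => by fun_prop
  have he1 : ∀ c ξ, ‖e c ξ‖ = 1 := fun c ξ => by
    simp only [he]
    rw [← Complex.ofReal_neg, Complex.norm_exp_ofReal_mul_I]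
  have hbψ : Integrable fun ξ => ‖𝓕 f ξ‖ * (1 + 2 * Real.pi * ‖ξ‖) * ‖ψ ξ‖ :=
    hbint.mul_bdd (c := 2) hψc.norm.aestronglyMeasurable (ae_of_all _ fun ξ => by
      simpa using hψ2 ξ)
  have hint : ∀ (ρ : Measure E) [IsProbabilityMeasure ρ] c,
      Integrable fun ξ => 𝓕 f ξ * e c ξ * charFun ρ ((2 * Real.pi) • ξ) := by
    intro ρ _ c
    have hρ : Continuous (charFun ρ) := continuous_charFun
    refine ((𝓕 f).integrable.mul_bdd (c := 1) (hec c).aestronglyMeasurable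
      (ae_of_all _ fun ξ => (he1 c ξ).le)).mul_bdd (c := 1)
      (by fun_prop : Continuous fun ξ => charFun ρ ((2 * Real.pi) • ξ)).aestronglyMeasurable
      (ae_of_all _ fun ξ => norm_charFun_le_one _)
  have hrep1 : ∀ (ρ : Measure E) [IsProbabilityMeasure ρ], (∀ᵐ x ∂ρ, ‖x‖ ≤ R) → ∀ c, ‖c‖ ≤ R' →
      ((∫ x, h (x - c) ∂ρ : ℝ) : ℂ) =
        ∫ ξ, 𝓕 f ξ * e c ξ * charFun ρ ((2 * Real.pi) • ξ) := by
    intro ρ _ hρ c hc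
    rw [← f.integral_comp_sub_eq_integral_fourier_mul_charFun, ← integral_complex_ofReal]
    refine integral_congr_ae ?_
    filter_upwards [hρ] with x hx
    exact (hf _ ((norm_sub_le _ _).trans (add_le_add hx hc))).symm
  have hrep : ∀ c, ‖c‖ ≤ R' → ((∫ x, h (x - c) ∂μ - ∫ x, h (x - c) ∂ν : ℝ) : ℂ) =
      ∫ ξ, 𝓕 f ξ * e c ξ * ψ ξ := by
    intro c hc
    rw [Complex.ofReal_sub, hrep1 μ hμ c hc, hrep1 ν hν c hc, ← integral_sub (hint μ c) (hint ν c)]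
    simp only [hψ, mul_sub]
  have hint' : ∀ c, Integrable fun ξ => 𝓕 f ξ * e c ξ * ψ ξ := fun c =>
    ((hint μ c).sub (hint ν c)).congr (ae_of_all _ fun ξ => by simp [hψ, mul_sub])
  constructor
  · intro c hc
    rw [← Real.norm_eq_abs, ← Complex.norm_real, hrep c hc]
    refine norm_integral_le_of_norm_le hbψ (ae_of_all _ fun ξ => ?_)
    rw [norm_mul, norm_mul, he1, mul_one]
    refine mul_le_mul_of_nonneg_right ?_ (norm_nonneg _)
    refine le_mul_of_one_le_right (norm_nonneg _) ?_
    have : 0 ≤ 2 * Real.pi * ‖ξ‖ := by positivity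
    linarith
  · intro c hc c' hc'
    rw [← Real.norm_eq_abs, ← Complex.norm_real, Complex.ofReal_sub, hrep c hc, hrep c' hc',
      ← integral_sub (hint' c) (hint' c'), ← integral_mul_const]
    refine norm_integral_le_of_norm_le (hbψ.mul_const _) (ae_of_all _ fun ξ => ?_)
    have h1 : 𝓕 f ξ * e c ξ * ψ ξ - 𝓕 f ξ * e c' ξ * ψ ξ = 𝓕 f ξ * (e c ξ - e c' ξ) * ψ ξ := by
      ring
    have h2 : ‖e c ξ - e c' ξ‖ ≤ 2 * Real.pi * ‖ξ‖ * ‖c - c'‖ := by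
      have h3 : e c ξ - e c' ξ = e c' ξ *
          (Complex.exp (Complex.I * ((2 * Real.pi * ⟪ξ, c' - c⟫ : ℝ) : ℂ)) - 1) := by
        simp only [he]
        rw [mul_sub, mul_one, ← Complex.exp_add]
        congr 2
        rw [inner_sub_right]
        push_cast
        ring
      rw [h3, norm_mul, he1, one_mul]
      refine Real.norm_exp_I_mul_ofReal_sub_one_le.trans ?_
      rw [Real.norm_eq_abs, abs_mul, abs_of_pos Real.two_pi_pos,
        mul_assoc (2 * Real.pi) ‖ξ‖]
      refine mul_le_mul_of_nonneg_left ?_ Real.two_pi_pos.le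
      rw [norm_sub_rev c c']
      exact abs_real_inner_le_norm _ _
    rw [h1, norm_mul, norm_mul]
    calc ‖𝓕 f ξ‖ * ‖e c ξ - e c' ξ‖ * ‖ψ ξ‖
        ≤ ‖𝓕 f ξ‖ * (2 * Real.pi * ‖ξ‖ * ‖c - c'‖) * ‖ψ ξ‖ := by gcongr
      _ ≤ ‖𝓕 f ξ‖ * ((1 + 2 * Real.pi * ‖ξ‖) * ‖c - c'‖) * ‖ψ ξ‖ := by gcongr; linarith
      _ = _ := by ring

end Fourier

/-- The uniform distribution on the points of a finite family. -/
noncomputable def finiteEmpirical {ι E : Type*} [Fintype ι] [MeasurableSpace E] (x : ι → E) :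
    Measure E :=
  (Fintype.card ι : ℝ≥0∞)⁻¹ • ∑ i, Measure.dirac (x i)

section finiteEmpirical

variable {ι E : Type*} [Fintype ι] [MeasurableSpace E]

theorem finiteEmpirical_fin {n : ℕ} (x : Fin n → E) :
    finiteEmpirical x = empiricalDistribution x := by
  rw [finiteEmpirical, empiricalDistribution, Fintype.card_fin]

instance isProbabilityMeasure_finiteEmpirical [Nonempty ι] (x : ι → E) :
    IsProbabilityMeasure (finiteEmpirical x) := by
  refine ⟨?_⟩
  simp only [finiteEmpirical, Measure.smul_apply, Measure.finsetSum_apply, measure_univ,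
    Finset.sum_const, Finset.card_univ, smul_eq_mul, nsmul_eq_mul, mul_one]
  exact ENNReal.inv_mul_cancel (by simp) (by simp)

theorem integral_finiteEmpirical [MeasurableSingletonClass E] {G : Type*} [NormedAddCommGroup G]
    [NormedSpace ℝ G] [CompleteSpace G] (x : ι → E) (f : E → G) :
    ∫ y, f y ∂finiteEmpirical x = (Fintype.card ι : ℝ)⁻¹ • ∑ i, f (x i) := by
  rw [finiteEmpirical, integral_smul_measure, integral_finsetSum_measure]
  · simp
  · intro i _
    exact integrable_dirac (by simp)

theorem ae_finiteEmpirical [MeasurableSingletonClass E] {x : ι → E} {p : E → Prop}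
    (h : ∀ i, p (x i)) : ∀ᵐ y ∂finiteEmpirical x, p y := by
  rw [finiteEmpirical]
  refine Measure.ae_smul_measure ?_ _
  rw [← Measure.sum_fintype, Measure.ae_sum_iff]
  · intro i
    rw [ae_dirac_eq]
    exact h i

end finiteEmpirical

theorem pow_four_le_exp_add_exp_neg (y : ℝ) : y ^ 4 ≤ 24 * (Real.exp y + Real.exp (-y)) := by
  have key : ∀ x : ℝ, 0 ≤ x → x ^ 4 ≤ 24 * Real.exp x := by
    intro x hx
    have := Real.pow_div_factorial_le_exp x hx 4
    rw [div_le_iff₀ (by positivity)] at this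
    norm_num [Nat.factorial] at this
    linarith
  rcases le_total 0 y with h | h
  · linarith [key y h, Real.exp_pos (-y)]
  · have := key (-y) (by linarith)
    rw [neg_pow, show (-1 : ℝ) ^ 4 = 1 by norm_num, one_mul] at this
    linarith [Real.exp_pos y]

theorem integral_sum_pow_four_le {Ω ι : Type*} [MeasurableSpace Ω] {P : Measure Ω}
    [IsProbabilityMeasure P] [Fintype ι] [Nonempty ι] {Z : ι → Ω → ℝ} (hZ : iIndepFun Z P)
    (hm : ∀ i, Measurable (Z i)) (hb : ∀ i ω, |Z i ω| ≤ 2) (h0 : ∀ i, ∫ ω, Z i ω ∂P = 0) :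
    ∫ ω, (∑ i, Z i ω) ^ 4 ∂P ≤ 48 * Real.exp 2 * (Fintype.card ι : ℝ) ^ 2 := by
  set N : ℝ := (Fintype.card ι : ℝ) with hN
  have hNpos : 0 < N := by rw [hN]; exact_mod_cast Fintype.card_pos
  have hsub := HasSubgaussianMGF.sum_of_iIndepFun hZ (s := Finset.univ) (fun i _ =>
    hasSubgaussianMGF_of_mem_Icc_of_integral_eq_zero (a := -2) (b := 2) (hm i).aemeasurable
      (ae_of_all _ fun ω => abs_le.1 (hb i ω)) (h0 i))
  set S : Ω → ℝ := fun ω => ∑ i, Z i ω with hS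
  set t : ℝ := (√N)⁻¹ with ht
  have ht2 : t ^ 2 = N⁻¹ := by rw [ht, inv_pow, Real.sq_sqrt hNpos.le]
  have hparam : (((∑ _i : ι, (‖(2 : ℝ) - -2‖₊ / 2) ^ 2 : NNReal)) : ℝ) = 4 * N := by
    push_cast
    rw [Finset.sum_const, Finset.card_univ, nsmul_eq_mul]
    norm_num
    ring
  have hmgf : ∀ u : ℝ, u ^ 2 = N⁻¹ → ∫ ω, Real.exp (u * S ω) ∂P ≤ Real.exp 2 := by
    intro u hu
    refine (hsub.mgf_le u).trans (Real.exp_le_exp.2 (le_of_eq ?_))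
    rw [hparam, hu]
    field_simp
    norm_num
  have h4 : ∀ ω, (S ω) ^ 4 ≤ N ^ 2 * (24 * (Real.exp (t * S ω) + Real.exp (-t * S ω))) := by
    intro ω
    have h1 := pow_four_le_exp_add_exp_neg (t * S ω)
    have h2 : (t * S ω) ^ 4 = (N ^ 2)⁻¹ * (S ω) ^ 4 := by
      rw [mul_pow, show t ^ 4 = (t ^ 2) ^ 2 by ring, ht2, inv_pow]
    rw [h2, inv_mul_le_iff₀ (by positivity)] at h1
    rwa [neg_mul]
  have hi1 := hsub.integrable_exp_mul t
  have hi2 := hsub.integrable_exp_mul (-t)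
  calc ∫ ω, (S ω) ^ 4 ∂P
      ≤ ∫ ω, N ^ 2 * (24 * (Real.exp (t * S ω) + Real.exp (-t * S ω))) ∂P :=
        integral_mono_of_nonneg (ae_of_all _ fun ω => by positivity)
          (((hi1.add hi2).const_mul _).const_mul _) (ae_of_all _ h4)
    _ = N ^ 2 * (24 * (∫ ω, Real.exp (t * S ω) ∂P + ∫ ω, Real.exp (-t * S ω) ∂P)) := by
        rw [integral_const_mul, integral_const_mul, integral_add hi1 hi2]
    _ ≤ N ^ 2 * (24 * (Real.exp 2 + Real.exp 2)) := by
        gcongr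
        · exact hmgf t ht2
        · exact hmgf (-t) (by rw [neg_sq, ht2])
    _ = _ := by ring

theorem integral_mul_pow_four_le {α : Type*} [MeasurableSpace α] {μ : Measure α} {b f : α → ℝ}
    (hb : Integrable b μ) (hb0 : ∀ x, 0 ≤ b x) (hbf : Integrable (fun x => b x * f x) μ)
    (hbf4 : Integrable (fun x => b x * f x ^ 4) μ) :
    (∫ x, b x * f x ∂μ) ^ 4 ≤ (∫ x, b x ∂μ) ^ 3 * ∫ x, b x * f x ^ 4 ∂μ := by
  set T := ∫ x, b x ∂μ with hT
  set M := ∫ x, b x * f x ∂μ with hM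
  have hT0 : 0 ≤ T := integral_nonneg hb0
  rcases hT0.eq_or_lt with h | hTpos
  · have h1 : b =ᵐ[μ] 0 := (integral_eq_zero_iff_of_nonneg hb0 hb).1 h.symm
    have : M = 0 := by
      rw [hM, ← integral_zero α ℝ (μ := μ)]
      refine integral_congr_ae ?_
      filter_upwards [h1] with x hx
      simp [hx]
    rw [this, ← h]
    simp
  set a := M / T with ha
  have key : 4 * a ^ 3 * M - 3 * a ^ 4 * T ≤ ∫ x, b x * f x ^ 4 ∂μ := by
    rw [hM, hT, ← integral_const_mul, ← integral_const_mul,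
      ← integral_sub (hbf.const_mul _) (hb.const_mul _)]
    refine integral_mono ((hbf.const_mul _).sub (hb.const_mul _)) hbf4 fun x => ?_
    have h1 : 0 ≤ f x ^ 4 - 4 * a ^ 3 * f x + 3 * a ^ 4 := by
      have : f x ^ 4 - 4 * a ^ 3 * f x + 3 * a ^ 4 =
          (f x - a) ^ 2 * ((f x + a) ^ 2 + 2 * a ^ 2) := by ring
      rw [this]
      positivity
    have := mul_nonneg (hb0 x) h1
    simp only
    linarith
  have h2 : T ^ 3 * (4 * a ^ 3 * M - 3 * a ^ 4 * T) = M ^ 4 := by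
    rw [ha]
    field_simp
    ring
  rw [← h2]
  exact mul_le_mul_of_nonneg_left key (by positivity)

theorem Complex.norm_pow_four_le (z : ℂ) : ‖z‖ ^ 4 ≤ 2 * z.re ^ 4 + 2 * z.im ^ 4 := by
  have : ‖z‖ ^ 4 = (z.re ^ 2 + z.im ^ 2) ^ 2 := by
    rw [show ‖z‖ ^ 4 = (‖z‖ ^ 2) ^ 2 by ring, Complex.sq_norm, Complex.normSq_apply]
    ring
  rw [this]
  nlinarith [sq_nonneg (z.re ^ 2 - z.im ^ 2)]

theorem integral_pow_four_centered_average_le {ι E : Type*} [Fintype ι] [Nonempty ι]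
    [MeasurableSpace E] {F : Measure E} [IsProbabilityMeasure F] {u : E → ℝ} (hu : Measurable u)
    (hb : ∀ x, |u x| ≤ 1) :
    ∫ x, ((Fintype.card ι : ℝ)⁻¹ * ∑ i : ι, u (x i) - ∫ y, u y ∂F) ^ 4 ∂Measure.pi (fun _ : ι => F)
      ≤ 48 * Real.exp 2 / (Fintype.card ι : ℝ) ^ 2 := by
  set N : ℝ := (Fintype.card ι : ℝ) with hN
  have hNpos : 0 < N := by rw [hN]; exact_mod_cast Fintype.card_pos
  have hui : Integrable u F := Integrable.of_bound hu.aestronglyMeasurable 1 (ae_of_all _ hb)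
  set m := ∫ y, u y ∂F with hm
  have hm1 : |m| ≤ 1 := by
    have := norm_integral_le_of_norm_le_const (μ := F) (f := u) (C := 1) (ae_of_all _ hb)
    simpa using this
  have hind : iIndepFun (fun (i : ι) (x : ι → E) => u (x i) - m) (Measure.pi fun _ : ι => F) :=
    iIndepFun_pi (X := fun (_ : ι) (y : E) => u y - m) fun i => (hu.sub_const m).aemeasurable
  have h := integral_sum_pow_four_le hind
    (fun i => (hu.comp (measurable_pi_apply i)).sub_const m)
    (fun i x => (abs_sub _ _).trans (by linarith [hb (x i)])) (fun i => by
      rw [integral_comp_eval (μ := fun _ : ι => F) (i := i) (f := fun y => u y - m)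
        (hu.sub_const m).aestronglyMeasurable, integral_sub hui (integrable_const _)]
      simp [hm])
  have heq : ∀ x : ι → E, (N⁻¹ * ∑ i, u (x i) - m) ^ 4 = (N ^ 4)⁻¹ * (∑ i, (u (x i) - m)) ^ 4 := by
    intro x
    rw [Finset.sum_sub_distrib, Finset.sum_const, Finset.card_univ, nsmul_eq_mul, ← hN]
    field_simp
  simp_rw [heq]
  rw [integral_const_mul, inv_mul_le_iff₀ (by positivity)]
  refine h.trans (le_of_eq ?_)
  field_simp
  rw [hN]

theorem norm_charFun_sub_le_two {E : Type*} [SeminormedAddCommGroup E] [InnerProductSpace ℝ E]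
    [MeasurableSpace E] (μ ν : Measure E) [IsProbabilityMeasure μ] [IsProbabilityMeasure ν]
    (t : E) : ‖charFun μ t - charFun ν t‖ ≤ 2 :=
  (norm_sub_le _ _).trans ((add_le_add (norm_charFun_le_one t) (norm_charFun_le_one t)).trans
    (by norm_num))

section charFun

open scoped RealInnerProductSpace

variable {E : Type*} [NormedAddCommGroup E] [InnerProductSpace ℝ E]
  [MeasurableSpace E] [BorelSpace E]

theorem re_charFun [SecondCountableTopology E] (μ : Measure E) [IsFiniteMeasure μ] (t : E) :
    (charFun μ t).re = ∫ x, Real.cos ⟪x, t⟫ ∂μ := by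
  rw [charFun_apply]
  have hi : Integrable (fun x => Complex.exp (⟪x, t⟫ * Complex.I)) μ :=
    Integrable.of_bound (by fun_prop : Continuous fun x : E =>
      Complex.exp (⟪x, t⟫ * Complex.I)).aestronglyMeasurable 1
      (ae_of_all _ fun x => (Complex.norm_exp_ofReal_mul_I _).le)
  have := integral_re hi
  simp only [RCLike.re_to_complex] at this
  rw [← this]
  simp only [Complex.exp_ofReal_mul_I_re]

theorem im_charFun [SecondCountableTopology E] (μ : Measure E) [IsFiniteMeasure μ] (t : E) :
    (charFun μ t).im = ∫ x, Real.sin ⟪x, t⟫ ∂μ := by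
  rw [charFun_apply]
  have hi : Integrable (fun x => Complex.exp (⟪x, t⟫ * Complex.I)) μ :=
    Integrable.of_bound (by fun_prop : Continuous fun x : E =>
      Complex.exp (⟪x, t⟫ * Complex.I)).aestronglyMeasurable 1
      (ae_of_all _ fun x => (Complex.norm_exp_ofReal_mul_I _).le)
  have := integral_im hi
  simp only [RCLike.im_to_complex] at this
  rw [← this]
  simp only [Complex.exp_ofReal_mul_I_im]

variable [FiniteDimensional ℝ E] {ι : Type*} [Fintype ι] {F : Measure E}
  [IsProbabilityMeasure F]

theorem charFun_finiteEmpirical (x : ι → E) (t : E) :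
    charFun (finiteEmpirical x) t =
      (Fintype.card ι : ℝ)⁻¹ • ∑ i, Complex.exp (⟪x i, t⟫ * Complex.I) := by
  rw [charFun_apply, integral_finiteEmpirical]

/-- The weighted `L¹` distance between the characteristic functions of `μ` and of `ν`. -/
noncomputable def charFunDist (b : E → ℝ) (μ ν : Measure E) : ℝ :=
  ∫ ξ, b ξ * ‖charFun μ ((2 * Real.pi) • ξ) - charFun ν ((2 * Real.pi) • ξ)‖

theorem charFunDist_nonneg {b : E → ℝ} (hb0 : ∀ ξ, 0 ≤ b ξ) (μ ν : Measure E) :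
    0 ≤ charFunDist b μ ν :=
  integral_nonneg fun ξ => mul_nonneg (hb0 ξ) (norm_nonneg _)

theorem measurable_charFunDist_finiteEmpirical {b : E → ℝ} (hbc : Continuous b) :
    Measurable fun x : ι → E => charFunDist b (finiteEmpirical x) F := by
  have hF : Continuous (charFun F) := continuous_charFun
  have h : Continuous fun p : (ι → E) × E => b p.2 *
      ‖charFun (finiteEmpirical p.1) ((2 * Real.pi) • p.2) - charFun F ((2 * Real.pi) • p.2)‖ := by
    simp only [charFun_finiteEmpirical]
    fun_prop
  exact (h.stronglyMeasurable.integral_prod_right (ν := volume)).measurable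

variable [Nonempty ι]

theorem integral_norm_charFun_sub_pow_four_le (t : E) :
    ∫ x, ‖charFun (finiteEmpirical x) t - charFun F t‖ ^ 4 ∂Measure.pi (fun _ : ι => F) ≤
      192 * Real.exp 2 / (Fintype.card ι : ℝ) ^ 2 := by
  have hc := integral_pow_four_centered_average_le (ι := ι) (F := F) (u := fun y => Real.cos ⟪y, t⟫)
    (by fun_prop) fun x => Real.abs_cos_le_one _
  have hs := integral_pow_four_centered_average_le (ι := ι) (F := F) (u := fun y => Real.sin ⟪y, t⟫)
    (by fun_prop) fun x => Real.abs_sin_le_one _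
  set A : (ι → E) → ℝ := fun x => (charFun (finiteEmpirical x) t - charFun F t).re with hA
  set B : (ι → E) → ℝ := fun x => (charFun (finiteEmpirical x) t - charFun F t).im with hB
  have hA' : ∀ x, (Fintype.card ι : ℝ)⁻¹ * ∑ i : ι, Real.cos ⟪x i, t⟫ - ∫ y, Real.cos ⟪y, t⟫ ∂F
      = A x := by
    intro x
    rw [hA]
    simp only
    rw [Complex.sub_re, re_charFun, re_charFun, integral_finiteEmpirical, smul_eq_mul]
  have hB' : ∀ x, (Fintype.card ι : ℝ)⁻¹ * ∑ i : ι, Real.sin ⟪x i, t⟫ - ∫ y, Real.sin ⟪y, t⟫ ∂F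
      = B x := by
    intro x
    rw [hB]
    simp only
    rw [Complex.sub_im, im_charFun, im_charFun, integral_finiteEmpirical, smul_eq_mul]
  simp_rw [hA'] at hc
  simp_rw [hB'] at hs
  have hcont : Continuous fun x : ι → E => charFun (finiteEmpirical x) t - charFun F t := by
    simp_rw [charFun_finiteEmpirical]
    fun_prop
  have hbd : ∀ x : ι → E, ‖charFun (finiteEmpirical x) t - charFun F t‖ ≤ 2 := fun x =>
    norm_charFun_sub_le_two _ _ _
  have hAc : Continuous A := Complex.continuous_re.comp hcont
  have hBc : Continuous B := Complex.continuous_im.comp hcont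
  have hA2 : ∀ x, ‖A x‖ ≤ 2 := fun x => (Complex.abs_re_le_norm _).trans (hbd x)
  have hB2 : ∀ x, ‖B x‖ ≤ 2 := fun x => (Complex.abs_im_le_norm _).trans (hbd x)
  have hpow : ∀ G : (ι → E) → ℝ, Continuous G → (∀ x, ‖G x‖ ≤ 2) →
      Integrable (fun x => G x ^ 4) (Measure.pi fun _ : ι => F) := by
    intro G hG hG2
    have h4 : Continuous fun x => G x ^ 4 := by fun_prop
    refine Integrable.of_bound h4.aestronglyMeasurable (2 ^ 4) (ae_of_all _ fun x => ?_)
    rw [norm_pow]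
    exact pow_le_pow_left₀ (norm_nonneg _) (hG2 x) 4
  have hAi := hpow A hAc hA2
  have hBi := hpow B hBc hB2
  calc ∫ x, ‖charFun (finiteEmpirical x) t - charFun F t‖ ^ 4 ∂Measure.pi (fun _ : ι => F)
      ≤ ∫ x, (2 * A x ^ 4 + 2 * B x ^ 4) ∂Measure.pi (fun _ : ι => F) :=
        integral_mono_of_nonneg (ae_of_all _ fun x => by positivity)
          ((hAi.const_mul 2).add (hBi.const_mul 2))
          (ae_of_all _ fun x => Complex.norm_pow_four_le _)
    _ = 2 * ∫ x, A x ^ 4 ∂Measure.pi (fun _ : ι => F) +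
        2 * ∫ x, B x ^ 4 ∂Measure.pi (fun _ : ι => F) := by
        rw [integral_add (hAi.const_mul 2) (hBi.const_mul 2), integral_const_mul,
          integral_const_mul]
    _ ≤ 2 * (48 * Real.exp 2 / (Fintype.card ι : ℝ) ^ 2) +
        2 * (48 * Real.exp 2 / (Fintype.card ι : ℝ) ^ 2) := by gcongr
    _ = _ := by ring

theorem charFunDist_le {b : E → ℝ} (hb0 : ∀ ξ, 0 ≤ b ξ) (hb : Integrable b) (μ ν : Measure E)
    [IsProbabilityMeasure μ] [IsProbabilityMeasure ν] : charFunDist b μ ν ≤ 2 * ∫ ξ, b ξ := by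
  rw [charFunDist, ← integral_const_mul]
  refine integral_mono_of_nonneg (ae_of_all _ fun ξ => mul_nonneg (hb0 ξ) (norm_nonneg _))
    (hb.const_mul 2) (ae_of_all _ fun ξ => ?_)
  change _ ≤ 2 * b ξ
  rw [mul_comm (2 : ℝ) (b ξ)]
  exact mul_le_mul_of_nonneg_left (norm_charFun_sub_le_two _ _ _) (hb0 ξ)

theorem integrable_charFunDist_pow {b : E → ℝ} (hbc : Continuous b) (hb0 : ∀ ξ, 0 ≤ b ξ)
    (hb : Integrable b) (k : ℕ) :
    Integrable (fun x : ι → E => charFunDist b (finiteEmpirical x) F ^ k)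
      (Measure.pi fun _ : ι => F) :=
  Integrable.of_bound ((measurable_charFunDist_finiteEmpirical hbc).pow_const k).aestronglyMeasurable
    ((2 * ∫ ξ, b ξ) ^ k) (ae_of_all _ fun x => by
      rw [norm_pow, Real.norm_of_nonneg (charFunDist_nonneg hb0 _ _)]
      exact pow_le_pow_left₀ (charFunDist_nonneg hb0 _ _) (charFunDist_le hb0 hb _ _) k)

theorem integral_charFunDist_pow_four_le {b : E → ℝ} (hbc : Continuous b) (hb0 : ∀ ξ, 0 ≤ b ξ)
    (hb : Integrable b) :
    ∫ x, charFunDist b (finiteEmpirical x) F ^ 4 ∂Measure.pi (fun _ : ι => F) ≤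
      (∫ ξ, b ξ) ^ 4 * (192 * Real.exp 2) / (Fintype.card ι : ℝ) ^ 2 := by
  set φ : (ι → E) → E → ℝ := fun x ξ =>
    ‖charFun (finiteEmpirical x) ((2 * Real.pi) • ξ) - charFun F ((2 * Real.pi) • ξ)‖ with hφ
  have hF : Continuous (charFun F) := continuous_charFun
  have hφc : Continuous fun p : (ι → E) × E => φ p.1 p.2 := by
    simp only [hφ, charFun_finiteEmpirical]
    fun_prop
  have hφ2 : ∀ x ξ, φ x ξ ≤ 2 := fun x ξ => norm_charFun_sub_le_two _ _ _
  have hφ0 : ∀ x ξ, 0 ≤ φ x ξ := fun x ξ => norm_nonneg _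
  have hφx : ∀ x, Continuous (φ x) := fun x => by
    simp only [hφ, charFun_finiteEmpirical]
    fun_prop
  have hT0 : 0 ≤ ∫ ξ, b ξ := integral_nonneg hb0
  have hprod : Integrable (fun p : (ι → E) × E => b p.2 * φ p.1 p.2 ^ 4)
      ((Measure.pi fun _ : ι => F).prod volume) :=
    (hb.comp_snd _).mul_bdd (c := 2 ^ 4) (hφc.pow 4).aestronglyMeasurable
      (ae_of_all _ fun p => by
        rw [norm_pow, Real.norm_of_nonneg (hφ0 _ _)]
        exact pow_le_pow_left₀ (hφ0 _ _) (hφ2 _ _) 4)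
  have h1 : ∀ x, charFunDist b (finiteEmpirical x) F ^ 4 ≤
      (∫ ξ, b ξ) ^ 3 * ∫ ξ, b ξ * φ x ξ ^ 4 := by
    intro x
    refine integral_mul_pow_four_le hb hb0 ?_ ?_
    · exact hb.mul_bdd (c := 2) (hφx x).aestronglyMeasurable (ae_of_all _ fun ξ => by
        rw [Real.norm_of_nonneg (hφ0 _ _)]
        exact hφ2 _ _)
    · exact hb.mul_bdd (c := 2 ^ 4) ((hφx x).pow 4).aestronglyMeasurable (ae_of_all _ fun ξ => by
        rw [norm_pow, Real.norm_of_nonneg (hφ0 _ _)]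
        exact pow_le_pow_left₀ (hφ0 _ _) (hφ2 _ _) 4)
  calc ∫ x, charFunDist b (finiteEmpirical x) F ^ 4 ∂Measure.pi (fun _ : ι => F)
      ≤ ∫ x, (∫ ξ, b ξ) ^ 3 * (∫ ξ, b ξ * φ x ξ ^ 4) ∂Measure.pi (fun _ : ι => F) :=
        integral_mono (integrable_charFunDist_pow hbc hb0 hb 4)
          (hprod.integral_prod_left.const_mul _) h1
    _ = (∫ ξ, b ξ) ^ 3 * ∫ ξ, b ξ * (∫ x, φ x ξ ^ 4 ∂Measure.pi (fun _ : ι => F)) := by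
        rw [integral_const_mul, integral_integral_swap hprod]
        simp_rw [integral_const_mul]
    _ ≤ (∫ ξ, b ξ) ^ 3 * ∫ ξ, b ξ * (192 * Real.exp 2 / (Fintype.card ι : ℝ) ^ 2) := by
        refine mul_le_mul_of_nonneg_left ?_ (by positivity)
        refine integral_mono_of_nonneg (ae_of_all _ fun ξ => mul_nonneg (hb0 ξ)
          (integral_nonneg fun x => by positivity)) (hb.mul_const _) (ae_of_all _ fun ξ => ?_)
        exact mul_le_mul_of_nonneg_left (integral_norm_charFun_sub_pow_four_le _) (hb0 ξ)
    _ = _ := by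
        rw [integral_mul_const]
        ring

end charFun

/-- The mean of the translates of `h` under `μ`. -/
noncomputable def potential {E : Type*} [AddGroup E] [MeasurableSpace E] (h : E → ℝ)
    (μ : Measure E) (c : E) : ℝ :=
  ∫ x, h (x - c) ∂μ

/-- The probability that `D` takes values at distance at most `a` at two independent points. -/
noncomputable def closeProb {α : Type*} [MeasurableSpace α] (F : Measure α) (D : α → ℝ) (a : ℝ) :
    ℝ :=
  (F.prod F).real {p | |D p.1 - D p.2| ≤ a}

/-- The probability that `D` and `D'` compare two independent points differently. -/
noncomputable def discordProb {α : Type*} [MeasurableSpace α] (F : Measure α) (D D' : α → ℝ) : ℝ :=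
  (F.prod F).real {p | ¬ (D p.1 ≤ D p.2 ↔ D' p.1 ≤ D' p.2)}

theorem closeProb_le {α : Type*} [MeasurableSpace α] {F : Measure α} [IsProbabilityMeasure F]
    {D : α → ℝ} {C : ℝ} (hD : Measurable D)
    (hA : ∀ a b, a ≤ b → F.real {z | D z ∈ Set.Icc a b} ≤ C * (b - a)) {a : ℝ} (ha : 0 ≤ a) :
    closeProb F D a ≤ 2 * C * a := by
  rw [closeProb, measureReal_prod_eq_integral F F (measurableSet_le (by fun_prop) measurable_const)]
  refine (integral_mono_of_nonneg (ae_of_all _ fun z => measureReal_nonneg)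
    (integrable_const (2 * C * a)) (ae_of_all _ fun z => ?_)).trans (by simp)
  have : Prod.mk z ⁻¹' {p : α × α | |D p.1 - D p.2| ≤ a} =
      {z' | D z' ∈ Set.Icc (D z - a) (D z + a)} := by
    ext z'
    simp only [Set.mem_preimage, Set.mem_ofPred_eq, Set.mem_Icc, abs_le]
    constructor <;> rintro ⟨h1, h2⟩ <;> constructor <;> linarith
  change F.real (Prod.mk z ⁻¹' {p : α × α | |D p.1 - D p.2| ≤ a}) ≤ 2 * C * a
  rw [this]
  exact (hA _ _ (by linarith)).trans (le_of_eq (by ring))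

theorem closeProb_mono {α : Type*} [MeasurableSpace α] {F : Measure α} [IsProbabilityMeasure F]
    {D D' : α → ℝ} {a b x : ℝ} (h : ∀ᵐ z ∂F, |D z - D' z| ≤ x) (hab : a + 2 * x ≤ b) :
    closeProb F D a ≤ closeProb F D' b := by
  have h2 : ∀ᵐ p ∂F.prod F, |D p.1 - D' p.1| ≤ x ∧ |D p.2 - D' p.2| ≤ x :=
    (Measure.quasiMeasurePreserving_fst.ae h).and (Measure.quasiMeasurePreserving_snd.ae h)
  refine ENNReal.toReal_mono (measure_ne_top _ _) (measure_mono_ae ?_)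
  filter_upwards [h2] with p ⟨h1, h2⟩ hp
  change |_ - _| ≤ _ at hp
  change |_ - _| ≤ _
  rw [abs_le] at *
  constructor <;> linarith

theorem discordProb_le_closeProb {α : Type*} [MeasurableSpace α] {F : Measure α}
    [IsProbabilityMeasure F] {D D' : α → ℝ} {x : ℝ} (h : ∀ᵐ z ∂F, |D z - D' z| ≤ x) :
    discordProb F D D' ≤ closeProb F D' (2 * x) := by
  have h2 : ∀ᵐ p ∂F.prod F, |D p.1 - D' p.1| ≤ x ∧ |D p.2 - D' p.2| ≤ x :=
    (Measure.quasiMeasurePreserving_fst.ae h).and (Measure.quasiMeasurePreserving_snd.ae h)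
  refine ENNReal.toReal_mono (measure_ne_top _ _) (measure_mono_ae ?_)
  filter_upwards [h2] with p ⟨h1, h2⟩ hp
  change ¬ (_ ↔ _) at hp
  change |_ - _| ≤ _
  rw [abs_le] at *
  by_cases hc : D p.1 ≤ D p.2
  · have : ¬ D' p.1 ≤ D' p.2 := fun hc' => hp ⟨fun _ => hc', fun _ => hc⟩
    constructor <;> linarith
  · have : D' p.1 ≤ D' p.2 := by
      by_contra hc'
      exact hp ⟨fun h => absurd h hc, fun h => absurd h hc'⟩
    constructor <;> linarith

theorem le_one_add_pow_four (x : ℝ) : x ≤ 1 + x ^ 4 := by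
  nlinarith [sq_nonneg (x ^ 2 - 1), sq_nonneg (x - 1), sq_nonneg x]

theorem mul_add_le_of_concentration {C δ K N ρ M p q : ℝ} (hC : 0 ≤ C) (hδ : 0 ≤ δ) (hK1 : 1 ≤ K)
    (hρ1 : 1 ≤ ρ) (hρ2 : ρ * ρ = N) (hMu : 0 ≤ M) (hp0 : 0 ≤ p) (hq0 : 0 ≤ q)
    (hqu : q ≤ 4 * C * M) (hpu : p ≤ 4 * C * (M + 2 / N))
    (hgood : ρ * M ≤ K → p ≤ 36 * C * δ * ρ⁻¹) :
    p * (p + q) ≤ N⁻¹ * ((8 * C * (36 * C * δ)) * (2 + N ^ 2 * M ^ 4) +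
      192 * C ^ 2 / K ^ 2 * (N ^ 2 * M ^ 4)) := by
  have hρpos : 0 < ρ := by linarith
  have hK0 : 0 ≤ K := by linarith
  have hNpos : 0 < N := by rw [← hρ2]; positivity
  have hMle : ρ * M ≤ 1 + N ^ 2 * M ^ 4 := by
    have : N ^ 2 * M ^ 4 = (ρ * M) ^ 4 := by rw [← hρ2]; ring
    rw [this]
    exact le_one_add_pow_four _
  have hs : p + q ≤ 8 * C * (M + N⁻¹) := by
    have : 4 * C * (M + 2 / N) + 4 * C * M = 8 * C * (M + N⁻¹) := by
      field_simp; ring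
    linarith
  have hN' : N⁻¹ ≤ ρ⁻¹ := by
    rw [← hρ2]
    exact inv_anti₀ hρpos (by nlinarith)
  by_cases hMK : ρ * M ≤ K
  · have h2 : p * (p + q) ≤ (36 * C * δ * ρ⁻¹) * (8 * C * (M + N⁻¹)) :=
      mul_le_mul (hgood hMK) hs (add_nonneg (hp0) (hq0)) (by positivity)
    have h3 : ρ⁻¹ * (M + N⁻¹) ≤ N⁻¹ * (2 + N ^ 2 * M ^ 4) := by
      have h4 : ρ⁻¹ * M = N⁻¹ * (ρ * M) := by
        rw [← hρ2]; field_simp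
      have h5 : ρ⁻¹ * N⁻¹ ≤ 1 * N⁻¹ :=
        mul_le_mul_of_nonneg_right (inv_le_one_of_one_le₀ hρ1) (by positivity)
      have h6 : N⁻¹ * (ρ * M) ≤ N⁻¹ * (1 + N ^ 2 * M ^ 4) :=
        mul_le_mul_of_nonneg_left (hMle) (by positivity)
      rw [mul_add, h4]
      linarith
    have h7 : 0 ≤ N⁻¹ * (192 * C ^ 2 / K ^ 2 * (N ^ 2 * M ^ 4)) := by positivity
    have h8 := mul_le_mul_of_nonneg_left h3 (by positivity : 0 ≤ 36 * C * δ * (8 * C))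
    rw [mul_add]
    linarith
  · have hMK : K < ρ * M := not_le.1 hMK
    have hMρ : ρ⁻¹ ≤ M := by
      rw [inv_le_iff_one_le_mul₀ hρpos, mul_comm]
      linarith
    have hs' : p + q ≤ 16 * C * M := by nlinarith
    have hp' : p ≤ 12 * C * M := by
      have : 2 / N = 2 * N⁻¹ := by ring
      rw [this] at hpu
      nlinarith
    have h2 : p * (p + q) ≤ (12 * C * M) * (16 * C * M) :=
      mul_le_mul hp' hs' (add_nonneg (hp0) (hq0)) (by positivity)
    have h3 : M ^ 2 ≤ N⁻¹ * (1 / K ^ 2 * (N ^ 2 * M ^ 4)) := by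
      have h4 : K ^ 2 ≤ N * M ^ 2 := by
        have : N * M ^ 2 = (ρ * M) ^ 2 := by rw [← hρ2]; ring
        rw [this]
        exact pow_le_pow_left₀ hK0 hMK.le 2
      have h5 : N⁻¹ * (1 / K ^ 2 * (N ^ 2 * M ^ 4)) = (N * M ^ 2) / K ^ 2 * M ^ 2 := by
        field_simp
      rw [h5]
      refine le_mul_of_one_le_left (sq_nonneg _) ?_
      rw [one_le_div (by positivity)]
      exact h4
    have h6 := mul_le_mul_of_nonneg_left h3 (by positivity : 0 ≤ 192 * C ^ 2)
    have h7 : 0 ≤ N⁻¹ * ((8 * C * (36 * C * δ)) * (2 + N ^ 2 * M ^ 4)) := by positivity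
    have h8 : 192 * C ^ 2 * (N⁻¹ * (1 / K ^ 2 * (N ^ 2 * M ^ 4))) =
      N⁻¹ * (192 * C ^ 2 / K ^ 2 * (N ^ 2 * M ^ 4)) := by ring
    rw [mul_add]
    linarith

theorem add_le_of_concentration {C N ρ M p q : ℝ} (hC : 0 ≤ C) (hρ1 : 1 ≤ ρ) (hρ2 : ρ * ρ = N)
    (hqu : q ≤ 4 * C * M) (hpu : p ≤ 4 * C * (M + 2 / N)) :
    p + q ≤ 8 * C * ρ⁻¹ * (2 + N ^ 2 * M ^ 4) := by
  have hρpos : 0 < ρ := by linarith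
  have hNpos : 0 < N := by rw [← hρ2]; positivity
  have hMle : ρ * M ≤ 1 + N ^ 2 * M ^ 4 := by
    have : N ^ 2 * M ^ 4 = (ρ * M) ^ 4 := by rw [← hρ2]; ring
    rw [this]
    exact le_one_add_pow_four _
  have hs : p + q ≤ 8 * C * (M + N⁻¹) := by
    have : 4 * C * (M + 2 / N) + 4 * C * M = 8 * C * (M + N⁻¹) := by
      field_simp; ring
    linarith
  have hN' : N⁻¹ ≤ ρ⁻¹ := by
    rw [← hρ2]
    exact inv_anti₀ hρpos (by nlinarith)
  have h4 : M = ρ⁻¹ * (ρ * M) := by field_simp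
  have h6 : ρ⁻¹ * (ρ * M) ≤ ρ⁻¹ * (1 + N ^ 2 * M ^ 4) :=
    mul_le_mul_of_nonneg_left (hMle) (by positivity)
  have h7 : M + N⁻¹ ≤ ρ⁻¹ * (2 + N ^ 2 * M ^ 4) := by linarith
  refine hs.trans ?_
  have := mul_le_mul_of_nonneg_left h7 (by positivity : 0 ≤ 8 * C)
  linarith

section

open scoped ContDiff

theorem continuous_potential {E : Type*} [NormedAddCommGroup E] [SecondCountableTopology E]
    [MeasurableSpace E] [BorelSpace E] {h : E → ℝ} (hc : Continuous h) (h1 : ∀ v, |h v| ≤ 1)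
    (μ : Measure E)
    [IsFiniteMeasure μ] : Continuous (potential h μ) :=
  continuous_of_dominated (bound := fun _ => 1)
    (fun c => (by fun_prop : Continuous fun x => h (x - c)).aestronglyMeasurable)
    (fun c => ae_of_all _ fun x => h1 _) (integrable_const _)
    (ae_of_all _ fun x => by fun_prop)

variable {E : Type*} [NormedAddCommGroup E] [InnerProductSpace ℝ E] [FiniteDimensional ℝ E]
  [MeasurableSpace E] [BorelSpace E] {h : E → ℝ} {F : Measure E} [IsProbabilityMeasure F]
  {C R r : ℝ}

/-- Mean concentration and discordance of the empirical depth of an i.i.d. sample. -/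
theorem exists_forall_integral_closeProb_discordProb_le (hh : ContDiff ℝ ∞ h)
    (h1 : ∀ v, |h v| ≤ 1) (hR : ∀ᵐ z ∂F, ‖z‖ ≤ R)
    (hA : ∀ a b, a ≤ b → F.real {z | sphereInf r (potential h F) z ∈ Set.Icc a b} ≤ C * (b - a))
    (hC : 0 < C) {η : ℝ} (hη : 0 < η) :
    ∃ N₀ : ℕ, ∀ (ι : Type) [Fintype ι] [Nonempty ι], N₀ ≤ Fintype.card ι →
      (∫ u, (closeProb F (sphereInf r (potential h (finiteEmpirical u))) (4 / Fintype.card ι) *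
        (closeProb F (sphereInf r (potential h (finiteEmpirical u))) (4 / Fintype.card ι) +
          discordProb F (sphereInf r (potential h (finiteEmpirical u)))
            (sphereInf r (potential h F)))) ∂Measure.pi (fun _ : ι => F)) ≤
        η / Fintype.card ι ∧
      (∫ u, (closeProb F (sphereInf r (potential h (finiteEmpirical u))) (4 / Fintype.card ι) +
          discordProb F (sphereInf r (potential h (finiteEmpirical u)))
            (sphereInf r (potential h F))) ∂Measure.pi (fun _ : ι => F)) ≤ η := by
  have hhc : Continuous h := hh.continuous
  obtain ⟨b, hbc, hb0, hb, hdom⟩ := exists_integral_sub_le_integral_charFun hh R (R + r)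
  set Γ : ℝ := (∫ ξ, b ξ) ^ 4 * (192 * Real.exp 2) with hΓ
  have hΓ0 : 0 ≤ Γ := by positivity
  obtain ⟨K, hK1, hK⟩ : ∃ K : ℝ, 1 ≤ K ∧ 192 * C ^ 2 * Γ / K ^ 2 ≤ η / 2 := by
    refine ⟨max 1 (384 * C ^ 2 * Γ / η), le_max_left _ _, ?_⟩
    set K := max 1 (384 * C ^ 2 * Γ / η)
    have hK1 : 1 ≤ K := le_max_left _ _
    have hK2 : 384 * C ^ 2 * Γ / η ≤ K := le_max_right _ _
    rw [div_le_iff₀ hη] at hK2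
    rw [div_le_iff₀ (by positivity)]
    nlinarith [mul_nonneg hη.le (mul_nonneg (sub_nonneg.2 hK1) (by positivity : 0 ≤ K))]
  have hK0 : 0 ≤ K := zero_le_one.trans hK1
  set δ : ℝ := η / (2 * (8 * C * (36 * C) * (2 + Γ))) with hδdef
  have hδ : 0 < δ := by positivity
  have hδη : 8 * C * (36 * C * δ) * (2 + Γ) ≤ η / 2 := by
    rw [hδdef]
    apply le_of_eq
    field_simp
  have hconc := eventually_forall_prod_real_abs_sphereInf_sub_le (r := r)
    (continuous_potential hhc h1 F) hR hA hC hK0 hδ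
  have hsqrt : Tendsto (fun n : ℕ => (√(n : ℝ))⁻¹) atTop (𝓝[>] 0) := by
    refine tendsto_inv_atTop_nhdsGT_zero.comp ?_
    exact Real.tendsto_sqrt_atTop.comp tendsto_natCast_atTop_atTop
  have hN4 : ∀ᶠ n : ℕ in atTop, 4 * (√(n : ℝ))⁻¹ ≤ δ := by
    have := (tendsto_nhds_of_tendsto_nhdsWithin hsqrt).const_mul 4
    rw [mul_zero] at this
    exact (this.eventually_lt_const hδ).mono fun _ hn => hn.le
  have hNη : ∀ᶠ n : ℕ in atTop, 8 * C * (2 + Γ) * (√(n : ℝ))⁻¹ ≤ η := by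
    have := (tendsto_nhds_of_tendsto_nhdsWithin hsqrt).const_mul (8 * C * (2 + Γ))
    rw [mul_zero] at this
    exact (this.eventually_lt_const hη).mono fun _ hn => hn.le
  obtain ⟨N₀, hN₀⟩ := eventually_atTop.1 ((hsqrt.eventually hconc).and (hN4.and hNη))
  refine ⟨N₀, fun ι _ _ hι => ?_⟩
  obtain ⟨hconc, hN4, hNη⟩ := hN₀ _ hι
  set N : ℝ := (Fintype.card ι : ℝ) with hN
  have hN1 : 1 ≤ N := by rw [hN]; exact_mod_cast Fintype.card_pos
  have hNpos : 0 < N := by linarith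
  set ρ := √N with hρ
  have hρ2 : ρ * ρ = N := Real.mul_self_sqrt hNpos.le
  have hρ1 : 1 ≤ ρ := Real.one_le_sqrt.2 hN1
  have hρpos : 0 < ρ := by linarith
  set D := sphereInf r (potential h F) with hD
  have hDc : Continuous D := continuous_sphereInf_right (continuous_potential hhc h1 F)
  set M : (ι → E) → ℝ := fun u => charFunDist b (finiteEmpirical u) F with hM
  have hM0 : ∀ u, 0 ≤ M u := fun u => charFunDist_nonneg hb0 _ _
  set p : (ι → E) → ℝ := fun u =>
    closeProb F (sphereInf r (potential h (finiteEmpirical u))) (4 / N) with hp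
  set q : (ι → E) → ℝ := fun u =>
    discordProb F (sphereInf r (potential h (finiteEmpirical u))) D with hq
  have hp0 : ∀ u, 0 ≤ p u := fun u => measureReal_nonneg
  have hq0 : ∀ u, 0 ≤ q u := fun u => measureReal_nonneg
  have hae : ∀ᵐ u ∂Measure.pi (fun _ : ι => F), ∀ i, ‖u i‖ ≤ R := by
    rw [ae_all_iff]
    exact fun i => (measurePreserving_eval (fun _ : ι => F) i).quasiMeasurePreserving.ae hR
  have hq_le : ∀ᵐ u ∂Measure.pi (fun _ : ι => F), q u ≤ 4 * C * M u ∧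
      p u ≤ 4 * C * (M u + 2 / N) ∧ (ρ * M u ≤ K → p u ≤ 36 * C * δ * ρ⁻¹) := by
    filter_upwards [hae] with u hu
    obtain ⟨hd1, hd2⟩ := hdom (finiteEmpirical u) F (ae_finiteEmpirical hu) hR
    have hgu : Continuous (potential h (finiteEmpirical u)) := continuous_potential hhc h1 _
    have hg : Continuous (potential h F) := continuous_potential hhc h1 _
    have hclose : ∀ᵐ z ∂F, |sphereInf r (potential h (finiteEmpirical u)) z - D z| ≤ M u := by
      filter_upwards [hR] with z hz
      refine abs_sphereInf_sub_le hgu hg (hM0 u) fun c hc => ?_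
      exact hd1 c (by simpa using sphere_subset_closedBall_of_norm_le hz hc)
    refine ⟨?_, ?_, ?_⟩
    · refine (discordProb_le_closeProb hclose).trans ?_
      refine (closeProb_le hDc.measurable hA (by have := hM0 u; positivity)).trans (le_of_eq ?_)
      ring
    · refine (closeProb_mono hclose le_rfl).trans ?_
      refine (closeProb_le hDc.measurable hA (by have := hM0 u; positivity)).trans (le_of_eq ?_)
      ring
    · intro hMK
      have hc1 := hconc
        (fun c => ρ * (potential h (finiteEmpirical u) c - potential h F c)) (by fun_prop)
        (fun c hc => by
          rw [abs_mul, abs_of_pos hρpos]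
          exact (mul_le_mul_of_nonneg_left (hd1 c (by simpa using hc)) hρpos.le).trans hMK)
        (fun c hc c' hc' => by
          rw [← mul_sub, abs_mul, abs_of_pos hρpos]
          refine (mul_le_mul_of_nonneg_left (hd2 c (by simpa using hc) c' (by simpa using hc'))
            hρpos.le).trans ?_
          rw [← mul_assoc]
          exact mul_le_mul_of_nonneg_right hMK (norm_nonneg _))
      have heq : (fun c => potential h F c + ρ⁻¹ * (ρ * (potential h (finiteEmpirical u) c -
          potential h F c))) = potential h (finiteEmpirical u) := by
        ext c
        rw [← mul_assoc, inv_mul_cancel₀ hρpos.ne', one_mul]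
        ring
      rw [heq] at hc1
      refine le_trans (measureReal_mono fun z hz => ?_) hc1
      change |sphereInf r (potential h (finiteEmpirical u)) z.1 -
        sphereInf r (potential h (finiteEmpirical u)) z.2| ≤ 4 / N at hz
      change |_ - _| ≤ δ * ρ⁻¹
      refine le_trans hz ?_
      rw [← hρ2]
      have := mul_le_mul_of_nonneg_right hN4 (inv_nonneg.2 hρpos.le)
      refine le_trans (le_of_eq ?_) this
      field_simp
  have hMint : ∀ k, Integrable (fun u => M u ^ k) (Measure.pi fun _ : ι => F) := fun k =>
    integrable_charFunDist_pow hbc hb0 hb k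
  have hM4 : N ^ 2 * ∫ u, M u ^ 4 ∂Measure.pi (fun _ : ι => F) ≤ Γ := by
    have := integral_charFunDist_pow_four_le (ι := ι) (F := F) hbc hb0 hb
    rw [le_div_iff₀ (by positivity)] at this
    rw [mul_comm]
    exact this
  have hi4 : Integrable (fun u => N ^ 2 * M u ^ 4) (Measure.pi fun _ : ι => F) :=
    (hMint 4).const_mul _
  have hi2 : Integrable (fun u => 2 + N ^ 2 * M u ^ 4) (Measure.pi fun _ : ι => F) :=
    (integrable_const _).add hi4
  have hI2 : ∫ u, (2 + N ^ 2 * M u ^ 4) ∂Measure.pi (fun _ : ι => F) =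
      2 + N ^ 2 * ∫ u, M u ^ 4 ∂Measure.pi (fun _ : ι => F) := by
    rw [integral_add (integrable_const _) hi4, integral_const_mul]
    simp
  constructor
  · set B : (ι → E) → ℝ := fun u => N⁻¹ * ((8 * C * (36 * C * δ)) * (2 + N ^ 2 * M u ^ 4) +
      192 * C ^ 2 / K ^ 2 * (N ^ 2 * M u ^ 4)) with hB
    have hBint : Integrable B (Measure.pi fun _ : ι => F) :=
      ((hi2.const_mul _).add (hi4.const_mul _)).const_mul _
    have hle : ∀ᵐ u ∂Measure.pi (fun _ : ι => F), p u * (p u + q u) ≤ B u := by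
      filter_upwards [hq_le] with u ⟨hqu, hpu, hgood⟩
      exact mul_add_le_of_concentration hC.le hδ.le hK1 hρ1 hρ2 (hM0 u) (hp0 u) (hq0 u) hqu
        hpu hgood
    refine (integral_mono_of_nonneg (ae_of_all _ fun u =>
      mul_nonneg (hp0 u) (add_nonneg (hp0 u) (hq0 u))) hBint hle).trans ?_
    have hI : ∫ u, B u ∂Measure.pi (fun _ : ι => F) = N⁻¹ * ((8 * C * (36 * C * δ)) *
        (2 + N ^ 2 * ∫ u, M u ^ 4 ∂Measure.pi (fun _ : ι => F)) +
        192 * C ^ 2 / K ^ 2 * (N ^ 2 * ∫ u, M u ^ 4 ∂Measure.pi (fun _ : ι => F))) := by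
      rw [hB, integral_const_mul, integral_add (hi2.const_mul _) (hi4.const_mul _),
        integral_const_mul, integral_const_mul, hI2, integral_const_mul]
    rw [hI, div_eq_inv_mul η]
    refine mul_le_mul_of_nonneg_left ?_ (by positivity)
    have e1 : (8 * C * (36 * C * δ)) * (2 + N ^ 2 * ∫ u, M u ^ 4 ∂Measure.pi (fun _ : ι => F)) ≤
        (8 * C * (36 * C * δ)) * (2 + Γ) :=
      mul_le_mul_of_nonneg_left (by linarith) (by positivity)
    have e2 : 192 * C ^ 2 / K ^ 2 * (N ^ 2 * ∫ u, M u ^ 4 ∂Measure.pi (fun _ : ι => F)) ≤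
        192 * C ^ 2 / K ^ 2 * Γ := mul_le_mul_of_nonneg_left hM4 (by positivity)
    have e3 : 192 * C ^ 2 / K ^ 2 * Γ = 192 * C ^ 2 * Γ / K ^ 2 := by ring
    linarith
  · set B : (ι → E) → ℝ := fun u => 8 * C * ρ⁻¹ * (2 + N ^ 2 * M u ^ 4) with hB
    have hBint : Integrable B (Measure.pi fun _ : ι => F) := hi2.const_mul _
    have hle : ∀ᵐ u ∂Measure.pi (fun _ : ι => F), p u + q u ≤ B u := by
      filter_upwards [hq_le] with u ⟨hqu, hpu, _⟩
      exact add_le_of_concentration hC.le hρ1 hρ2 hqu hpu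
    refine (integral_mono_of_nonneg (ae_of_all _ fun u => add_nonneg (hp0 u) (hq0 u)) hBint
      hle).trans ?_
    have hI : ∫ u, B u ∂Measure.pi (fun _ : ι => F) = 8 * C * ρ⁻¹ *
        (2 + N ^ 2 * ∫ u, M u ^ 4 ∂Measure.pi (fun _ : ι => F)) := by
      rw [hB, integral_const_mul, hI2]
    rw [hI]
    have e1 : 8 * C * ρ⁻¹ * (2 + N ^ 2 * ∫ u, M u ^ 4 ∂Measure.pi (fun _ : ι => F)) ≤
        8 * C * ρ⁻¹ * (2 + Γ) := mul_le_mul_of_nonneg_left (by linarith) (by positivity)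
    linarith

end

section LeaveOut

variable {Ω 𝒰 𝒱 : Type*} [MeasurableSpace Ω] [MeasurableSpace 𝒰] [MeasurableSpace 𝒱]
  {P : Measure Ω} {π : Measure 𝒰} {ν : Measure 𝒱} [IsProbabilityMeasure π] [IsProbabilityMeasure ν]

theorem integrable_of_measurable_of_abs_le_const {α : Type*} [MeasurableSpace α] {μ : Measure α}
    [IsFiniteMeasure μ] {f : α → ℝ} (hf : Measurable f) {c : ℝ} (hc : ∀ x, |f x| ≤ c) :
    Integrable f μ :=
  Integrable.of_bound hf.aestronglyMeasurable c (ae_of_all _ hc)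

theorem integral_prod_prod_mul {f g : 𝒰 × 𝒱 → ℝ} (hf : Measurable f) (hg : Measurable g) {c : ℝ}
    (hfc : ∀ x, |f x| ≤ c) (hgc : ∀ x, |g x| ≤ c) :
    ∫ x, f (x.1, x.2.1) * g (x.1, x.2.2) ∂π.prod (ν.prod ν) =
      ∫ u, (∫ v, f (u, v) ∂ν) * (∫ v, g (u, v) ∂ν) ∂π := by
  rw [integral_prod]
  · refine integral_congr_ae (ae_of_all _ fun u => ?_)
    exact integral_prod_mul (fun v => f (u, v)) (fun v => g (u, v))
  · refine integrable_of_measurable_of_abs_le_const (c := c * c) (by fun_prop) fun x => ?_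
    rw [abs_mul]
    exact mul_le_mul (hfc _) (hgc _) (abs_nonneg _) ((abs_nonneg _).trans (hfc (x.1, x.2.1)))

/-- If `T₁` and `T₂` are approximated by functions of conditionally independent variables, their
mixed moment is bounded through the conditional means. -/
theorem integral_mul_le_of_condIndep_approx {U : Ω → 𝒰} {V₁ V₂ : Ω → 𝒱}
    (hm : AEMeasurable (fun ω => (U ω, (V₁ ω, V₂ ω))) P)
    (hlaw : P.map (fun ω => (U ω, (V₁ ω, V₂ ω))) = π.prod (ν.prod ν))
    {τ e : 𝒰 × 𝒱 → ℝ} (hτ : Measurable τ) (he : Measurable e) (hτ1 : ∀ x, |τ x| ≤ 1)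
    (he1 : ∀ x, |e x| ≤ 1) (hτe : ∀ u, |∫ v, τ (u, v) ∂ν| ≤ ∫ v, e (u, v) ∂ν)
    {T₁ T₂ : Ω → ℝ} (hT : Integrable (fun ω => T₁ ω * T₂ ω) P)
    (h1 : ∀ ω, |T₁ ω - τ (U ω, V₁ ω)| ≤ e (U ω, V₁ ω))
    (h2 : ∀ ω, |T₂ ω - τ (U ω, V₂ ω)| ≤ e (U ω, V₂ ω)) :
    ∫ ω, T₁ ω * T₂ ω ∂P ≤
      2 * ∫ u, (∫ v, e (u, v) ∂ν) * ((∫ v, e (u, v) ∂ν) + ∫ v, |τ (u, v)| ∂ν) ∂π := by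
  set p : 𝒰 → ℝ := fun u => ∫ v, e (u, v) ∂ν with hp
  set q : 𝒰 → ℝ := fun u => ∫ v, |τ (u, v)| ∂ν with hq
  set t : 𝒰 → ℝ := fun u => ∫ v, τ (u, v) ∂ν with ht
  have hτa : Measurable fun x => |τ x| := by fun_prop
  have hs : Measurable fun x => |τ x| + e x := by fun_prop
  have hτa1 : ∀ x, |(|τ x|)| ≤ 1 := fun x => by rw [abs_abs]; exact hτ1 x
  have hs1 : ∀ x, |(|τ x| + e x)| ≤ 2 := fun x => (abs_add_le _ _).trans (by
    have := hτa1 x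
    have := he1 x
    linarith)
  have hpm : Measurable p := he.stronglyMeasurable.integral_prod_right'.measurable
  have hqm : Measurable q := hτa.stronglyMeasurable.integral_prod_right'.measurable
  have htm : Measurable t := hτ.stronglyMeasurable.integral_prod_right'.measurable
  have hbd : ∀ {f : 𝒰 × 𝒱 → ℝ}, (∀ x, |f x| ≤ 1) → ∀ u, |∫ v, f (u, v) ∂ν| ≤ 1 := by
    intro f hf u
    have := norm_integral_le_of_norm_le_const (μ := ν) (f := fun v => f (u, v)) (C := 1)
      (ae_of_all _ fun v => hf _)
    simpa using this
  have hp1 := hbd he1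
  have hq1 := hbd hτa1
  have ht1 := hbd hτ1
  set G : 𝒰 × (𝒱 × 𝒱) → ℝ := fun x => τ (x.1, x.2.1) * τ (x.1, x.2.2) +
    ((|τ (x.1, x.2.1)| + e (x.1, x.2.1)) * e (x.1, x.2.2) +
      e (x.1, x.2.1) * |τ (x.1, x.2.2)|) with hG
  have hmul : ∀ {f g : 𝒰 × 𝒱 → ℝ}, Measurable f → Measurable g → (∀ x, |f x| ≤ 2) →
      (∀ x, |g x| ≤ 2) → Integrable (fun x : 𝒰 × (𝒱 × 𝒱) => f (x.1, x.2.1) * g (x.1, x.2.2))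
        (π.prod (ν.prod ν)) := by
    intro f g hf hg hf2 hg2
    refine integrable_of_measurable_of_abs_le_const (c := 2 * 2) (by fun_prop) fun x => ?_
    rw [abs_mul]
    exact mul_le_mul (hf2 _) (hg2 _) (abs_nonneg _) (by norm_num)
  have hle2 : ∀ {f : 𝒰 × 𝒱 → ℝ}, (∀ x, |f x| ≤ 1) → ∀ x, |f x| ≤ 2 := fun hf x =>
    (hf x).trans (by norm_num)
  have i1 := hmul hτ hτ (hle2 hτ1) (hle2 hτ1)
  have i2 := hmul hs he hs1 (hle2 he1)
  have i3 := hmul he hτa (hle2 he1) (hle2 hτa1)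
  have i23 : Integrable (fun x : 𝒰 × (𝒱 × 𝒱) =>
      (|τ (x.1, x.2.1)| + e (x.1, x.2.1)) * e (x.1, x.2.2) +
      e (x.1, x.2.1) * |τ (x.1, x.2.2)|) (π.prod (ν.prod ν)) := i2.add i3
  have hGi : Integrable G (π.prod (ν.prod ν)) := i1.add i23
  have hGm : Measurable G := by fun_prop
  have hmono : ∫ ω, T₁ ω * T₂ ω ∂P ≤ ∫ ω, G (U ω, (V₁ ω, V₂ ω)) ∂P := by
    refine integral_mono hT ?_ fun ω => ?_
    · have := hlaw ▸ hGi
      exact this.comp_aemeasurable hm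
    · have a1 := h1 ω
      have a2 := h2 ω
      have key : ∀ a b x y c d : ℝ, |a - x| ≤ c → |b - y| ≤ d →
          a * b ≤ x * y + ((|x| + c) * d + c * |y|) := by
        intro a b x y c d hac hbd
        have e1 : a * b = x * y + (x * (b - y) + (a - x) * (b - y) + (a - x) * y) := by ring
        have e2 : x * (b - y) ≤ |x| * d := (le_abs_self _).trans (by
          rw [abs_mul]; exact mul_le_mul_of_nonneg_left hbd (abs_nonneg _))
        have e3 : (a - x) * (b - y) ≤ c * d := (le_abs_self _).trans (by
          rw [abs_mul]
          exact mul_le_mul hac hbd (abs_nonneg _) ((abs_nonneg _).trans hac))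
        have e4 : (a - x) * y ≤ c * |y| := (le_abs_self _).trans (by
          rw [abs_mul]; exact mul_le_mul_of_nonneg_right hac (abs_nonneg _))
        rw [e1]
        linarith
      exact key _ _ _ _ _ _ a1 a2
  have hGint : ∫ ω, G (U ω, (V₁ ω, V₂ ω)) ∂P =
      ∫ u, (t u * t u + ((q u + p u) * p u + p u * q u)) ∂π := by
    rw [← integral_map (f := G) hm hGm.aestronglyMeasurable, hlaw, hG, integral_add i1 i23,
      integral_add i2 i3]
    rw [integral_prod_prod_mul hτ hτ hτ1 hτ1, integral_prod_prod_mul hs he hs1 (hle2 he1),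
      integral_prod_prod_mul he hτa he1 hτa1]
    have hsq : ∀ u, ∫ v, (|τ (u, v)| + e (u, v)) ∂ν = q u + p u := fun u => by
      rw [integral_add]
      · exact integrable_of_measurable_of_abs_le_const (by fun_prop) fun v => hτa1 (u, v)
      · exact integrable_of_measurable_of_abs_le_const (by fun_prop) fun v => he1 (u, v)
    simp_rw [hsq]
    have j1 : Integrable (fun u => t u * t u) π :=
      integrable_of_measurable_of_abs_le_const (c := 1) (by fun_prop) fun u => by
        rw [abs_mul]; exact mul_le_one₀ (ht1 u) (abs_nonneg _) (ht1 u)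
    have j2 : Integrable (fun u => (q u + p u) * p u) π :=
      integrable_of_measurable_of_abs_le_const (c := 2 * 1) (by fun_prop) fun u => by
        rw [abs_mul]
        exact mul_le_mul ((abs_add_le _ _).trans (by linarith [hq1 u, hp1 u])) (hp1 u)
          (abs_nonneg _) (by norm_num)
    have j3 : Integrable (fun u => p u * q u) π :=
      integrable_of_measurable_of_abs_le_const (c := 1) (by fun_prop) fun u => by
        rw [abs_mul]; exact mul_le_one₀ (hp1 u) (abs_nonneg _) (hq1 u)
    have j23 : Integrable (fun u => (q u + p u) * p u + p u * q u) π := j2.add j3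
    rw [integral_add j1 j23, integral_add j2 j3]
  rw [hGint] at hmono
  refine hmono.trans ?_
  rw [← integral_const_mul]
  refine integral_mono ?_ ?_ fun u => ?_
  · refine integrable_of_measurable_of_abs_le_const (c := 1 + (2 * 1 + 1)) (by fun_prop) fun u => ?_
    refine (abs_add_le _ _).trans (add_le_add ?_ ((abs_add_le _ _).trans (add_le_add ?_ ?_)))
    · rw [abs_mul]; exact mul_le_one₀ (ht1 u) (abs_nonneg _) (ht1 u)
    · rw [abs_mul]
      exact mul_le_mul ((abs_add_le _ _).trans (by linarith [hq1 u, hp1 u])) (hp1 u)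
          (abs_nonneg _) (by norm_num)
    · rw [abs_mul]; exact mul_le_one₀ (hp1 u) (abs_nonneg _) (hq1 u)
  · change Integrable (fun u => 2 * (p u * (p u + q u))) π
    refine integrable_of_measurable_of_abs_le_const (c := 2 * (1 * 2)) (by fun_prop) fun u => ?_
    rw [abs_mul, abs_mul, abs_two]
    refine mul_le_mul_of_nonneg_left ?_ (by norm_num)
    exact mul_le_mul (hp1 u) ((abs_add_le _ _).trans (by linarith [hq1 u, hp1 u]))
      (abs_nonneg _) (by norm_num)
  · have : t u * t u ≤ p u * p u := by
      rw [← abs_mul_abs_self (t u)]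
      exact mul_self_le_mul_self (abs_nonneg _) (hτe u)
    simp only
    nlinarith

theorem integral_abs_le_of_condIndep_approx {U : Ω → 𝒰} {V : Ω → 𝒱}
    (hm : AEMeasurable (fun ω => (U ω, V ω)) P) (hlaw : P.map (fun ω => (U ω, V ω)) = π.prod ν)
    {τ e : 𝒰 × 𝒱 → ℝ} (hτ : Measurable τ) (he : Measurable e) (hτ1 : ∀ x, |τ x| ≤ 1)
    (he1 : ∀ x, |e x| ≤ 1) {T : Ω → ℝ}
    (h1 : ∀ ω, |T ω - τ (U ω, V ω)| ≤ e (U ω, V ω)) :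
    ∫ ω, |T ω| ∂P ≤ ∫ u, ((∫ v, e (u, v) ∂ν) + ∫ v, |τ (u, v)| ∂ν) ∂π := by
  have hei : Integrable e (π.prod ν) := integrable_of_measurable_of_abs_le_const he he1
  have hτi : Integrable (fun x => |τ x|) (π.prod ν) :=
    integrable_of_measurable_of_abs_le_const (by fun_prop) fun x => by rw [abs_abs]; exact hτ1 x
  have hmono : ∫ ω, |T ω| ∂P ≤ ∫ ω, (e (U ω, V ω) + |τ (U ω, V ω)|) ∂P := by
    refine integral_mono_of_nonneg (ae_of_all _ fun ω => abs_nonneg _) ?_ (ae_of_all _ fun ω => ?_)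
    · have := hlaw ▸ (hei.add hτi)
      exact this.comp_aemeasurable hm
    · have := abs_sub_abs_le_abs_sub (T ω) (τ (U ω, V ω))
      have := h1 ω
      simp only
      linarith
  refine hmono.trans (le_of_eq ?_)
  rw [← integral_map (f := fun x => e x + |τ x|) hm (by fun_prop), hlaw, integral_add hei hτi,
    integral_prod _ hei, integral_prod _ hτi, integral_add hei.integral_prod_left
      hτi.integral_prod_left]

end LeaveOut

section Tuples

variable {Ω E κ : Type*} [MeasurableSpace Ω] [MeasurableSpace E] {P : Measure Ω}
  [IsProbabilityMeasure P] {F : Measure E} {W : κ → Ω → E}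

theorem map_prodMk_eq_prod (hW : ∀ k, Measurable (W k)) (hF : ∀ k, P.map (W k) = F)
    (hi : iIndepFun W P) {k l : κ} (h : k ≠ l) :
    P.map (fun ω => (W k ω, W l ω)) = F.prod F := by
  rw [(indepFun_iff_map_prod_eq_prod_map_map (hW k).aemeasurable (hW l).aemeasurable).1
    (hi.indepFun h), hF, hF]

theorem map_prodMk_prodMk_eq_prod (hW : ∀ k, Measurable (W k)) (hF : ∀ k, P.map (W k) = F)
    (hi : iIndepFun W P) {a b c d : κ} (hab : a ≠ b) (hcd : c ≠ d) (hac : a ≠ c) (had : a ≠ d)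
    (hbc : b ≠ c) (hbd : b ≠ d) :
    P.map (fun ω => ((W a ω, W b ω), (W c ω, W d ω))) = (F.prod F).prod (F.prod F) := by
  rw [(indepFun_iff_map_prod_eq_prod_map_map ((hW a).prodMk (hW b)).aemeasurable
    ((hW c).prodMk (hW d)).aemeasurable).1
    (hi.indepFun_prodMk_prodMk hW a b c d hac had hbc hbd), map_prodMk_eq_prod hW hF hi hab,
    map_prodMk_eq_prod hW hF hi hcd]

/-- The law of a block of an i.i.d. family together with two pairs outside the block. -/
theorem map_tuple_prodMk_prodMk_eq_prod (hW : ∀ k, Measurable (W k)) (hF : ∀ k, P.map (W k) = F)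
    (hi : iIndepFun W P) {a b c d : κ} (hab : a ≠ b) (hcd : c ≠ d) (hac : a ≠ c) (had : a ≠ d)
    (hbc : b ≠ c) (hbd : b ≠ d) {ι : Type*} [Fintype ι] {g : ι → κ} (hg : g.Injective)
    (hga : ∀ i, g i ≠ a) (hgb : ∀ i, g i ≠ b) (hgc : ∀ i, g i ≠ c) (hgd : ∀ i, g i ≠ d) :
    P.map (fun ω => ((fun i => W (g i) ω), ((W a ω, W b ω), (W c ω, W d ω)))) =
      (Measure.pi fun _ : ι => F).prod ((F.prod F).prod (F.prod F)) := by
  classical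
  have hind : IndepFun (fun ω i => W (g i) ω) (fun ω => ((W a ω, W b ω), (W c ω, W d ω))) P := by
    set S : Finset κ := Finset.univ.image g
    set T : Finset κ := {a, b, c, d}
    have hST : Disjoint S T := by
      rw [Finset.disjoint_left]
      intro k hk
      obtain ⟨i, -, rfl⟩ := Finset.mem_image.1 hk
      simp [T, hga i, hgb i, hgc i, hgd i]
    have h := hi.indepFun_finset S T hST hW
    exact h.comp
      (φ := fun (u : S → E) (i : ι) => u ⟨g i, Finset.mem_image_of_mem g (Finset.mem_univ i)⟩)
      (ψ := fun u : T → E => ((u ⟨a, by simp [T]⟩, u ⟨b, by simp [T]⟩),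
        (u ⟨c, by simp [T]⟩, u ⟨d, by simp [T]⟩))) (by fun_prop) (by fun_prop)
  rw [(indepFun_iff_map_prod_eq_prod_map_map (by fun_prop) (by fun_prop)).1 hind,
    map_prodMk_prodMk_eq_prod hW hF hi hab hcd hac had hbc hbd]
  congr 1
  have h1 := (iIndepFun_iff_map_fun_eq_pi_map (fun i => (hW (g i)).aemeasurable)).1
    (hi.precomp hg)
  simp only [h1, hF]

end Tuples

section SumComplement

theorem abs_inv_mul_sum_sub_le {n : ℕ} (hn : 3 ≤ n) {f : ℕ → ℝ} (hf0 : ∀ k, 0 ≤ f k)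
    (hf1 : ∀ k, f k ≤ 1) {i i' : ℕ} (hi : i < n) (hi' : i' < n) (h : i ≠ i') :
    |(n : ℝ)⁻¹ * ∑ k ∈ Finset.range n, f k -
      ((n - 2 : ℕ) : ℝ)⁻¹ * ∑ k ∈ ((Finset.range n).erase i).erase i', f k| ≤
        2 / ((n - 2 : ℕ) : ℝ) := by
  obtain ⟨N, rfl⟩ : ∃ N, n = N + 2 := ⟨n - 2, by omega⟩
  have hN : (1 : ℝ) ≤ N := by exact_mod_cast (by omega : 1 ≤ N)
  have hi'm : i' ∈ (Finset.range (N + 2)).erase i := by simp [hi', h.symm]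
  have him : i ∈ Finset.range (N + 2) := by simp [hi]
  have hcard : (((Finset.range (N + 2)).erase i).erase i').card = N := by
    rw [Finset.card_erase_of_mem hi'm, Finset.card_erase_of_mem him, Finset.card_range]
    omega
  rw [← Finset.add_sum_erase _ _ him, ← Finset.add_sum_erase _ _ hi'm, Nat.add_sub_cancel]
  set A := ∑ k ∈ ((Finset.range (N + 2)).erase i).erase i', f k with hA
  have hA0 : 0 ≤ A := Finset.sum_nonneg fun k _ => hf0 k
  have hA1 : A ≤ N := by
    calc A ≤ ∑ k ∈ ((Finset.range (N + 2)).erase i).erase i', (1 : ℝ) :=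
          Finset.sum_le_sum fun k _ => hf1 k
      _ = N := by simp [hcard]
  have e : ((N + 2 : ℕ) : ℝ)⁻¹ * (f i + (f i' + A)) - (N : ℝ)⁻¹ * A =
      (f i + f i' - 2 * (A / N)) / (N + 2) := by
    push_cast
    field_simp
    ring
  have hAN : A / N ≤ 1 := (div_le_one (by linarith)).2 hA1
  have hAN0 : 0 ≤ A / N := by positivity
  rw [e, abs_div, abs_of_pos (by linarith : (0 : ℝ) < N + 2)]
  refine div_le_div₀ (by norm_num) ?_ (by linarith) (by linarith)
  rw [abs_le]
  constructor <;> linarith [hf0 i, hf0 i', hf1 i, hf1 i']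

end SumComplement

/-- The numerical truth value of `a ≤ b`. -/
noncomputable def leIndicator (a b : ℝ) : ℝ := if a ≤ b then 1 else 0

section leIndicator

theorem leIndicator_nonneg (a b : ℝ) : 0 ≤ leIndicator a b := by
  rw [leIndicator]; split_ifs <;> norm_num

theorem leIndicator_le_one (a b : ℝ) : leIndicator a b ≤ 1 := by
  rw [leIndicator]; split_ifs <;> norm_num

theorem abs_leIndicator_le_one (a b : ℝ) : |leIndicator a b| ≤ 1 :=
  abs_le.2 ⟨by linarith [leIndicator_nonneg a b], leIndicator_le_one a b⟩

theorem abs_leIndicator_sub_le_one (a b c d : ℝ) : |leIndicator a b - leIndicator c d| ≤ 1 :=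
  abs_le.2 ⟨by linarith [leIndicator_nonneg a b, leIndicator_le_one c d],
    by linarith [leIndicator_nonneg c d, leIndicator_le_one a b]⟩

theorem abs_leIndicator_sub_eq (a b c d : ℝ) :
    |leIndicator a b - leIndicator c d| = if (a ≤ b ↔ c ≤ d) then 0 else 1 := by
  simp only [leIndicator]
  by_cases h1 : a ≤ b <;> by_cases h2 : c ≤ d <;> simp [h1, h2]

theorem leIndicator_add_leIndicator_swap (a b : ℝ) :
    leIndicator a b + leIndicator b a = 1 + if a = b then 1 else 0 := by
  simp only [leIndicator]
  rcases lt_trichotomy a b with h | h | h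
  · simp [h.le, not_le.2 h, h.ne]
  · simp [h]
  · simp [h.le, not_le.2 h, h.ne']

theorem abs_leIndicator_sub_le_of_abs_sub_le {a b c d ε : ℝ} (h1 : |a - c| ≤ ε) (h2 : |b - d| ≤ ε) :
    |leIndicator a b - leIndicator c d| ≤ if |c - d| ≤ 2 * ε then 1 else 0 := by
  split_ifs with h
  · exact abs_leIndicator_sub_le_one _ _ _ _
  · rw [abs_leIndicator_sub_eq, if_pos]
    rw [abs_le] at h1 h2
    rw [not_le, lt_abs] at h
    constructor
    · intro hab
      rcases h with h | h <;> linarith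
    · intro hcd
      rcases h with h | h <;> linarith

theorem Measurable.leIndicator {α : Type*} [MeasurableSpace α] {f g : α → ℝ} (hf : Measurable f)
    (hg : Measurable g) : Measurable fun x => leIndicator (f x) (g x) :=
  Measurable.ite (measurableSet_le hf hg) measurable_const measurable_const

variable {α : Type*} [MeasurableSpace α] {F : Measure α} {D D' : α → ℝ}

theorem integral_ite_one_zero {μ : Measure α} {p : α → Prop} [DecidablePred p]
    (hp : MeasurableSet {x | p x}) : ∫ x, (if p x then (1 : ℝ) else 0) ∂μ = μ.real {x | p x} := by
  rw [← integral_indicator_one hp]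
  refine integral_congr_ae (ae_of_all _ fun x => ?_)
  by_cases h : p x <;> simp [Set.indicator, h]

theorem integrable_leIndicator {μ : Measure α} [IsFiniteMeasure μ] (hD : Measurable D)
    (hD' : Measurable D') : Integrable (fun x => leIndicator (D x) (D' x)) μ :=
  Integrable.of_bound (hD.leIndicator hD').aestronglyMeasurable 1
    (ae_of_all _ fun _ => abs_leIndicator_le_one _ _)

theorem integral_abs_leIndicator_sub (hD : Measurable D) (hD' : Measurable D') :
    ∫ p, |leIndicator (D p.1) (D p.2) - leIndicator (D' p.1) (D' p.2)| ∂F.prod F =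
      discordProb F D D' := by
  classical
  have hm : MeasurableSet {p : α × α | ¬ (D p.1 ≤ D p.2 ↔ D' p.1 ≤ D' p.2)} := by
    have h1 : MeasurableSet {p : α × α | D p.1 ≤ D p.2} :=
      measurableSet_le (by fun_prop) (by fun_prop)
    have h2 : MeasurableSet {p : α × α | D' p.1 ≤ D' p.2} :=
      measurableSet_le (by fun_prop) (by fun_prop)
    exact (MeasurableSet.iff h1 h2).compl
  rw [discordProb, ← integral_ite_one_zero hm]
  refine integral_congr_ae (ae_of_all _ fun p => ?_)
  simp only [abs_leIndicator_sub_eq, ite_not]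

theorem integral_ite_abs_sub_le (hD : Measurable D) (a : ℝ) :
    ∫ p, (if |D p.1 - D p.2| ≤ a then (1 : ℝ) else 0) ∂F.prod F = closeProb F D a := by
  rw [closeProb, integral_ite_one_zero]
  exact measurableSet_le (by fun_prop) measurable_const

variable [IsProbabilityMeasure F]

theorem two_mul_integral_leIndicator (hD : Measurable D) :
    2 * ∫ p, leIndicator (D p.1) (D p.2) ∂F.prod F =
      1 + (F.prod F).real {p | D p.1 = D p.2} := by
  have hm1 : Measurable fun p : α × α => D p.1 := by fun_prop
  have hm2 : Measurable fun p : α × α => D p.2 := by fun_prop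
  have hs : ∫ p, leIndicator (D p.2) (D p.1) ∂F.prod F =
      ∫ p, leIndicator (D p.1) (D p.2) ∂F.prod F :=
    integral_prod_swap (μ := F) (ν := F) fun p : α × α => leIndicator (D p.1) (D p.2)
  rw [two_mul]
  nth_rewrite 2 [← hs]
  rw [← integral_add (integrable_leIndicator hm1 hm2) (integrable_leIndicator hm2 hm1)]
  simp_rw [leIndicator_add_leIndicator_swap]
  have hset : MeasurableSet {p : α × α | D p.1 = D p.2} := measurableSet_eq_fun hm1 hm2
  rw [integral_add (integrable_const _) (Integrable.of_bound
    (Measurable.ite hset measurable_const measurable_const).aestronglyMeasurable 1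
    (ae_of_all _ fun p => by split_ifs <;> simp)), integral_ite_one_zero hset]
  simp

theorem measureReal_prod_eq_zero_of_noAtoms (hD : Measurable D)
    (h0 : ∀ t, F.real {z | D z = t} = 0) : (F.prod F).real {p | D p.1 = D p.2} = 0 := by
  rw [measureReal_prod_eq_integral F F (measurableSet_eq_fun (by fun_prop) (by fun_prop))]
  refine integral_eq_zero_of_ae (ae_of_all _ fun x => ?_)
  simpa [eq_comm] using h0 (D x)

theorem integral_leIndicator_of_noAtoms (hD : Measurable D)
    (h0 : ∀ t, F.real {z | D z = t} = 0) :
    ∫ p, leIndicator (D p.1) (D p.2) ∂F.prod F = 1 / 2 := by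
  have := two_mul_integral_leIndicator (F := F) hD
  rw [measureReal_prod_eq_zero_of_noAtoms hD h0] at this
  linarith

theorem abs_integral_leIndicator_sub_le_closeProb (hD : Measurable D) (hD' : Measurable D')
    (h0 : ∀ t, F.real {z | D' z = t} = 0) {a : ℝ} (ha : 0 ≤ a) :
    |∫ p, (leIndicator (D p.1) (D p.2) - leIndicator (D' p.1) (D' p.2)) ∂F.prod F| ≤
      closeProb F D a := by
  rw [integral_sub (integrable_leIndicator (by fun_prop) (by fun_prop))
    (integrable_leIndicator (by fun_prop) (by fun_prop)), integral_leIndicator_of_noAtoms hD' h0]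
  have h1 := two_mul_integral_leIndicator (F := F) hD
  have h2 : (F.prod F).real {p | D p.1 = D p.2} ≤ closeProb F D a := by
    refine measureReal_mono fun p hp => ?_
    change D p.1 = D p.2 at hp
    change |D p.1 - D p.2| ≤ a
    rw [hp, sub_self, abs_zero]
    exact ha
  have h3 : 0 ≤ (F.prod F).real {p | D p.1 = D p.2} := measureReal_nonneg
  rw [abs_of_nonneg (by linarith)]
  linarith

end leIndicator

section LeaveTwoOut

theorem continuous_sphereInf_potential_finiteEmpirical {ι E : Type*} [Fintype ι]
    [NormedAddCommGroup E] [InnerProductSpace ℝ E] [FiniteDimensional ℝ E] [MeasurableSpace E]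
    [BorelSpace E] {h : E → ℝ} (hc : Continuous h) (r : ℝ) :
    Continuous fun p : (ι → E) × E => sphereInf r (potential h (finiteEmpirical p.1)) p.2 := by
  refine continuous_sphereInf (G := fun (u : ι → E) => potential h (finiteEmpirical u)) ?_
  simp only [potential, integral_finiteEmpirical]
  fun_prop

end LeaveTwoOut

section LeaveTwoOut

variable {E : Type*} [NormedAddCommGroup E] [InnerProductSpace ℝ E] [FiniteDimensional ℝ E]
  [MeasurableSpace E] [BorelSpace E] {h : E → ℝ} {r : ℝ}

theorem continuous_potential_finiteEmpirical {ι : Type*} [Fintype ι] (hc : Continuous h)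
    (x : ι → E) : Continuous (potential h (finiteEmpirical x)) := by
  change Continuous fun c => potential h (finiteEmpirical x) c
  simp only [potential, integral_finiteEmpirical]
  fun_prop

theorem abs_sphereInf_potential_sub_erase_le (hc : Continuous h) (h0 : ∀ v, 0 ≤ h v)
    (h1 : ∀ v, h v ≤ 1) {n : ℕ} (hn : 3 ≤ n) (x : ℕ → E) {i i' : ℕ} (hi : i < n) (hi' : i' < n)
    (hii : i ≠ i') (z : E) :
    |sphereInf r (potential h (finiteEmpirical fun k : Fin n => x k)) z -
      sphereInf r (potential h (finiteEmpirical
        fun k : ((Finset.range n).erase i).erase i' => x k)) z| ≤ 2 / ((n - 2 : ℕ) : ℝ) := by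
  have hcard : (((Finset.range n).erase i).erase i').card = n - 2 := by
    rw [Finset.card_erase_of_mem (by simp [hi', hii.symm]), Finset.card_erase_of_mem (by simp [hi]),
      Finset.card_range]
    omega
  refine abs_sphereInf_sub_le (continuous_potential_finiteEmpirical hc _)
    (continuous_potential_finiteEmpirical hc _) (by positivity) fun c _ => ?_
  · simp only [potential, integral_finiteEmpirical, smul_eq_mul, Fintype.card_fin,
      Fintype.card_coe, hcard]
    have e1 := Finset.sum_range (n := n) fun k => h (x k - c)
    have e2 := Finset.sum_coe_sort (((Finset.range n).erase i).erase i') fun k => h (x k - c)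
    rw [← e1, e2]
    exact abs_inv_mul_sum_sub_le hn (fun k => h0 _) (fun k => h1 _) hi hi' hii

/-- The difference of the comparisons of two points by `D` and by `D'`. -/
noncomputable def orderGap {α : Type*} (D D' : α → ℝ) (x y : α) : ℝ :=
  leIndicator (D x) (D y) - leIndicator (D' x) (D' y)

theorem abs_orderGap_le_one {α : Type*} (D D' : α → ℝ) (x y : α) : |orderGap D D' x y| ≤ 1 :=
  abs_leIndicator_sub_le_one _ _ _ _

theorem abs_orderGap_sub_orderGap_le {α : Type*} {D D₁ D₂ : α → ℝ} {ε : ℝ}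
    (h : ∀ z, |D₁ z - D₂ z| ≤ ε) (x y : α) :
    |orderGap D₁ D x y - orderGap D₂ D x y| ≤ if |D₂ x - D₂ y| ≤ 2 * ε then 1 else 0 := by
  rw [orderGap, orderGap, sub_sub_sub_cancel_right]
  exact abs_leIndicator_sub_le_of_abs_sub_le (h x) (h y)

section Abstract

variable {𝒰 α Ω : Type*} [MeasurableSpace 𝒰] [MeasurableSpace α] [MeasurableSpace Ω]
  {P : Measure Ω} {F : Measure α} [IsProbabilityMeasure F] {π : Measure 𝒰}
  [IsProbabilityMeasure π] {Φ : 𝒰 × α → ℝ} {D : α → ℝ}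

theorem measurable_orderGap (hΦ : Measurable Φ) (hD : Measurable D) :
    Measurable fun p : 𝒰 × (α × α) => orderGap (fun z => Φ (p.1, z)) D p.2.1 p.2.2 :=
  (Measurable.leIndicator (f := fun p : 𝒰 × (α × α) => Φ (p.1, p.2.1))
    (g := fun p : 𝒰 × (α × α) => Φ (p.1, p.2.2)) (by fun_prop) (by fun_prop)).sub
  (Measurable.leIndicator (f := fun p : 𝒰 × (α × α) => D p.2.1)
    (g := fun p : 𝒰 × (α × α) => D p.2.2) (by fun_prop) (by fun_prop))

theorem measurable_ite_abs_sub_le (hΦ : Measurable Φ) (a : ℝ) :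
    Measurable fun p : 𝒰 × (α × α) =>
      if |Φ (p.1, p.2.1) - Φ (p.1, p.2.2)| ≤ a then (1 : ℝ) else 0 :=
  Measurable.ite (measurableSet_le (by fun_prop) measurable_const) measurable_const measurable_const

theorem integral_orderGap_mul_orderGap_le (hΦ : Measurable Φ) (hD : Measurable D)
    (hD0 : ∀ t, F.real {z | D z = t} = 0) {Dn : Ω → α → ℝ} {U : Ω → 𝒰} {ε : ℝ} (hε : 0 ≤ ε)
    (hclose : ∀ ω z, |Dn ω z - Φ (U ω, z)| ≤ ε) {V₁ V₂ : Ω → α × α}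
    (hm : AEMeasurable (fun ω => (U ω, (V₁ ω, V₂ ω))) P)
    (hlaw : P.map (fun ω => (U ω, (V₁ ω, V₂ ω))) = π.prod ((F.prod F).prod (F.prod F)))
    (hT : Integrable (fun ω => orderGap (Dn ω) D (V₁ ω).1 (V₁ ω).2 *
      orderGap (Dn ω) D (V₂ ω).1 (V₂ ω).2) P) :
    ∫ ω, orderGap (Dn ω) D (V₁ ω).1 (V₁ ω).2 * orderGap (Dn ω) D (V₂ ω).1 (V₂ ω).2 ∂P ≤
      2 * ∫ u, closeProb F (fun z => Φ (u, z)) (2 * ε) * (closeProb F (fun z => Φ (u, z)) (2 * ε) +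
        discordProb F (fun z => Φ (u, z)) D) ∂π := by
  have hΦu : ∀ u, Measurable fun z => Φ (u, z) := fun u => by fun_prop
  have := integral_mul_le_of_condIndep_approx hm hlaw (measurable_orderGap hΦ hD)
    (measurable_ite_abs_sub_le hΦ (2 * ε)) (fun x => abs_orderGap_le_one _ _ _ _)
    (fun x => by split_ifs <;> simp)
    (fun u => by
      rw [integral_ite_abs_sub_le (hΦu u)]
      exact abs_integral_leIndicator_sub_le_closeProb (hΦu u) hD hD0 (by positivity)) hT
    (fun ω => abs_orderGap_sub_orderGap_le (hclose ω) _ _)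
    (fun ω => abs_orderGap_sub_orderGap_le (hclose ω) _ _)
  refine this.trans_eq ?_
  congr 2
  funext u
  rw [integral_ite_abs_sub_le (hΦu u), ← integral_abs_leIndicator_sub (hΦu u) hD]
  rfl

theorem integral_abs_orderGap_le (hΦ : Measurable Φ) (hD : Measurable D)
    {Dn : Ω → α → ℝ} {U : Ω → 𝒰} {ε : ℝ}
    (hclose : ∀ ω z, |Dn ω z - Φ (U ω, z)| ≤ ε) {V : Ω → α × α}
    (hm : AEMeasurable (fun ω => (U ω, V ω)) P)
    (hlaw : P.map (fun ω => (U ω, V ω)) = π.prod (F.prod F)) :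
    ∫ ω, |orderGap (Dn ω) D (V ω).1 (V ω).2| ∂P ≤
      ∫ u, (closeProb F (fun z => Φ (u, z)) (2 * ε) + discordProb F (fun z => Φ (u, z)) D) ∂π := by
  have hΦu : ∀ u, Measurable fun z => Φ (u, z) := fun u => by fun_prop
  have := integral_abs_le_of_condIndep_approx hm hlaw (measurable_orderGap hΦ hD)
    (measurable_ite_abs_sub_le hΦ (2 * ε)) (fun x => abs_orderGap_le_one _ _ _ _)
    (fun x => by split_ifs <;> simp)
    (fun ω => abs_orderGap_sub_orderGap_le (hclose ω) _ _)
  refine this.trans_eq ?_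
  congr 1
  funext u
  rw [integral_ite_abs_sub_le (hΦu u), ← integral_abs_leIndicator_sub (hΦu u) hD]
  rfl

end Abstract

variable {Ω : Type*} [MeasurableSpace Ω] {P : Measure Ω} [IsProbabilityMeasure P]
  {F : Measure E} [IsProbabilityMeasure F] {C R : ℝ}

theorem measurable_orderGap_empirical (hc : Continuous h) {D : E → ℝ} (hD : Measurable D)
    {X Y : ℕ → Ω → E} (hX : ∀ i, Measurable (X i)) (hY : ∀ j, Measurable (Y j)) (n i j : ℕ) :
    Measurable fun ω => orderGap (sphereInf r (potential h
      (finiteEmpirical fun k : Fin n => X k ω))) D (X i ω) (Y j ω) := by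
  have h1 := measurable_orderGap (𝒰 := Fin n → E)
    (Φ := fun p => sphereInf r (potential h (finiteEmpirical p.1)) p.2)
    (continuous_sphereInf_potential_finiteEmpirical (ι := Fin n) hc r).measurable hD
  have h2 : Measurable fun ω => ((fun k : Fin n => X k ω), (X i ω, Y j ω)) := by fun_prop
  have h3 := h1.comp h2
  exact h3

/-- Errors of the comparisons by the empirical depth are small, and almost uncorrelated for
disjoint pairs of sample points. -/
theorem exists_forall_integral_orderGap_mul_le (hh : ContDiff ℝ (⊤ : ℕ∞) h) (h0 : ∀ v, 0 ≤ h v)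
    (h1 : ∀ v, h v ≤ 1) (hR : ∀ᵐ z ∂F, ‖z‖ ≤ R)
    (hA : ∀ a b, a ≤ b → F.real {z | sphereInf r (potential h F) z ∈ Set.Icc a b} ≤ C * (b - a))
    (hC : 0 < C) {X Y : ℕ → Ω → E} (hX : ∀ i, Measurable (X i)) (hY : ∀ j, Measurable (Y j))
    (hXF : ∀ i, P.map (X i) = F) (hYF : ∀ j, P.map (Y j) = F) (hi : iIndepFun (Sum.elim X Y) P)
    {η : ℝ} (hη : 0 < η) :
    ∃ n₀ : ℕ, ∀ n, n₀ ≤ n →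
      (∀ i i' j j', i < n → i' < n → i ≠ i' → j ≠ j' →
        ∫ ω, orderGap (sphereInf r (potential h (finiteEmpirical fun k : Fin n => X k ω)))
            (sphereInf r (potential h F)) (X i ω) (Y j ω) *
          orderGap (sphereInf r (potential h (finiteEmpirical fun k : Fin n => X k ω)))
            (sphereInf r (potential h F)) (X i' ω) (Y j' ω) ∂P ≤ η / n) ∧
      (∀ i j, i < n →
        ∫ ω, |orderGap (sphereInf r (potential h (finiteEmpirical fun k : Fin n => X k ω)))
            (sphereInf r (potential h F)) (X i ω) (Y j ω)| ∂P ≤ η) := by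
  have hc : Continuous h := hh.continuous
  have habs : ∀ v, |h v| ≤ 1 := fun v => abs_le.2 ⟨by linarith [h0 v], h1 v⟩
  obtain ⟨N₀, hN₀⟩ := exists_forall_integral_closeProb_discordProb_le (r := r) hh habs hR hA hC
    (by positivity : 0 < η / 6)
  set D := sphereInf r (potential h F) with hD
  have hDm : Measurable D :=
    (continuous_sphereInf_right (continuous_potential hc habs F)).measurable
  have hD0 : ∀ t, F.real {z | D z = t} = 0 := measureReal_eq_singleton_zero hA
  refine ⟨max 3 (N₀ + 2), fun n hn => ?_⟩
  have hn3 : 3 ≤ n := (le_max_left _ _).trans hn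
  have hnN : N₀ + 2 ≤ n := (le_max_right _ _).trans hn
  have hWm : ∀ k, Measurable (Sum.elim X Y k) := fun k => by cases k <;> simp [hX, hY]
  have hWF : ∀ k, P.map (Sum.elim X Y k) = F := fun k => by cases k <;> simp [hXF, hYF]
  have key : ∀ i i', i < n → i' < n → i ≠ i' → ∀ j j', j ≠ j' →
      ∃ p q : ((((Finset.range n).erase i).erase i' : Finset ℕ) → E) → ℝ,
        (∫ u, p u * (p u + q u) ∂Measure.pi (fun _ => F)) ≤ η / 6 / ((n - 2 : ℕ) : ℝ) ∧
        (∫ u, (p u + q u) ∂Measure.pi (fun _ => F)) ≤ η / 6 ∧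
        ∫ ω, orderGap (sphereInf r (potential h (finiteEmpirical fun k : Fin n => X k ω)))
              D (X i ω) (Y j ω) *
            orderGap (sphereInf r (potential h (finiteEmpirical fun k : Fin n => X k ω)))
              D (X i' ω) (Y j' ω) ∂P ≤
          2 * ∫ u, p u * (p u + q u) ∂Measure.pi (fun _ => F) ∧
        ∫ ω, |orderGap (sphereInf r (potential h (finiteEmpirical fun k : Fin n => X k ω)))
            D (X i ω) (Y j ω)| ∂P ≤ ∫ u, (p u + q u) ∂Measure.pi (fun _ => F) := by
    intro i i' hin hin' hii j j' hjj
    set S := ((Finset.range n).erase i).erase i' with hS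
    have hcard : Fintype.card S = n - 2 := by
      rw [Fintype.card_coe, hS, Finset.card_erase_of_mem (by simp [hin', hii.symm]),
        Finset.card_erase_of_mem (by simp [hin]), Finset.card_range]
      omega
    have : Nonempty S := Fintype.card_pos_iff.1 (by omega)
    have hΦ := (continuous_sphereInf_potential_finiteEmpirical (ι := S) hc r).measurable
    have hlaw := map_tuple_prodMk_prodMk_eq_prod (P := P) (W := Sum.elim X Y) hWm hWF hi
      (a := Sum.inl i) (b := Sum.inr j) (c := Sum.inl i') (d := Sum.inr j') (by simp) (by simp)
      (by simpa using hii) (by simp) (by simp) (by simpa using hjj)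
      (g := fun k : S => Sum.inl (k : ℕ)) (fun k l hkl => Subtype.ext (Sum.inl_injective hkl))
      (fun k => by
        have := k.2
        simp only [hS, Finset.mem_erase] at this
        simpa using this.2.1) (by simp)
      (fun k => by
        have := k.2
        simp only [hS, Finset.mem_erase] at this
        simpa using this.1) (by simp)
    simp only [Sum.elim_inl, Sum.elim_inr] at hlaw
    set U : Ω → S → E := fun ω k => X k ω with hU
    have hUm : Measurable U := by fun_prop
    have hclose : ∀ ω z, |sphereInf r (potential h (finiteEmpirical fun k : Fin n => X k ω)) z -
        sphereInf r (potential h (finiteEmpirical (U ω))) z| ≤ 2 / ((n - 2 : ℕ) : ℝ) := fun ω z =>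
      abs_sphereInf_potential_sub_erase_le hc h0 h1 hn3 (fun k => X k ω) hin hin' hii z
    have hgm : ∀ i j, Measurable fun ω => orderGap (sphereInf r (potential h
        (finiteEmpirical fun k : Fin n => X k ω))) D (X i ω) (Y j ω) :=
      measurable_orderGap_empirical hc hDm hX hY n
    have ha : 2 * (2 / ((n - 2 : ℕ) : ℝ)) = 4 / Fintype.card S := by rw [hcard]; ring
    obtain ⟨hb1, hb2⟩ := hN₀ S (by omega)
    refine ⟨fun u => closeProb F (sphereInf r (potential h (finiteEmpirical u)))
        (4 / Fintype.card S),
      fun u => discordProb F (sphereInf r (potential h (finiteEmpirical u))) D, ?_, hb2, ?_, ?_⟩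
    · rw [← hcard]
      exact hb1
    · rw [← ha]
      have hint := integral_orderGap_mul_orderGap_le (Φ := fun p : (S → E) × E =>
        sphereInf r (potential h (finiteEmpirical p.1)) p.2) hΦ hDm hD0 (by positivity) hclose
        (by fun_prop) hlaw
        (integrable_of_measurable_of_abs_le_const (c := 1) ((hgm i j).mul (hgm i' j')) fun ω => by
          rw [abs_mul]
          exact mul_le_one₀ (abs_orderGap_le_one _ _ _ _) (abs_nonneg _)
            (abs_orderGap_le_one _ _ _ _))
      exact hint
    · have hlaw' : P.map (fun ω => (U ω, (X i ω, Y j ω))) =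
          (Measure.pi fun _ : S => F).prod (F.prod F) := by
        have hmp := (MeasurePreserving.id (Measure.pi fun _ : S => F)).prod
          (measurePreserving_fst (μ := F.prod F) (ν := F.prod F))
        rw [← hmp.map_eq, ← hlaw, Measure.map_map hmp.measurable (by fun_prop)]
        rfl
      rw [← ha]
      have hint := integral_abs_orderGap_le (Φ := fun p : (S → E) × E =>
        sphereInf r (potential h (finiteEmpirical p.1)) p.2) hΦ hDm hclose (by fun_prop) hlaw'
      exact hint
  have hn2 : (n : ℝ) / 3 ≤ ((n - 2 : ℕ) : ℝ) := by
    rw [Nat.cast_sub (by omega)]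
    have : (3 : ℝ) ≤ n := by exact_mod_cast hn3
    push_cast
    linarith
  have hn0 : (0 : ℝ) < n := by exact_mod_cast (by omega : 0 < n)
  constructor
  · intro i i' j j' hin hin' hii hjj
    obtain ⟨p, q, hb1, -, hb3, -⟩ := key i i' hin hin' hii j j' hjj
    refine hb3.trans ?_
    calc 2 * ∫ u, p u * (p u + q u) ∂Measure.pi (fun _ => F)
        ≤ 2 * (η / 6 / ((n - 2 : ℕ) : ℝ)) := by linarith
      _ ≤ 2 * (η / 6 / ((n : ℝ) / 3)) := by gcongr
      _ = η / n := by
        field_simp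
        norm_num
  · intro i j hin
    obtain ⟨i', hin', hii⟩ : ∃ i', i' < n ∧ i ≠ i' := by
      rcases Nat.eq_zero_or_pos i with h | h
      · exact ⟨1, by omega, by omega⟩
      · exact ⟨0, by omega, by omega⟩
    obtain ⟨p, q, -, hb2, -, hb4⟩ := key i i' hin hin' hii j (j + 1) (by omega)
    linarith

end LeaveTwoOut

section SecondMoment

variable {Ω ι : Type*} [MeasurableSpace Ω] {P : Measure Ω}

theorem integral_sq_sum_le_of_integral_mul_le {A : Finset ι} {T : ι → Ω → ℝ} {g : ι → ι → ℝ}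
    (hT : ∀ a b, Integrable (fun ω => T a ω * T b ω) P)
    (hg : ∀ a ∈ A, ∀ b ∈ A, ∫ ω, T a ω * T b ω ∂P ≤ g a b) :
    ∫ ω, (∑ a ∈ A, T a ω) ^ 2 ∂P ≤ ∑ a ∈ A, ∑ b ∈ A, g a b := by
  simp_rw [sq, Finset.sum_mul_sum]
  rw [integral_finsetSum _ fun a _ => integrable_finsetSum _ fun b _ => hT a b]
  refine Finset.sum_le_sum fun a ha => ?_
  rw [integral_finsetSum _ fun b _ => hT a b]
  exact Finset.sum_le_sum fun b hb => hg a ha b hb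

theorem sum_product_sum_product_ite_fst (n m : ℕ) :
    ∑ a ∈ Finset.range n ×ˢ Finset.range m, ∑ b ∈ Finset.range n ×ˢ Finset.range m,
      (if a.1 = b.1 then (1 : ℝ) else 0) = n * m ^ 2 := by
  have h : ∀ a ∈ Finset.range n ×ˢ Finset.range m, ∑ b ∈ Finset.range n ×ˢ Finset.range m,
      (if a.1 = b.1 then (1 : ℝ) else 0) = m := fun a ha => by
    have h1 : a.1 < n := by simpa using (Finset.mem_product.1 ha).1
    rw [Finset.sum_product]
    change ∑ x ∈ Finset.range n, ∑ _y ∈ Finset.range m, (if a.1 = x then (1 : ℝ) else 0) = m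
    simp_rw [Finset.sum_const]
    rw [← Finset.smul_sum, Finset.sum_ite_eq, if_pos (by simpa using h1)]
    simp
  rw [Finset.sum_congr rfl h]
  simp
  ring

theorem sum_product_sum_product_ite_snd (n m : ℕ) :
    ∑ a ∈ Finset.range n ×ˢ Finset.range m, ∑ b ∈ Finset.range n ×ˢ Finset.range m,
      (if a.2 = b.2 then (1 : ℝ) else 0) = n ^ 2 * m := by
  have h : ∀ a ∈ Finset.range n ×ˢ Finset.range m, ∑ b ∈ Finset.range n ×ˢ Finset.range m,
      (if a.2 = b.2 then (1 : ℝ) else 0) = n := fun a ha => by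
    have h1 : a.2 < m := by simpa using (Finset.mem_product.1 ha).2
    rw [Finset.sum_product_right]
    change ∑ y ∈ Finset.range m, ∑ _x ∈ Finset.range n, (if a.2 = y then (1 : ℝ) else 0) = n
    simp_rw [Finset.sum_const]
    rw [← Finset.smul_sum, Finset.sum_ite_eq, if_pos (by simpa using h1)]
    simp
  rw [Finset.sum_congr rfl h]
  simp
  ring

theorem integral_sq_average_le_of_disjoint {T : ℕ × ℕ → Ω → ℝ} {α β : ℝ} (hα : 0 ≤ α) (hβ : 0 ≤ β)
    {n m : ℕ} (hn : 0 < n) (hm : 0 < m) (hT : ∀ a b, Integrable (fun ω => T a ω * T b ω) P)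
    (h1 : ∀ a b, a.1 < n → b.1 < n → a.1 ≠ b.1 → a.2 ≠ b.2 → ∫ ω, T a ω * T b ω ∂P ≤ α)
    (h2 : ∀ a b, a.1 < n → ∫ ω, T a ω * T b ω ∂P ≤ β) :
    ∫ ω, ((n * m : ℝ)⁻¹ * ∑ a ∈ Finset.range n ×ˢ Finset.range m, T a ω) ^ 2 ∂P ≤
      α + β * (1 / n + 1 / m) := by
  have h := integral_sq_sum_le_of_integral_mul_le (A := Finset.range n ×ˢ Finset.range m)
    (g := fun a b => α + (β * (if a.1 = b.1 then (1 : ℝ) else 0) +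
      β * (if a.2 = b.2 then (1 : ℝ) else 0))) hT (by
    intro a ha b hb
    simp only [Finset.mem_product, Finset.mem_range] at ha hb
    by_cases h : a.1 = b.1
    · refine (h2 a b ha.1).trans ?_
      rw [if_pos h]
      split_ifs <;> linarith
    · by_cases h' : a.2 = b.2
      · refine (h2 a b ha.1).trans ?_
        rw [if_pos h', if_neg h]
        linarith
      · refine (h1 a b ha.1 hb.1 h h').trans ?_
        rw [if_neg h', if_neg h]
        linarith)
  simp only [Finset.sum_add_distrib, ← Finset.mul_sum, sum_product_sum_product_ite_fst,
    sum_product_sum_product_ite_snd, Finset.sum_const, Finset.card_product, Finset.card_range,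
    nsmul_eq_mul] at h
  simp_rw [mul_pow]
  rw [integral_const_mul]
  have hn' : (0 : ℝ) < n := by exact_mod_cast hn
  have hm' : (0 : ℝ) < m := by exact_mod_cast hm
  refine (mul_le_mul_of_nonneg_left h (by positivity)).trans_eq ?_
  push_cast
  field_simp

theorem integral_sq_average_le_of_orthogonal {T : ℕ × ℕ → Ω → ℝ} {β : ℝ} (n m : ℕ)
    (hT : ∀ a b, Integrable (fun ω => T a ω * T b ω) P)
    (h1 : ∀ a b, a ≠ b → ∫ ω, T a ω * T b ω ∂P = 0) (h2 : ∀ a, ∫ ω, T a ω * T a ω ∂P ≤ β) :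
    ∫ ω, ((n * m : ℝ)⁻¹ * ∑ a ∈ Finset.range n ×ˢ Finset.range m, T a ω) ^ 2 ∂P ≤
      β / (n * m) := by
  have h := integral_sq_sum_le_of_integral_mul_le (A := Finset.range n ×ˢ Finset.range m)
    (g := fun a b => if a = b then β else 0) hT (by
    intro a ha b hb
    split_ifs with h
    · exact h ▸ h2 a
    · exact (h1 a b h).le)
  have e : ∑ a ∈ Finset.range n ×ˢ Finset.range m, ∑ b ∈ Finset.range n ×ˢ Finset.range m,
      (if a = b then β else 0) = (n * m) * β := by
    simp only [Finset.sum_ite_eq]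
    rw [Finset.sum_congr rfl fun i hi => if_pos hi]
    simp
  rw [e] at h
  simp_rw [mul_pow]
  rw [integral_const_mul]
  refine (mul_le_mul_of_nonneg_left h (by positivity)).trans_eq ?_
  rcases eq_or_ne ((n : ℝ) * m) 0 with h0 | h0
  · simp [h0]
  · field_simp

end SecondMoment

section Hajek

variable {α Ω : Type*} [MeasurableSpace α] [MeasurableSpace Ω] {P : Measure Ω}
  {F : Measure α} {D : α → ℝ}

/-- The probability that `D` does not exceed `D x` at a random point. -/
noncomputable def depthRank (F : Measure α) (D : α → ℝ) (x : α) : ℝ :=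
  ∫ z, leIndicator (D z) (D x) ∂F

/-- The completely degenerate part of the comparison of two points by `D`. -/
noncomputable def hajekRemainder (F : Measure α) (D : α → ℝ) (p : α × α) : ℝ :=
  leIndicator (D p.1) (D p.2) - 1 / 2 - (1 / 2 - depthRank F D p.1) - (depthRank F D p.2 - 1 / 2)

theorem depthRank_nonneg (x : α) : 0 ≤ depthRank F D x :=
  integral_nonneg fun _ => leIndicator_nonneg _ _

theorem map_triple_eq_prod [IsProbabilityMeasure P] {κ : Type*} {W : κ → Ω → α}
    (hW : ∀ k, Measurable (W k))
    (hF : ∀ k, P.map (W k) = F) (hi : iIndepFun W P) {a b c : κ} (hab : a ≠ b) (hac : a ≠ c)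
    (hbc : b ≠ c) : P.map (fun ω => (W a ω, (W b ω, W c ω))) = F.prod (F.prod F) := by
  rw [(indepFun_iff_map_prod_eq_prod_map_map (hW a).aemeasurable
    ((hW b).prodMk (hW c)).aemeasurable).1 (hi.indepFun_prodMk hW b c a hab.symm hac.symm).symm,
    hF, map_prodMk_eq_prod hW hF hi hbc]

variable [IsProbabilityMeasure F]

theorem depthRank_le_one (x : α) : depthRank F D x ≤ 1 := by
  refine (integral_mono_of_nonneg (ae_of_all _ fun _ => leIndicator_nonneg _ _)
    (integrable_const (1 : ℝ)) (ae_of_all _ fun z => leIndicator_le_one _ _)).trans ?_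
  simp

theorem abs_depthRank_le_one (x : α) : |depthRank F D x| ≤ 1 :=
  abs_le.2 ⟨by linarith [depthRank_nonneg (F := F) (D := D) x], depthRank_le_one x⟩

theorem measurable_depthRank (hD : Measurable D) : Measurable (depthRank F D) := by
  have : Measurable fun p : α × α => leIndicator (D p.2) (D p.1) :=
    Measurable.leIndicator (by fun_prop) (by fun_prop)
  exact this.stronglyMeasurable.integral_prod_right'.measurable

theorem integrable_depthRank (hD : Measurable D) : Integrable (depthRank F D) F :=
  integrable_of_measurable_of_abs_le_const (measurable_depthRank hD) abs_depthRank_le_one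

theorem measurable_hajekRemainder (hD : Measurable D) : Measurable (hajekRemainder F D) := by
  have h1 : Measurable fun p : α × α => leIndicator (D p.1) (D p.2) :=
    Measurable.leIndicator (by fun_prop) (by fun_prop)
  have h2 := measurable_depthRank (F := F) hD
  unfold hajekRemainder
  fun_prop

theorem abs_hajekRemainder_le (p : α × α) : |hajekRemainder F D p| ≤ 2 := by
  have h1 := leIndicator_nonneg (D p.1) (D p.2)
  have h2 := leIndicator_le_one (D p.1) (D p.2)
  have h3 := depthRank_nonneg (F := F) (D := D) p.1
  have h4 := depthRank_le_one (F := F) (D := D) p.1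
  have h5 := depthRank_nonneg (F := F) (D := D) p.2
  have h6 := depthRank_le_one (F := F) (D := D) p.2
  rw [abs_le, hajekRemainder]
  constructor <;> linarith

theorem integral_depthRank (hD : Measurable D) (h0 : ∀ t, F.real {z | D z = t} = 0) :
    ∫ x, depthRank F D x ∂F = 1 / 2 := by
  have h := integral_leIndicator_of_noAtoms hD h0
  have hm : Measurable fun p : α × α => leIndicator (D p.1) (D p.2) :=
    Measurable.leIndicator (by fun_prop) (by fun_prop)
  rw [integral_prod_symm _ (integrable_of_measurable_of_abs_le_const hm fun p =>
    abs_leIndicator_le_one _ _)] at h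
  exact h

theorem integral_leIndicator_left (hD : Measurable D) (h0 : ∀ t, F.real {z | D z = t} = 0) (x : α) :
    ∫ y, leIndicator (D x) (D y) ∂F = 1 - depthRank F D x := by
  have hae : ∀ᵐ z ∂F, D z ≠ D x := by
    have := h0 (D x)
    rw [measureReal_eq_zero_iff] at this
    exact compl_mem_ae_iff.2 this
  have : ∫ y, (leIndicator (D x) (D y) + leIndicator (D y) (D x)) ∂F = 1 := by
    rw [integral_congr_ae (g := fun _ => (1 : ℝ))]
    · simp
    · filter_upwards [hae] with z hz
      rw [leIndicator_add_leIndicator_swap, if_neg hz.symm, add_zero]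
  rw [integral_add (integrable_leIndicator measurable_const hD)
    (integrable_leIndicator hD measurable_const)] at this
  rw [depthRank]
  linarith

theorem integral_hajekRemainder_right (hD : Measurable D) (h0 : ∀ t, F.real {z | D z = t} = 0)
    (x : α) : ∫ y, hajekRemainder F D (x, y) ∂F = 0 := by
  have h1 : Integrable (fun y => leIndicator (D x) (D y)) F :=
    integrable_leIndicator measurable_const hD
  have h2 := integrable_depthRank (F := F) hD
  have e : ∀ y, hajekRemainder F D (x, y) =
      leIndicator (D x) (D y) - depthRank F D y + (depthRank F D x - 1 / 2) := fun y => by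
    rw [hajekRemainder]; ring
  simp_rw [e]
  have h12 : Integrable (fun y => leIndicator (D x) (D y) - depthRank F D y) F := h1.sub h2
  rw [integral_add h12 (integrable_const _), integral_sub h1 h2,
    integral_leIndicator_left hD h0, integral_depthRank hD h0]
  simp
  ring

theorem integral_hajekRemainder_left (hD : Measurable D) (h0 : ∀ t, F.real {z | D z = t} = 0)
    (y : α) : ∫ x, hajekRemainder F D (x, y) ∂F = 0 := by
  have h1 : Integrable (fun x => leIndicator (D x) (D y)) F :=
    integrable_leIndicator hD measurable_const
  have h2 := integrable_depthRank (F := F) hD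
  have e : ∀ x, hajekRemainder F D (x, y) =
      leIndicator (D x) (D y) + depthRank F D x + (- depthRank F D y - 1 / 2) := fun x => by
    rw [hajekRemainder]; ring
  simp_rw [e]
  have h12 : Integrable (fun x => leIndicator (D x) (D y) + depthRank F D x) F := h1.add h2
  rw [integral_add h12 (integrable_const _), integral_add h1 h2, integral_depthRank hD h0]
  simp only [integral_const, probReal_univ, smul_eq_mul, one_mul]
  change depthRank F D y + 1 / 2 + (-depthRank F D y - 1 / 2) = 0
  ring

theorem integral_mul_of_map_triple {V W₁ W₂ : Ω → α} (hV : Measurable V) (hW₁ : Measurable W₁)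
    (hW₂ : Measurable W₂) (hlaw : P.map (fun ω => (V ω, (W₁ ω, W₂ ω))) = F.prod (F.prod F))
    {f : α × α → ℝ} (hf : Measurable f) {c : ℝ} (hc : ∀ x, |f x| ≤ c) :
    ∫ ω, f (V ω, W₁ ω) * f (V ω, W₂ ω) ∂P = ∫ x, (∫ y, f (x, y) ∂F) * (∫ y, f (x, y) ∂F) ∂F := by
  rw [← integral_prod_prod_mul hf hf hc hc, ← hlaw, integral_map (by fun_prop) (by fun_prop)]

variable [IsProbabilityMeasure P]

/-- The second moment of the rank is that of the uniform distribution on `[0, 1]`. -/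
theorem integral_depthRank_mul_self (hD : Measurable D) (h0 : ∀ t, F.real {z | D z = t} = 0)
    {W : ℕ → Ω → α} (hW : ∀ k, Measurable (W k)) (hF : ∀ k, P.map (W k) = F)
    (hi : iIndepFun W P) : ∫ x, depthRank F D x * depthRank F D x ∂F = 1 / 3 := by
  have hm : Measurable fun p : α × α => leIndicator (D p.2) (D p.1) :=
    Measurable.leIndicator (by fun_prop) (by fun_prop)
  have key : ∀ a b c : ℕ, a ≠ b → a ≠ c → b ≠ c →
      ∫ ω, leIndicator (D (W b ω)) (D (W a ω)) * leIndicator (D (W c ω)) (D (W a ω)) ∂P =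
        ∫ x, depthRank F D x * depthRank F D x ∂F := fun a b c hab hac hbc =>
    integral_mul_of_map_triple (hW a) (hW b) (hW c) (map_triple_eq_prod hW hF hi hab hac hbc) hm
      fun x => abs_leIndicator_le_one _ _
  have hint : ∀ a b c : ℕ, Integrable (fun ω => leIndicator (D (W b ω)) (D (W a ω)) *
      leIndicator (D (W c ω)) (D (W a ω))) P := fun a b c => by
    refine integrable_of_measurable_of_abs_le_const (c := 1) (Measurable.mul
      (Measurable.leIndicator (hD.comp (hW b)) (hD.comp (hW a)))
      (Measurable.leIndicator (hD.comp (hW c)) (hD.comp (hW a)))) fun ω => ?_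
    rw [abs_mul]
    exact mul_le_one₀ (abs_leIndicator_le_one _ _) (abs_nonneg _) (abs_leIndicator_le_one _ _)
  have htie : ∀ a b : ℕ, a ≠ b → ∀ᵐ ω ∂P, D (W a ω) ≠ D (W b ω) := fun a b hab => by
    have h := measureReal_prod_eq_zero_of_noAtoms hD h0
    rw [measureReal_eq_zero_iff, ← map_prodMk_eq_prod hW hF hi hab, Measure.map_apply (by fun_prop)
      (measurableSet_eq_fun (by fun_prop) (by fun_prop))] at h
    exact compl_mem_ae_iff.2 h
  have hsum : ∫ ω, (leIndicator (D (W 1 ω)) (D (W 0 ω)) * leIndicator (D (W 2 ω)) (D (W 0 ω)) +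
      (leIndicator (D (W 0 ω)) (D (W 1 ω)) * leIndicator (D (W 2 ω)) (D (W 1 ω)) +
      leIndicator (D (W 0 ω)) (D (W 2 ω)) * leIndicator (D (W 1 ω)) (D (W 2 ω)))) ∂P = 1 := by
    rw [integral_congr_ae (g := fun _ => (1 : ℝ))]
    · simp
    · filter_upwards [htie 0 1 (by norm_num), htie 0 2 (by norm_num), htie 1 2 (by norm_num)]
        with ω h1 h2 h3
      simp only [leIndicator]
      rcases lt_or_gt_of_ne h1 with h1 | h1 <;> rcases lt_or_gt_of_ne h2 with h2 | h2 <;>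
        rcases lt_or_gt_of_ne h3 with h3 | h3 <;>
        simp only [h1.le, h2.le, h3.le, not_le.2 h1, not_le.2 h2, not_le.2 h3, if_true,
          if_false] <;>
        norm_num <;> linarith
  have h23 : Integrable (fun ω => leIndicator (D (W 0 ω)) (D (W 1 ω)) *
      leIndicator (D (W 2 ω)) (D (W 1 ω)) + leIndicator (D (W 0 ω)) (D (W 2 ω)) *
      leIndicator (D (W 1 ω)) (D (W 2 ω))) P := (hint 1 0 2).add (hint 2 0 1)
  rw [integral_add (hint 0 1 2) h23, integral_add (hint 1 0 2) (hint 2 0 1),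
    key 0 1 2 (by norm_num) (by norm_num) (by norm_num),
    key 1 0 2 (by norm_num) (by norm_num) (by norm_num),
    key 2 0 1 (by norm_num) (by norm_num) (by norm_num)] at hsum
  linarith

theorem integral_sq_average_hajekRemainder_le (hD : Measurable D)
    (h0 : ∀ t, F.real {z | D z = t} = 0) {X Y : ℕ → Ω → α} (hX : ∀ i, Measurable (X i))
    (hY : ∀ j, Measurable (Y j)) (hXF : ∀ i, P.map (X i) = F) (hYF : ∀ j, P.map (Y j) = F)
    (hi : iIndepFun (Sum.elim X Y) P) (n m : ℕ) :
    ∫ ω, ((n * m : ℝ)⁻¹ * ∑ a ∈ Finset.range n ×ˢ Finset.range m,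
      hajekRemainder F D (X a.1 ω, Y a.2 ω)) ^ 2 ∂P ≤ 4 / (n * m) := by
  have hWm : ∀ k, Measurable (Sum.elim X Y k) := fun k => by cases k <;> simp [hX, hY]
  have hWF : ∀ k, P.map (Sum.elim X Y k) = F := fun k => by cases k <;> simp [hXF, hYF]
  have hH := measurable_hajekRemainder (F := F) hD
  have hH' : Measurable fun p : α × α => hajekRemainder F D (p.2, p.1) := by fun_prop
  have hbd : ∀ a b : ℕ × ℕ, ∀ ω, |hajekRemainder F D (X a.1 ω, Y a.2 ω) *
      hajekRemainder F D (X b.1 ω, Y b.2 ω)| ≤ 4 := fun a b ω => by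
    rw [abs_mul]
    exact (mul_le_mul (abs_hajekRemainder_le _) (abs_hajekRemainder_le _) (abs_nonneg _)
      (by norm_num)).trans_eq (by norm_num)
  have hint : ∀ a b : ℕ × ℕ, Integrable (fun ω => hajekRemainder F D (X a.1 ω, Y a.2 ω) *
      hajekRemainder F D (X b.1 ω, Y b.2 ω)) P := fun a b =>
    integrable_of_measurable_of_abs_le_const (by fun_prop) (hbd a b)
  refine integral_sq_average_le_of_orthogonal n m hint ?_ fun a => ?_
  · rintro ⟨i, j⟩ ⟨i', j'⟩ hne
    simp only
    by_cases hii : i = i'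
    · subst hii
      have hjj : j ≠ j' := fun h => hne (by rw [h])
      have hlaw := map_triple_eq_prod (P := P) hWm hWF hi (a := Sum.inl i) (b := Sum.inr j)
        (c := Sum.inr j') (by simp) (by simp) (by simpa using hjj)
      simp only [Sum.elim_inl, Sum.elim_inr] at hlaw
      rw [integral_mul_of_map_triple (hX i) (hY j) (hY j') hlaw hH abs_hajekRemainder_le]
      simp [integral_hajekRemainder_right hD h0]
    · by_cases hjj : j = j'
      · subst hjj
        have hlaw := map_triple_eq_prod (P := P) hWm hWF hi (a := Sum.inr j) (b := Sum.inl i)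
          (c := Sum.inl i') (by simp) (by simp) (by simpa using hii)
        simp only [Sum.elim_inl, Sum.elim_inr] at hlaw
        have := integral_mul_of_map_triple (hY j) (hX i) (hX i') hlaw hH'
          (fun p => abs_hajekRemainder_le _)
        simp only [integral_hajekRemainder_left hD h0] at this
        simpa using this
      · have hind := hi.indepFun_prodMk_prodMk hWm (Sum.inl i) (Sum.inr j) (Sum.inl i')
          (Sum.inr j') (by simpa using hii) (by simp) (by simp) (by simpa using hjj)
        simp only [Sum.elim_inl, Sum.elim_inr] at hind
        have h1 := (hind.comp hH hH).integral_mul_eq_mul_integral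
          (hH.comp (by fun_prop)).aestronglyMeasurable (hH.comp (by fun_prop)).aestronglyMeasurable
        have hlaw := map_prodMk_eq_prod (P := P) hWm hWF hi (k := Sum.inl i) (l := Sum.inr j)
          (by simp)
        simp only [Sum.elim_inl, Sum.elim_inr] at hlaw
        have hz : ∫ ω, hajekRemainder F D (X i ω, Y j ω) ∂P = 0 := by
          have hmap := integral_map (μ := P) (φ := fun ω => (X i ω, Y j ω)) (by fun_prop)
            hH.aestronglyMeasurable
          rw [← hmap, hlaw, integral_prod _ (integrable_of_measurable_of_abs_le_const hH
            abs_hajekRemainder_le)]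
          simp [integral_hajekRemainder_right hD h0]
        have h2 : ∫ ω, hajekRemainder F D (X i ω, Y j ω) * hajekRemainder F D (X i' ω, Y j' ω) ∂P =
            (∫ ω, hajekRemainder F D (X i ω, Y j ω) ∂P) *
              ∫ ω, hajekRemainder F D (X i' ω, Y j' ω) ∂P := h1
        rw [h2, hz, zero_mul]
  · have h := integral_mono (hint a a) (integrable_const (4 : ℝ)) fun ω =>
      (le_abs_self _).trans (hbd a a ω)
    simpa using h

end Hajek

section TwoSampleCLT

theorem norm_pow_sub_pow_le_of_norm_le_one {a b : ℂ} (ha : ‖a‖ ≤ 1) (hb : ‖b‖ ≤ 1) (n : ℕ) :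
    ‖a ^ n - b ^ n‖ ≤ n * ‖a - b‖ := by
  induction n with
  | zero => simp
  | succ n ih =>
    have e : a ^ (n + 1) - b ^ (n + 1) = a ^ n * (a - b) + (a ^ n - b ^ n) * b := by ring
    rw [e]
    refine (norm_add_le _ _).trans ?_
    rw [norm_mul, norm_mul, norm_pow]
    have h1 : ‖a‖ ^ n * ‖a - b‖ ≤ 1 * ‖a - b‖ :=
      mul_le_mul_of_nonneg_right (pow_le_one₀ (norm_nonneg _) ha) (norm_nonneg _)
    have h2 : ‖a ^ n - b ^ n‖ * ‖b‖ ≤ n * ‖a - b‖ * 1 :=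
      mul_le_mul ih hb (norm_nonneg _) (by positivity)
    push_cast
    linarith

theorem norm_mul_sub_mul_le_of_norm_le_one {a b c d : ℂ} (ha : ‖a‖ ≤ 1) (hd : ‖d‖ ≤ 1) :
    ‖a * b - c * d‖ ≤ ‖a - c‖ + ‖b - d‖ := by
  have e : a * b - c * d = a * (b - d) + (a - c) * d := by ring
  rw [e]
  refine (norm_add_le _ _).trans ?_
  rw [norm_mul, norm_mul]
  have h1 : ‖a‖ * ‖b - d‖ ≤ 1 * ‖b - d‖ := mul_le_mul_of_nonneg_right ha (norm_nonneg _)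
  have h2 : ‖a - c‖ * ‖d‖ ≤ ‖a - c‖ * 1 := mul_le_mul_of_nonneg_left hd (norm_nonneg _)
  linarith

theorem exists_forall_norm_pow_sub_pow_le {φ ψ : ℝ → ℂ} (hφ : ∀ t, ‖φ t‖ ≤ 1)
    (hψ : ∀ t, ‖ψ t‖ ≤ 1) (h : (fun t => φ t - ψ t) =o[𝓝 0] fun t => t ^ 2) (t : ℝ) {ε : ℝ}
    (hε : 0 < ε) :
    ∃ n₀ : ℕ, ∀ n, n₀ ≤ n → ∀ a : ℝ, n * a ^ 2 ≤ 1 → ‖φ (a * t) ^ n - ψ (a * t) ^ n‖ ≤ ε := by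
  have h1 := h.def (by positivity : 0 < ε / (t ^ 2 + 1))
  obtain ⟨δ, hδ, hball⟩ := Metric.eventually_nhds_iff.1 h1
  obtain ⟨n₀, hn₀⟩ := exists_nat_gt (t ^ 2 / δ ^ 2)
  refine ⟨n₀, fun n hn a ha => ?_⟩
  have hn' : t ^ 2 / δ ^ 2 < n := hn₀.trans_le (by exact_mod_cast hn)
  rw [div_lt_iff₀ (by positivity)] at hn'
  have hn0 : (0 : ℝ) < n := by
    by_contra hcon
    nlinarith [sq_nonneg t, sq_nonneg δ]
  have hsmall : (a * t) ^ 2 < δ ^ 2 := by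
    have h2 : n * (a * t) ^ 2 ≤ t ^ 2 := by nlinarith [sq_nonneg t]
    have h3 : n * (a * t) ^ 2 < n * δ ^ 2 := h2.trans_lt hn'
    exact lt_of_mul_lt_mul_left h3 hn0.le
  have hd : dist (a * t) 0 < δ := by
    rw [Real.dist_eq, sub_zero]
    exact abs_lt_of_sq_lt_sq hsmall hδ.le
  have h4 := hball hd
  rw [Real.norm_of_nonneg (sq_nonneg (a * t))] at h4
  refine (norm_pow_sub_pow_le_of_norm_le_one (hφ _) (hψ _) n).trans ?_
  calc n * ‖φ (a * t) - ψ (a * t)‖ ≤ n * (ε / (t ^ 2 + 1) * (a * t) ^ 2) := by gcongr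
    _ = (n * a ^ 2) * (ε * (t ^ 2 / (t ^ 2 + 1))) := by ring
    _ ≤ 1 * (ε * 1) := by
        gcongr
        rw [div_le_one (by positivity)]
        linarith
    _ = ε := by ring

variable {Ω : Type*} [MeasurableSpace Ω] {P : Measure Ω}

theorem isLittleO_charFun_sub_charFun_gaussianReal [IsProbabilityMeasure P] {Z : Ω → ℝ}
    (hZ : AEMeasurable Z P)
    (h0 : P[Z] = 0) (h1 : P[Z ^ 2] = 1) :
    (fun t => charFun (P.map Z) t - charFun (gaussianReal 0 1) t) =o[𝓝 0] fun t : ℝ => t ^ 2 := by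
  have hg := taylor_charFun_two (P := gaussianReal 0 1) (X := id) (by fun_prop) (by simp) (by
    have h := variance_id_gaussianReal (μ := 0) (v := 1)
    rw [variance_of_integral_eq_zero (by fun_prop) (by simp)] at h
    simpa using h)
  rw [Measure.map_id] at hg
  refine ((taylor_charFun_two hZ h0 h1).sub hg).congr_left fun t => ?_
  ring

theorem charFun_map_two_sample {Z Z' : ℕ → Ω → ℝ} (hZ : ∀ i, Measurable (Z i))
    (hZ' : ∀ j, Measurable (Z' j)) (hi : iIndepFun (Sum.elim Z Z') P)
    (hl : ∀ i, P.map (Z i) = P.map (Z 0)) (hl' : ∀ j, P.map (Z' j) = P.map (Z' 0)) (n m : ℕ)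
    (a b t : ℝ) :
    charFun (P.map fun ω => a * ∑ i ∈ Finset.range n, Z i ω + b * ∑ j ∈ Finset.range m, Z' j ω) t =
      charFun (P.map (Z 0)) (a * t) ^ n * charFun (P.map (Z' 0)) (b * t) ^ m := by
  set V : ℕ ⊕ ℕ → Ω → ℝ := Sum.elim (fun i ω => a * Z i ω) (fun j ω => b * Z' j ω) with hV
  have hVm : ∀ k, Measurable (V k) := fun k => by
    cases k <;> simp only [hV, Sum.elim_inl, Sum.elim_inr] <;> fun_prop
  have hVi : iIndepFun V P := by
    have h := hi.comp (g := fun k x => (Sum.elim (fun _ => a) (fun _ => b) k : ℝ) * x)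
      (fun k => by fun_prop)
    convert h using 1
    funext k
    cases k <;> rfl
  have e : (fun ω => a * ∑ i ∈ Finset.range n, Z i ω + b * ∑ j ∈ Finset.range m, Z' j ω) =
      fun ω => ∑ k ∈ (Finset.range n).disjSum (Finset.range m), V k ω := by
    funext ω
    rw [Finset.sum_disjSum, Finset.mul_sum, Finset.mul_sum]
    rfl
  rw [e, (hVi.restrict _).charFun_map_fun_finsetSum_eq_prod (fun k _ => (hVm k).aemeasurable),
    Finset.prod_apply, Finset.prod_disjSum]
  have c1 : ∀ i, charFun (P.map (V (Sum.inl i))) t = charFun (P.map (Z 0)) (a * t) := fun i => by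
    simp only [hV, Sum.elim_inl]
    rw [charFun_map_mul_comp (hZ i).aemeasurable, hl]
  have c2 : ∀ j, charFun (P.map (V (Sum.inr j))) t = charFun (P.map (Z' 0)) (b * t) := fun j => by
    simp only [hV, Sum.elim_inr]
    rw [charFun_map_mul_comp (hZ' j).aemeasurable, hl']
  simp only [c1, c2, Finset.prod_const, Finset.card_range]

variable [IsProbabilityMeasure P]

/-- The central limit theorem for the sum of the averages of two independent samples. -/
theorem tendstoInDistribution_two_sample {Z Z' : ℕ → Ω → ℝ} (hZ : ∀ i, Measurable (Z i))
    (hZ' : ∀ j, Measurable (Z' j)) (hi : iIndepFun (Sum.elim Z Z') P)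
    (hl : ∀ i, P.map (Z i) = P.map (Z 0)) (hl' : ∀ j, P.map (Z' j) = P.map (Z' 0))
    (h0 : P[Z 0] = 0) (h1 : P[Z 0 ^ 2] = 1) (h0' : P[Z' 0] = 0) (h1' : P[Z' 0 ^ 2] = 1) :
    TendstoInDistribution (fun (p : ℕ × ℕ) ω => (√(1 / (p.1 : ℝ) + 1 / p.2))⁻¹ *
        ((p.1 : ℝ)⁻¹ * ∑ i ∈ Finset.range p.1, Z i ω +
          (p.2 : ℝ)⁻¹ * ∑ j ∈ Finset.range p.2, Z' j ω))
      (atTop ×ˢ atTop) (id : ℝ → ℝ) (fun _ => P) (gaussianReal 0 1) where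
  forall_aemeasurable p := by fun_prop
  tendsto := by
    refine tendsto_of_seq_tendsto fun x hx => ?_
    refine ProbabilityMeasure.tendsto_of_tendsto_charFun fun t => ?_
    simp only [ProbabilityMeasure.coe_mk, Measure.map_id]
    suffices H : Tendsto (fun p : ℕ × ℕ => charFun (P.map fun ω => (√(1 / (p.1 : ℝ) + 1 / p.2))⁻¹ *
        ((p.1 : ℝ)⁻¹ * ∑ i ∈ Finset.range p.1, Z i ω +
          (p.2 : ℝ)⁻¹ * ∑ j ∈ Finset.range p.2, Z' j ω)) t) (atTop ×ˢ atTop)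
        (𝓝 (charFun (gaussianReal 0 1) t)) from H.comp hx
    have hP1 := isLittleO_charFun_sub_charFun_gaussianReal (hZ 0).aemeasurable h0 h1
    have hP2 := isLittleO_charFun_sub_charFun_gaussianReal (hZ' 0).aemeasurable h0' h1'
    have hprob : ∀ {Y : Ω → ℝ}, Measurable Y → IsProbabilityMeasure (P.map Y) := fun hY =>
      Measure.isProbabilityMeasure_map hY.aemeasurable
    have := hprob (hZ 0)
    have := hprob (hZ' 0)
    rw [Metric.tendsto_nhds]
    intro ε hε
    obtain ⟨n₀, hn₀⟩ := exists_forall_norm_pow_sub_pow_le (fun t => norm_charFun_le_one t)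
      (fun t => norm_charFun_le_one t) hP1 t (by positivity : 0 < ε / 4)
    obtain ⟨m₀, hm₀⟩ := exists_forall_norm_pow_sub_pow_le (fun t => norm_charFun_le_one t)
      (fun t => norm_charFun_le_one t) hP2 t (by positivity : 0 < ε / 4)
    filter_upwards [prod_mem_prod (Ici_mem_atTop (max 1 n₀)) (Ici_mem_atTop (max 1 m₀))] with p hp
    obtain ⟨n, m⟩ := p
    obtain ⟨hpn, hpm⟩ := hp
    simp only [Set.mem_Ici, max_le_iff] at hpn hpm
    have hn : (0 : ℝ) < n := by exact_mod_cast hpn.1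
    have hm : (0 : ℝ) < m := by exact_mod_cast hpm.1
    set σ : ℝ := 1 / (n : ℝ) + 1 / m with hσ
    have hσ0 : 0 < σ := by positivity
    set a : ℝ := (√σ)⁻¹ * (n : ℝ)⁻¹ with ha
    set b : ℝ := (√σ)⁻¹ * (m : ℝ)⁻¹ with hb
    have hsum : n * a ^ 2 + m * b ^ 2 = 1 := by
      rw [ha, hb, mul_pow, mul_pow, inv_pow, Real.sq_sqrt hσ0.le, hσ]
      field_simp
    have ha1 : n * a ^ 2 ≤ 1 := by
      have : 0 ≤ m * b ^ 2 := by positivity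
      linarith
    have hb1 : m * b ^ 2 ≤ 1 := by
      have : 0 ≤ n * a ^ 2 := by positivity
      linarith
    have e : (fun ω => (√σ)⁻¹ * ((n : ℝ)⁻¹ * ∑ i ∈ Finset.range n, Z i ω +
        (m : ℝ)⁻¹ * ∑ j ∈ Finset.range m, Z' j ω)) =
        fun ω => a * ∑ i ∈ Finset.range n, Z i ω + b * ∑ j ∈ Finset.range m, Z' j ω := by
      funext ω
      rw [ha, hb]
      ring
    have hG : charFun (gaussianReal 0 1) t =
        charFun (gaussianReal 0 1) (a * t) ^ n * charFun (gaussianReal 0 1) (b * t) ^ m := by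
      simp only [charFun_gaussianReal, ← Complex.exp_nat_mul, ← Complex.exp_add]
      congr 1
      have : ((n * a ^ 2 + m * b ^ 2 : ℝ) : ℂ) = 1 := by rw [hsum]; simp
      push_cast at this ⊢
      linear_combination (t ^ 2 / 2 : ℂ) * this
    rw [e, charFun_map_two_sample hZ hZ' hi hl hl', hG, dist_eq_norm]
    refine (norm_mul_sub_mul_le_of_norm_le_one ?_ ?_).trans_lt
      ((add_le_add (hn₀ n hpn.2 a ha1) (hm₀ m hpm.2 b hb1)).trans_lt (by linarith))
    · rw [norm_pow]
      exact pow_le_one₀ (norm_nonneg _) (norm_charFun_le_one _)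
    · rw [norm_pow]
      exact pow_le_one₀ (norm_nonneg _) (norm_charFun_le_one _)

end TwoSampleCLT

section Rank

variable {α Ω : Type*} [MeasurableSpace α] [MeasurableSpace Ω] {P : Measure Ω}
  {F : Measure α} {D : α → ℝ}

theorem average_leIndicator_sub_half_eq {n m : ℕ} (hn : 0 < n) (hm : 0 < m) (Dn : α → ℝ)
    (x y : ℕ → α) :
    (n * m : ℝ)⁻¹ * ∑ a ∈ Finset.range n ×ˢ Finset.range m, leIndicator (Dn (x a.1)) (Dn (y a.2)) -
        1 / 2 =
      ((n : ℝ)⁻¹ * ∑ i ∈ Finset.range n, (1 / 2 - depthRank F D (x i)) +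
        (m : ℝ)⁻¹ * ∑ j ∈ Finset.range m, (depthRank F D (y j) - 1 / 2)) +
      ((n * m : ℝ)⁻¹ * ∑ a ∈ Finset.range n ×ˢ Finset.range m, orderGap Dn D (x a.1) (y a.2) +
        (n * m : ℝ)⁻¹ * ∑ a ∈ Finset.range n ×ˢ Finset.range m,
          hajekRemainder F D (x a.1, y a.2)) := by
  have hn' : (n : ℝ) ≠ 0 := by exact_mod_cast hn.ne'
  have hm' : (m : ℝ) ≠ 0 := by exact_mod_cast hm.ne'
  have e : ∀ a : ℕ × ℕ, leIndicator (Dn (x a.1)) (Dn (y a.2)) =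
      orderGap Dn D (x a.1) (y a.2) + hajekRemainder F D (x a.1, y a.2) + 1 / 2 +
        (1 / 2 - depthRank F D (x a.1)) + (depthRank F D (y a.2) - 1 / 2) := fun a => by
    rw [orderGap, hajekRemainder]
    ring
  have e1 : ∑ a ∈ Finset.range n ×ˢ Finset.range m, (1 / 2 - depthRank F D (x a.1)) =
      m * ∑ i ∈ Finset.range n, (1 / 2 - depthRank F D (x i)) := by
    rw [Finset.sum_product, Finset.mul_sum]
    exact Finset.sum_congr rfl fun i _ => by
      change ∑ _j ∈ Finset.range m, (1 / 2 - depthRank F D (x i)) = _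
      rw [Finset.sum_const, nsmul_eq_mul, Finset.card_range]
  have e2 : ∑ a ∈ Finset.range n ×ˢ Finset.range m, (depthRank F D (y a.2) - 1 / 2) =
      n * ∑ j ∈ Finset.range m, (depthRank F D (y j) - 1 / 2) := by
    rw [Finset.sum_product_right, Finset.mul_sum]
    exact Finset.sum_congr rfl fun j _ => by
      change ∑ _i ∈ Finset.range n, (depthRank F D (y j) - 1 / 2) = _
      rw [Finset.sum_const, nsmul_eq_mul, Finset.card_range]
  simp_rw [e]
  rw [Finset.sum_add_distrib, Finset.sum_add_distrib, Finset.sum_add_distrib,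
    Finset.sum_add_distrib, e1, e2]
  simp only [Finset.sum_const, Finset.card_product, Finset.card_range, nsmul_eq_mul, Nat.cast_mul]
  field_simp
  ring

variable [IsProbabilityMeasure F]

theorem integral_depthRank_sub_half (hD : Measurable D) (h0 : ∀ t, F.real {z | D z = t} = 0) :
    ∫ x, (depthRank F D x - 1 / 2) ∂F = 0 := by
  rw [integral_sub (integrable_depthRank hD) (integrable_const _), integral_depthRank hD h0]
  simp

variable [IsProbabilityMeasure P]

theorem integral_sq_depthRank_sub_half (hD : Measurable D) (h0 : ∀ t, F.real {z | D z = t} = 0)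
    {W : ℕ → Ω → α} (hW : ∀ k, Measurable (W k)) (hF : ∀ k, P.map (W k) = F)
    (hi : iIndepFun W P) : ∫ x, (depthRank F D x - 1 / 2) ^ 2 ∂F = 1 / 12 := by
  have h1 := integral_depthRank_mul_self hD h0 hW hF hi
  have h2 := integral_depthRank_sub_half (F := F) hD h0
  have e : ∀ x, (depthRank F D x - 1 / 2) ^ 2 =
      depthRank F D x * depthRank F D x - ((depthRank F D x - 1 / 2) + 1 / 4) := fun x => by ring
  have hk := measurable_depthRank (F := F) hD
  have i1 : Integrable (fun x => depthRank F D x * depthRank F D x) F :=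
    integrable_of_measurable_of_abs_le_const (c := 1) (by fun_prop) fun x => by
      rw [abs_mul]
      exact mul_le_one₀ (abs_depthRank_le_one _) (abs_nonneg _) (abs_depthRank_le_one _)
  have i2 : Integrable (fun x => depthRank F D x - 1 / 2) F :=
    (integrable_depthRank hD).sub (integrable_const _)
  have i3 : Integrable (fun x => (depthRank F D x - 1 / 2) + 1 / 4) F :=
    i2.add (integrable_const _)
  simp_rw [e]
  rw [integral_sub i1 i3, integral_add i2 (integrable_const _), h1, h2]
  simp
  norm_num

/-- Asymptotic normality of the linear part of the two-sample rank statistic. -/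
theorem tendstoInDistribution_depthRank (hD : Measurable D) (h0 : ∀ t, F.real {z | D z = t} = 0)
    {X Y : ℕ → Ω → α} (hX : ∀ i, Measurable (X i)) (hY : ∀ j, Measurable (Y j))
    (hXF : ∀ i, P.map (X i) = F) (hYF : ∀ j, P.map (Y j) = F) (hi : iIndepFun (Sum.elim X Y) P) :
    TendstoInDistribution (fun (p : ℕ × ℕ) ω => √12 * (√(1 / (p.1 : ℝ) + 1 / p.2))⁻¹ *
        ((p.1 : ℝ)⁻¹ * ∑ i ∈ Finset.range p.1, (1 / 2 - depthRank F D (X i ω)) +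
          (p.2 : ℝ)⁻¹ * ∑ j ∈ Finset.range p.2, (depthRank F D (Y j ω) - 1 / 2)))
      (atTop ×ˢ atTop) (id : ℝ → ℝ) (fun _ => P) (gaussianReal 0 1) := by
  have hk := measurable_depthRank (F := F) hD
  have hXi : iIndepFun X P :=
    iIndepFun.precomp (f := Sum.elim X Y) (g := Sum.inl) Sum.inl_injective hi
  have hvar := integral_sq_depthRank_sub_half hD h0 hX hXF hXi
  have hmean := integral_depthRank_sub_half (F := F) hD h0
  set Z : ℕ → Ω → ℝ := fun i ω => √12 * (1 / 2 - depthRank F D (X i ω)) with hZ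
  set Z' : ℕ → Ω → ℝ := fun j ω => √12 * (depthRank F D (Y j ω) - 1 / 2) with hZ'
  have hZm : ∀ i, Measurable (Z i) := fun i => by fun_prop
  have hZm' : ∀ j, Measurable (Z' j) := fun j => by fun_prop
  have hindep : iIndepFun (Sum.elim Z Z') P := by
    have h := hi.comp (g := fun k x => Sum.elim (fun _ => √12 * (1 / 2 - depthRank F D x))
      (fun _ => √12 * (depthRank F D x - 1 / 2)) k) (fun k => by
        cases k <;> simp only [Sum.elim_inl, Sum.elim_inr] <;> fun_prop)
    convert h using 1
    funext k
    cases k <;> rfl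
  have hg : Measurable fun x => √12 * (1 / 2 - depthRank F D x) := by fun_prop
  have hg' : Measurable fun x => √12 * (depthRank F D x - 1 / 2) := by fun_prop
  have hlaw : ∀ i, P.map (Z i) = F.map fun x => √12 * (1 / 2 - depthRank F D x) := fun i => by
    have h := Measure.map_map (μ := P) hg (hX i)
    rw [hXF i] at h
    exact h.symm
  have hlaw' : ∀ j, P.map (Z' j) = F.map fun x => √12 * (depthRank F D x - 1 / 2) := fun j => by
    have h := Measure.map_map (μ := P) hg' (hY j)
    rw [hYF j] at h
    exact h.symm
  have hpush : ∀ {V : Ω → α}, Measurable V → P.map V = F → ∀ {f : α → ℝ}, Measurable f →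
      ∫ ω, f (V ω) ∂P = ∫ x, f x ∂F := fun hV hVF f hf => by
    rw [← hVF, integral_map hV.aemeasurable hf.aestronglyMeasurable]
  have h12 : √12 ^ 2 = (12 : ℝ) := Real.sq_sqrt (by norm_num)
  have := tendstoInDistribution_two_sample hZm hZm' hindep (fun i => by rw [hlaw, hlaw])
    (fun j => by rw [hlaw', hlaw']) ?_ ?_ ?_ ?_
  · refine this.congr (fun p => ae_of_all _ fun ω => ?_) (ae_eq_refl _)
    simp only [hZ, hZ', ← Finset.mul_sum]
    ring
  · have := hpush (hX 0) (hXF 0) hg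
    rw [this]
    have e : ∀ x, √12 * (1 / 2 - depthRank F D x) = -√12 * (depthRank F D x - 1 / 2) :=
      fun x => by ring
    simp_rw [e]
    rw [integral_const_mul, hmean, mul_zero]
  · have := hpush (hX 0) (hXF 0) (hg.pow_const 2)
    refine this.trans ?_
    have e : ∀ x, (√12 * (1 / 2 - depthRank F D x)) ^ 2 = 12 * (depthRank F D x - 1 / 2) ^ 2 :=
      fun x => by rw [mul_pow, h12]; ring
    simp_rw [e]
    rw [integral_const_mul, hvar]
    norm_num
  · have := hpush (hY 0) (hYF 0) hg'
    rw [this, integral_const_mul, hmean, mul_zero]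
  · have := hpush (hY 0) (hYF 0) (hg'.pow_const 2)
    refine this.trans ?_
    simp_rw [mul_pow, h12]
    rw [integral_const_mul, hvar]
    norm_num

end Rank

theorem tendstoInMeasure_zero_of_integral_sq_le {Ω ι : Type*} [MeasurableSpace Ω] {P : Measure Ω}
    [IsProbabilityMeasure P] {l : Filter ι} {f : ι → Ω → ℝ}
    (h : ∀ η > 0, ∀ᶠ p in l, Integrable (fun ω => f p ω ^ 2) P ∧ ∫ ω, f p ω ^ 2 ∂P ≤ η) :
    TendstoInMeasure P f l 0 := by
  rw [tendstoInMeasure_iff_measureReal_norm]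
  intro ε hε
  rw [Metric.tendsto_nhds]
  intro δ hδ
  filter_upwards [h (δ / 2 * ε ^ 2) (by positivity)] with p hp
  have hcheb := (mul_meas_ge_le_integral_of_nonneg (ae_of_all _ fun ω => sq_nonneg (f p ω)) hp.1
    (ε ^ 2)).trans hp.2
  rw [mul_comm, mul_le_mul_iff_left₀ (by positivity)] at hcheb
  rw [Real.dist_eq, sub_zero, abs_of_nonneg measureReal_nonneg]
  refine lt_of_le_of_lt ((measureReal_mono fun ω hω => ?_).trans hcheb) (by linarith)
  change ε ≤ ‖f p ω - (0 : ℝ)‖ at hω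
  rw [sub_zero, Real.norm_eq_abs] at hω
  change ε ^ 2 ≤ f p ω ^ 2
  rw [← sq_abs (f p ω)]
  exact pow_le_pow_left₀ hε.le hω 2

section Main

variable {E : Type*} [NormedAddCommGroup E] [InnerProductSpace ℝ E] [FiniteDimensional ℝ E]
  [MeasurableSpace E] [BorelSpace E] {h : E → ℝ} {r : ℝ}
  {Ω : Type*} [MeasurableSpace Ω] {P : Measure Ω} [IsProbabilityMeasure P]
  {F : Measure E} [IsProbabilityMeasure F] {C R : ℝ}

theorem eventually_integral_sq_remainder_le (hh : ContDiff ℝ (⊤ : ℕ∞) h) (h0 : ∀ v, 0 ≤ h v)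
    (h1 : ∀ v, h v ≤ 1) (hR : ∀ᵐ z ∂F, ‖z‖ ≤ R)
    (hA : ∀ a b, a ≤ b → F.real {z | sphereInf r (potential h F) z ∈ Set.Icc a b} ≤ C * (b - a))
    (hC : 0 < C) {X Y : ℕ → Ω → E} (hX : ∀ i, Measurable (X i)) (hY : ∀ j, Measurable (Y j))
    (hXF : ∀ i, P.map (X i) = F) (hYF : ∀ j, P.map (Y j) = F) (hi : iIndepFun (Sum.elim X Y) P)
    {η : ℝ} (hη : 0 < η) :
    ∀ᶠ p : ℕ × ℕ in atTop ×ˢ atTop, Integrable (fun ω => (√12 * (√(1 / (p.1 : ℝ) + 1 / p.2))⁻¹ *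
      ((p.1 * p.2 : ℝ)⁻¹ * ∑ a ∈ Finset.range p.1 ×ˢ Finset.range p.2,
          orderGap (sphereInf r (potential h (finiteEmpirical fun k : Fin p.1 => X k ω)))
            (sphereInf r (potential h F)) (X a.1 ω) (Y a.2 ω) +
        (p.1 * p.2 : ℝ)⁻¹ * ∑ a ∈ Finset.range p.1 ×ˢ Finset.range p.2,
          hajekRemainder F (sphereInf r (potential h F)) (X a.1 ω, Y a.2 ω))) ^ 2) P ∧
      ∫ ω, (√12 * (√(1 / (p.1 : ℝ) + 1 / p.2))⁻¹ *
      ((p.1 * p.2 : ℝ)⁻¹ * ∑ a ∈ Finset.range p.1 ×ˢ Finset.range p.2,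
          orderGap (sphereInf r (potential h (finiteEmpirical fun k : Fin p.1 => X k ω)))
            (sphereInf r (potential h F)) (X a.1 ω) (Y a.2 ω) +
        (p.1 * p.2 : ℝ)⁻¹ * ∑ a ∈ Finset.range p.1 ×ˢ Finset.range p.2,
          hajekRemainder F (sphereInf r (potential h F)) (X a.1 ω, Y a.2 ω))) ^ 2 ∂P ≤ η := by
  have hc : Continuous h := hh.continuous
  have habs : ∀ v, |h v| ≤ 1 := fun v => abs_le.2 ⟨by linarith [h0 v], h1 v⟩
  set D := sphereInf r (potential h F) with hD
  have hDm : Measurable D :=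
    (continuous_sphereInf_right (continuous_potential hc habs F)).measurable
  have hD0 : ∀ t, F.real {z | D z = t} = 0 := measureReal_eq_singleton_zero hA
  obtain ⟨n₀, hn₀⟩ := exists_forall_integral_orderGap_mul_le hh h0 h1 hR hA hC hX hY hXF hYF hi
    (by positivity : 0 < η / 144)
  obtain ⟨n₁, hn₁⟩ := exists_nat_gt (144 / η)
  filter_upwards [prod_mem_prod (Ici_mem_atTop (max (max 1 n₁) n₀)) (Ici_mem_atTop 1)] with p hp
  obtain ⟨n, m⟩ := p
  obtain ⟨hpn, hpm⟩ := hp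
  simp only [Set.mem_Ici, max_le_iff] at hpn hpm
  obtain ⟨⟨hn1, hnn₁⟩, hnn₀⟩ := hpn
  have hn : (0 : ℝ) < n := by exact_mod_cast hn1
  have hm : (0 : ℝ) < m := by exact_mod_cast hpm
  simp only
  set Dn : Ω → E → ℝ := fun ω => sphereInf r (potential h (finiteEmpirical fun k : Fin n => X k ω))
    with hDn
  have hgm : ∀ i j, Measurable fun ω => orderGap (Dn ω) D (X i ω) (Y j ω) :=
    measurable_orderGap_empirical hc hDm hX hY n
  have hHm := measurable_hajekRemainder (F := F) hDm
  obtain ⟨hb1, hb2⟩ := hn₀ n hnn₀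
  have hint : ∀ a b : ℕ × ℕ, Integrable (fun ω => orderGap (Dn ω) D (X a.1 ω) (Y a.2 ω) *
      orderGap (Dn ω) D (X b.1 ω) (Y b.2 ω)) P := fun a b =>
    integrable_of_measurable_of_abs_le_const (c := 1) ((hgm _ _).mul (hgm _ _)) fun ω => by
      rw [abs_mul]
      exact mul_le_one₀ (abs_orderGap_le_one _ _ _ _) (abs_nonneg _) (abs_orderGap_le_one _ _ _ _)
  have hT := integral_sq_average_le_of_disjoint (P := P)
    (T := fun a ω => orderGap (Dn ω) D (X a.1 ω) (Y a.2 ω)) (α := η / 144 / n) (β := η / 144)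
    (by positivity) (by positivity) (Nat.succ_le_iff.1 hn1) (Nat.succ_le_iff.1 hpm) hint
    (fun a b ha hb hab hab' => hb1 a.1 b.1 a.2 b.2 ha hb hab hab')
    (fun a b ha => by
      refine (integral_mono (hint a b) ?_ fun ω => ?_).trans (hb2 a.1 a.2 ha)
      · exact integrable_of_measurable_of_abs_le_const (c := 1) (hgm _ _).abs fun ω => by
          rw [abs_abs]; exact abs_orderGap_le_one _ _ _ _
      · refine (le_abs_self _).trans ?_
        rw [abs_mul]
        exact mul_le_of_le_one_right (abs_nonneg _) (abs_orderGap_le_one _ _ _ _))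
  have hH := integral_sq_average_hajekRemainder_le hDm hD0 hX hY hXF hYF hi n m
  set A : Ω → ℝ := fun ω => (n * m : ℝ)⁻¹ * ∑ a ∈ Finset.range n ×ˢ Finset.range m,
    orderGap (Dn ω) D (X a.1 ω) (Y a.2 ω) with hAdef
  set B : Ω → ℝ := fun ω => (n * m : ℝ)⁻¹ * ∑ a ∈ Finset.range n ×ˢ Finset.range m,
    hajekRemainder F D (X a.1 ω, Y a.2 ω) with hBdef
  have hAm : Measurable A := Measurable.const_mul
    (Finset.measurable_fun_sum _ fun a _ => hgm a.1 a.2) _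
  have hBm : Measurable B := by fun_prop
  have havg : ∀ (f : ℕ × ℕ → ℝ) (c : ℝ), (∀ a, |f a| ≤ c) →
      |(n * m : ℝ)⁻¹ * ∑ a ∈ Finset.range n ×ˢ Finset.range m, f a| ≤ c := by
    intro f c hf
    rw [abs_mul, abs_of_nonneg (by positivity : 0 ≤ (n * m : ℝ)⁻¹), inv_mul_le_iff₀ (by positivity)]
    refine (Finset.abs_sum_le_sum_abs _ _).trans ((Finset.sum_le_sum fun a _ => hf a).trans_eq ?_)
    simp
  have hAb : ∀ ω, |A ω| ≤ 1 := fun ω => havg _ _ fun a => abs_orderGap_le_one _ _ _ _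
  have hBb : ∀ ω, |B ω| ≤ 2 := fun ω => havg _ _ fun a => abs_hajekRemainder_le _
  have hA2 : Integrable (fun ω => A ω ^ 2) P :=
    integrable_of_measurable_of_abs_le_const (c := 1 ^ 2) (by fun_prop) fun ω => by
      rw [abs_pow]; exact pow_le_pow_left₀ (abs_nonneg _) (hAb ω) 2
  have hB2 : Integrable (fun ω => B ω ^ 2) P :=
    integrable_of_measurable_of_abs_le_const (c := 2 ^ 2) (by fun_prop) fun ω => by
      rw [abs_pow]; exact pow_le_pow_left₀ (abs_nonneg _) (hBb ω) 2
  set σ : ℝ := 1 / (n : ℝ) + 1 / m with hσ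
  have hσ0 : 0 < σ := by positivity
  have hle : ∫ ω, (√12 * (√σ)⁻¹ * (A ω + B ω)) ^ 2 ∂P ≤
      ∫ ω, (24 / σ) * (A ω ^ 2 + B ω ^ 2) ∂P := by
    refine integral_mono_of_nonneg (ae_of_all _ fun ω => sq_nonneg _)
      ((hA2.add hB2).const_mul _) (ae_of_all _ fun ω => ?_)
    simp only
    rw [mul_pow, mul_pow, inv_pow, Real.sq_sqrt hσ0.le, Real.sq_sqrt (by norm_num)]
    calc 12 * σ⁻¹ * (A ω + B ω) ^ 2 ≤ 12 * σ⁻¹ * (2 * (A ω ^ 2 + B ω ^ 2)) := by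
          gcongr
          nlinarith [sq_nonneg (A ω - B ω)]
      _ = 24 / σ * (A ω ^ 2 + B ω ^ 2) := by ring
  refine ⟨integrable_of_measurable_of_abs_le_const (c := (√12 * (√σ)⁻¹ * (1 + 2)) ^ 2)
    (by fun_prop) fun ω => ?_, hle.trans ?_⟩
  · rw [abs_pow, abs_mul, abs_of_nonneg (by positivity : 0 ≤ √12 * (√σ)⁻¹)]
    gcongr
    exact (abs_add_le _ _).trans (add_le_add (hAb ω) (hBb ω))
  rw [integral_const_mul, integral_add hA2 hB2]
  have hbound : η / 144 / n + η / 144 * σ + 4 / (n * m) ≤ (η / 24) * σ := by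
    have e1 : η / 144 / n ≤ η / 144 * σ := by
      rw [div_eq_mul_one_div]
      gcongr
      rw [hσ]
      have : (0 : ℝ) < 1 / m := by positivity
      linarith
    have e2 : 4 / (n * m : ℝ) ≤ η / 36 * σ := by
      have : 144 / η < n := hn₁.trans_le (by exact_mod_cast hnn₁)
      rw [div_lt_iff₀ hη] at this
      have e3 : η / 36 * σ = η * (n + m) / 36 / (n * m) := by
        rw [hσ]
        field_simp
        ring
      rw [e3]
      gcongr
      nlinarith
    linarith
  calc 24 / σ * ((∫ ω, A ω ^ 2 ∂P) + ∫ ω, B ω ^ 2 ∂P)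
      ≤ 24 / σ * ((η / 24) * σ) := by
        gcongr
        linarith
    _ = η := by field_simp

theorem measurable_sphereInf_empirical (hc : Continuous h) {X : ℕ → Ω → E}
    (hX : ∀ i, Measurable (X i)) {V : Ω → E} (hV : Measurable V) (n : ℕ) :
    Measurable fun ω =>
      sphereInf r (potential h (finiteEmpirical fun k : Fin n => X k ω)) (V ω) := by
  have h1 := (continuous_sphereInf_potential_finiteEmpirical (ι := Fin n) hc r).measurable
  have h2 : Measurable fun ω => ((fun k : Fin n => X k ω), V ω) := by fun_prop
  have h3 := h1.comp h2
  exact h3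

theorem tendstoInDistribution_average_leIndicator (hh : ContDiff ℝ (⊤ : ℕ∞) h) (h0 : ∀ v, 0 ≤ h v)
    (h1 : ∀ v, h v ≤ 1) (hR : ∀ᵐ z ∂F, ‖z‖ ≤ R)
    (hA : ∀ a b, a ≤ b → F.real {z | sphereInf r (potential h F) z ∈ Set.Icc a b} ≤ C * (b - a))
    (hC : 0 < C) {X Y : ℕ → Ω → E} (hX : ∀ i, Measurable (X i)) (hY : ∀ j, Measurable (Y j))
    (hXF : ∀ i, P.map (X i) = F) (hYF : ∀ j, P.map (Y j) = F)
    (hi : iIndepFun (Sum.elim X Y) P) :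
    TendstoInDistribution (fun (p : ℕ × ℕ) ω => √12 * (√(1 / (p.1 : ℝ) + 1 / p.2))⁻¹ *
      ((p.1 * p.2 : ℝ)⁻¹ * ∑ a ∈ Finset.range p.1 ×ˢ Finset.range p.2,
          leIndicator
            (sphereInf r (potential h (finiteEmpirical fun k : Fin p.1 => X k ω)) (X a.1 ω))
            (sphereInf r (potential h (finiteEmpirical fun k : Fin p.1 => X k ω)) (Y a.2 ω)) -
        1 / 2)) (atTop ×ˢ atTop) (id : ℝ → ℝ) (fun _ => P) (gaussianReal 0 1) := by
  have hc : Continuous h := hh.continuous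
  have habs : ∀ v, |h v| ≤ 1 := fun v => abs_le.2 ⟨by linarith [h0 v], h1 v⟩
  have hDm : Measurable (sphereInf r (potential h F)) :=
    (continuous_sphereInf_right (continuous_potential hc habs F)).measurable
  have hD0 := measureReal_eq_singleton_zero hA
  have hlin := tendstoInDistribution_depthRank hDm hD0 hX hY hXF hYF hi
  refine tendstoInDistribution_of_tendstoInMeasure_sub _ _ hlin ?_ fun p => ?_
  · refine tendstoInMeasure_zero_of_integral_sq_le fun η hη => ?_
    filter_upwards [eventually_integral_sq_remainder_le hh h0 h1 hR hA hC hX hY hXF hYF hi hη,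
      prod_mem_prod (Ici_mem_atTop 1) (Ici_mem_atTop 1)] with p hp hp1
    obtain ⟨n, m⟩ := p
    obtain ⟨hn, hm⟩ := hp1
    simp only [Set.mem_Ici] at hn hm
    convert hp using 6 with ω ω
    all_goals
      rw [Pi.sub_apply, Pi.sub_apply, average_leIndicator_sub_half_eq (F := F)
        (D := sphereInf r (potential h F)) hn hm _ (fun i => X i ω) fun j => Y j ω]
      ring
  · refine Measurable.aemeasurable (Measurable.const_mul (Measurable.sub_const
      (Measurable.const_mul (Finset.measurable_fun_sum _ fun a _ => ?_) _) _) _)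
    exact Measurable.leIndicator (measurable_sphereInf_empirical hc hX (hX a.1) p.1)
      (measurable_sphereInf_empirical hc hX (hY a.2) p.1)

end Main

/-- The quality index of two empirical distributions is an average of comparisons. -/
theorem qualityIndex_empiricalDistribution {E : Type*} [MeasurableSpace E]
    [MeasurableSingletonClass E] {D : E → Measure E → ℝ} {n m : ℕ} (x y : ℕ → E)
    (hD : Measurable fun z => D z (empiricalDistribution fun i : Fin n => x i)) :
    qualityIndex D (empiricalDistribution fun i : Fin n => x i)
        (empiricalDistribution fun j : Fin m => y j) =
      (n * m : ℝ)⁻¹ * ∑ a ∈ Finset.range n ×ˢ Finset.range m,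
        leIndicator (D (x a.1) (empiricalDistribution fun i : Fin n => x i))
          (D (y a.2) (empiricalDistribution fun i : Fin n => x i)) := by
  rcases Nat.eq_zero_or_pos n with rfl | hn
  · simp [qualityIndex, empiricalDistribution]
  rcases Nat.eq_zero_or_pos m with rfl | hm
  · simp [qualityIndex, empiricalDistribution]
  have : Nonempty (Fin n) := ⟨⟨0, hn⟩⟩
  have : Nonempty (Fin m) := ⟨⟨0, hm⟩⟩
  rw [qualityIndex]
  simp only [← finiteEmpirical_fin] at hD ⊢
  set μ := finiteEmpirical fun i : Fin n => x i
  rw [measureReal_prod_eq_integral _ _ (measurableSet_le (by fun_prop) (by fun_prop)),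
    integral_finiteEmpirical, Fintype.card_fin, smul_eq_mul, ← Finset.sum_range (n := n) fun i =>
      (finiteEmpirical fun j : Fin m => y j).real (Prod.mk (x i) ⁻¹' {p | D p.1 μ ≤ D p.2 μ}),
    Finset.sum_product, mul_inv, mul_assoc, Finset.mul_sum (Finset.range n) _ (m : ℝ)⁻¹]
  congr 1
  refine Finset.sum_congr rfl fun i _ => ?_
  have hs : MeasurableSet {z | D (x i) μ ≤ D z μ} := measurableSet_le measurable_const hD
  have e := integral_ite_one_zero (μ := finiteEmpirical fun j : Fin m => y j) hs
  rw [integral_finiteEmpirical, Fintype.card_fin, smul_eq_mul,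
    ← Finset.sum_range (n := m) fun j => if D (x i) μ ≤ D (y j) μ then (1 : ℝ) else 0] at e
  exact e.symm

theorem sphereInf_mem_Icc {E : Type*} [NormedAddCommGroup E] [ProperSpace E] {r : ℝ} {g : E → ℝ}
    (hg : Continuous g) (h0 : ∀ c, 0 ≤ g c) (h1 : ∀ c, g c ≤ 1) (z : E) :
    sphereInf r g z ∈ Set.Icc (0 : ℝ) 1 := by
  refine ⟨Real.iInf_nonneg fun c => h0 c, ?_⟩
  rw [sphereInf]
  rcases isEmpty_or_nonempty (Metric.sphere z r) with hE | ⟨⟨c⟩⟩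
  · rw [Real.iInf_of_isEmpty]
    exact zero_le_one
  · exact (ciInf_le (bddBelow_range_sphere hg z) c).trans (h1 c)

/-- The bound of the probability of intervals extends from `[0, 1]` to the real line. -/
theorem exists_forall_measureReal_Icc_le {α : Type*} [MeasurableSpace α] {F : Measure α}
    [IsProbabilityMeasure F] {D : α → ℝ} (hD : ∀ z, D z ∈ Set.Icc (0 : ℝ) 1) {C : ℝ}
    (hC : ∀ a ∈ Set.Icc (0 : ℝ) 1, ∀ b ∈ Set.Icc (0 : ℝ) 1,
      F.real {z | a ≤ D z ∧ D z ≤ b} ≤ C * |b - a|) :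
    ∀ a b, a ≤ b → F.real {z | D z ∈ Set.Icc a b} ≤ max C 1 * (b - a) := by
  intro a b hab
  have hC1 : 0 ≤ max C 1 := zero_le_one.trans (le_max_right _ _)
  by_cases h : 0 ≤ b ∧ a ≤ 1
  · have ha : max a 0 ∈ Set.Icc (0 : ℝ) 1 := ⟨le_max_right _ _, max_le h.2 zero_le_one⟩
    have hb : min b 1 ∈ Set.Icc (0 : ℝ) 1 := ⟨le_min h.1 zero_le_one, min_le_right _ _⟩
    have hle : max a 0 ≤ min b 1 := max_le (le_min hab h.2) (le_min h.1 zero_le_one)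
    have hsub : {z | D z ∈ Set.Icc a b} ⊆ {z | max a 0 ≤ D z ∧ D z ≤ min b 1} := fun z hz =>
      ⟨max_le hz.1 (hD z).1, le_min hz.2 (hD z).2⟩
    refine (measureReal_mono hsub).trans ((hC _ ha _ hb).trans ?_)
    rw [abs_of_nonneg (sub_nonneg.2 hle)]
    have : min b 1 - max a 0 ≤ b - a := by linarith [min_le_left b 1, le_max_left a 0]
    calc C * (min b 1 - max a 0) ≤ max C 1 * (min b 1 - max a 0) :=
          mul_le_mul_of_nonneg_right (le_max_left _ _) (sub_nonneg.2 hle)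
      _ ≤ max C 1 * (b - a) := mul_le_mul_of_nonneg_left this hC1
  · have hempty : {z | D z ∈ Set.Icc a b} = ∅ := by
      refine Set.eq_empty_of_forall_notMem fun z hz => h ⟨?_, ?_⟩
      · exact (hD z).1.trans hz.2
      · exact hz.1.trans (hD z).2
    rw [hempty, measureReal_empty]
    exact mul_nonneg hC1 (sub_nonneg.2 hab)

/-- The smooth radial window whose translates define the sigmoid sphere depth. -/
noncomputable def sigmoidWindow {E : Type*} [NormedAddCommGroup E] (r s : ℝ) (v : E) : ℝ :=
  Real.sigmoid ((r ^ 2 - ‖v‖ ^ 2) / s)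

theorem contDiff_sigmoidWindow {E : Type*} [NormedAddCommGroup E] [InnerProductSpace ℝ E]
    (r s : ℝ) : ContDiff ℝ (⊤ : ℕ∞) (sigmoidWindow r s : E → ℝ) := by
  have h1 : ContDiff ℝ (⊤ : ℕ∞) Real.sigmoid :=
    contDiff_iff_contDiffAt.2 fun x => analyticAt_sigmoid.contDiffAt
  have h2 : ContDiff ℝ (⊤ : ℕ∞) fun v : E => (r ^ 2 - ‖v‖ ^ 2) / s :=
    (contDiff_const.sub (contDiff_norm_sq ℝ)).div_const s
  exact h1.comp h2

theorem sphereDepth_eq_sphereInf {d : ℕ} (r s : ℝ) (z : EuclideanSpace ℝ (Fin d))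
    (μ : Measure (EuclideanSpace ℝ (Fin d))) :
    sphereDepth r s z μ = sphereInf r (potential (sigmoidWindow r s) μ) z :=
  rfl

theorem rpow_neg_half_mul_eq {σ : ℝ} (hσ : 0 ≤ σ) :
    ((1 / 12 : ℝ) * σ) ^ (-(1 / 2) : ℝ) = √12 * (√σ)⁻¹ := by
  rw [Real.rpow_neg (by positivity), ← Real.sqrt_eq_rpow, Real.sqrt_mul (by norm_num), mul_inv,
    Real.sqrt_div zero_le_one, Real.sqrt_one, one_div, inv_inv]

theorem mainTheorem2 {d : ℕ} (r s : ℝ) (hr : 0 < r) (hs : 0 < s)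
    (F : Measure (EuclideanSpace ℝ (Fin d))) [IsProbabilityMeasure F]
    (hac : F ≪ volume) (hbdd : Bornology.IsBounded F.support)
    (hA1 : DepthA1 (sphereDepth r s) F)
    {Ω : Type*} [MeasurableSpace Ω] (P : Measure Ω) [IsProbabilityMeasure P]
    (X Y : ℕ → Ω → EuclideanSpace ℝ (Fin d))
    (hX : ∀ i, HasLaw (X i) F P) (hY : ∀ j, HasLaw (Y j) F P)
    (hindep : iIndepFun (fun k : ℕ ⊕ ℕ => Sum.elim X Y k) P) :
    TendstoInDistribution
      (fun (p : ℕ × ℕ) (ω : Ω) =>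
        ((1 / 12 : ℝ) * (1 / (p.1 : ℝ) + 1 / (p.2 : ℝ))) ^ (-(1 / 2) : ℝ) *
          (qualityIndex (sphereDepth r s)
              (empiricalDistribution fun i : Fin p.1 => X i ω)
              (empiricalDistribution fun j : Fin p.2 => Y j ω)
            - qualityIndex (sphereDepth r s) F F))
      (atTop ×ˢ atTop) (id : ℝ → ℝ) (fun _ => P) (gaussianReal 0 1) := by
  set h : EuclideanSpace ℝ (Fin d) → ℝ := sigmoidWindow r s with hh
  have hsmooth : ContDiff ℝ (⊤ : ℕ∞) h := contDiff_sigmoidWindow r s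
  have hc : Continuous h := hsmooth.continuous
  have h0 : ∀ v, 0 ≤ h v := fun v => Real.sigmoid_nonneg _
  have h1 : ∀ v, h v ≤ 1 := fun v => Real.sigmoid_le_one _
  have habs : ∀ v, |h v| ≤ 1 := fun v => abs_le.2 ⟨by linarith [h0 v], h1 v⟩
  obtain ⟨R, hR⟩ := hbdd.exists_norm_le
  have hRae : ∀ᵐ z ∂F, ‖z‖ ≤ R := by
    have : ∀ᵐ z ∂F, z ∈ F.support := Measure.support_mem_ae
    filter_upwards [this] with z hz using hR z hz
  have hpotc : Continuous (potential h F) := continuous_potential hc habs F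
  have hDm : Measurable (sphereInf r (potential h F)) :=
    (continuous_sphereInf_right hpotc).measurable
  have hD01 : ∀ z, sphereInf r (potential h F) z ∈ Set.Icc (0 : ℝ) 1 :=
    sphereInf_mem_Icc hpotc (fun c => integral_nonneg fun x => h0 _) fun c => by
      refine (integral_mono_of_nonneg (ae_of_all _ fun x => h0 _) (integrable_const (1 : ℝ))
        (ae_of_all _ fun x => h1 _)).trans ?_
      simp
  obtain ⟨C, hC⟩ := hA1
  have hA := exists_forall_measureReal_Icc_le hD01 hC
  have hC0 : 0 < max C 1 := zero_lt_one.trans_le (le_max_right _ _)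
  have hQ : qualityIndex (sphereDepth r s) F F = 1 / 2 := by
    have hlei := integral_leIndicator_of_noAtoms hDm (measureReal_eq_singleton_zero hA)
    have hs : MeasurableSet {p : EuclideanSpace ℝ (Fin d) × EuclideanSpace ℝ (Fin d) |
      sphereInf r (potential h F) p.1 ≤ sphereInf r (potential h F) p.2} :=
      measurableSet_le (by fun_prop) (by fun_prop)
    rw [← hlei]
    exact (integral_ite_one_zero hs).symm
  choose X' hX'm hX' using fun i => (hX i).aemeasurable
  choose Y' hY'm hY' using fun j => (hY j).aemeasurable
  have hXF : ∀ i, P.map (X' i) = F := fun i => by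
    rw [← Measure.map_congr (hX' i), (hX i).map_eq]
  have hYF : ∀ j, P.map (Y' j) = F := fun j => by
    rw [← Measure.map_congr (hY' j), (hY j).map_eq]
  have hi : iIndepFun (Sum.elim X' Y') P := by
    refine hindep.congr fun k => ?_
    cases k with
    | inl i => exact hX' i
    | inr j => exact hY' j
  refine (tendstoInDistribution_average_leIndicator hsmooth h0 h1 hRae hA hC0 hX'm hY'm hXF hYF
    hi).congr (fun p => ?_) (ae_eq_refl _)
  filter_upwards [ae_all_iff.2 hX', ae_all_iff.2 hY'] with ω hωX hωY
  have hcont := continuous_sphereInf_right (r := r)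
    (continuous_potential_finiteEmpirical hc fun i : Fin p.1 => X' i ω)
  simp only [hωX, hωY]
  rw [hQ, rpow_neg_half_mul_eq (by positivity), qualityIndex_empiricalDistribution
    (fun i => X' i ω) (fun j => Y' j ω)]
  · simp only [← finiteEmpirical_fin, sphereDepth_eq_sphereInf, hh]
  · rw [← finiteEmpirical_fin]
    exact hcont.measurable
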